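/- Let $\mathbf X=(X_{ij})_{i,j=1}^n$, $n\ge 1$, be a real random matrix that satisfies condition (C0) with parameters $\rho$ and $M_4$, that is: (a) the pairs $(X_{ij},X_{ji})$, $1\le i<j\le n$, are independent identically distributed random vectors; (b) $\mathbb E X_{ij}=0$, $\mathbb E X_{ij}^2=1$ and $\mathbb E|X_{ij}|^4\le M_4$ for $i\ne j$; (c) $\mathbb E(X_{ij}X_{ji})=\rho$ for $i\ne j$; (d) the diagonal entries $X_{ii}$ are independent identically distributed, the diagonal is independent of the off-diagonal entries, $\mathbb E X_{ii}=0$ and $\mathbb E X_{ii}^2<\infty$. Assume $|\rho|<1$ and let $K>1$. There are constants $C(\rho),C_1(\rho)>0$, which depend only on $\rho$, $K$ and $M_4$, such that for every $n\ge1$, every such matrix $\mathbf X$, every $z\in\mathbb C$ and every $\varepsilon>0$ the matrix $\mathbf A=\mathbf X-z\mathbf I$ satisfies $$\mathbb P\bigl(s_n(\mathbf A)\le\varepsilon n^{-1/2},\ \|\mathbf A\|\le 3K\sqrt n\bigr)\le C(\rho)\,\varepsilon^{1/8}+C_1(\rho)\,n^{-1/8}.$$ Here $s_1(\mathbf A)\ge\dots\ge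 s_n(\mathbf A)$ are the singular values of $\mathbf A$, so that $s_n(\mathbf A)=\inf_{\|x\|_2=1}\|\mathbf A x\|_2$, and $\|\mathbf A\|=\sup_{\|x\|_2=1}\|\mathbf A x\|_2$ is the spectral norm. -/

import Mathlib

open MeasureTheory ProbabilityTheory

/-- Condition (C0) on a real random `n × n` matrix `X`, with correlation `ρ` and a bound `M₄` for
the fourth moments of the off-diagonal entries. "The pairs are i.i.d." is read over `i < j`: the
pair `(X i j, X j i)` is listed once, so `X i j` and `X j i` may have different laws. The moments
are written for all pairs, which by identical distribution is the same as for one pair. -/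
structure ConditionC0 {Ω : Type*} [MeasurableSpace Ω] (P : Measure Ω) {n : ℕ}
    (X : Ω → Matrix (Fin n) (Fin n) ℝ) (ρ M₄ : ℝ) : Prop where
  measurable : ∀ i j, Measurable fun ω => X ω i j
  /-- a) the pairs `(X i j, X j i)`, `i < j`, are independent -/
  pairs_indep : iIndepFun
    (fun (p : {p : Fin n × Fin n // p.1 < p.2}) ω => (X ω p.1.1 p.1.2, X ω p.1.2 p.1.1)) P
  /-- a) the pairs `(X i j, X j i)`, `i < j`, are identically distributed -/
  pairs_identDistrib : ∀ i j k l : Fin n, i < j → k < l →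
    IdentDistrib (fun ω => (X ω i j, X ω j i)) (fun ω => (X ω k l, X ω l k)) P P
  /-- b) the off-diagonal entries have finite fourth moments -/
  memLp_four : ∀ i j, i ≠ j → MemLp (fun ω => X ω i j) 4 P
  /-- b) the off-diagonal entries are centred -/
  mean_eq_zero : ∀ i j, i ≠ j → ∫ ω, X ω i j ∂P = 0
  /-- b) the off-diagonal entries have unit variance -/
  second_moment : ∀ i j, i ≠ j → ∫ ω, X ω i j ^ 2 ∂P = 1
  /-- b) the fourth moments of the off-diagonal entries are at most `M₄` -/
  fourth_moment : ∀ i j, i ≠ j → ∫ ω, X ω i j ^ 4 ∂P ≤ M₄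
  /-- c) the correlation within a pair is `ρ` -/
  correlation : ∀ i j, i ≠ j → ∫ ω, X ω i j * X ω j i ∂P = ρ
  abs_correlation_le : |ρ| ≤ 1
  /-- d) the diagonal entries are independent -/
  diag_indep : iIndepFun (fun (i : Fin n) ω => X ω i i) P
  /-- d) the diagonal entries are identically distributed -/
  diag_identDistrib : ∀ i k : Fin n, IdentDistrib (fun ω => X ω i i) (fun ω => X ω k k) P P
  /-- d) the diagonal is independent of the off-diagonal entries -/
  diag_indep_offDiag : IndepFun (fun ω (i : Fin n) => X ω i i)
    (fun ω (p : {p : Fin n × Fin n // p.1 ≠ p.2}) => X ω p.1.1 p.1.2) P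
  /-- d) the diagonal entries have finite second moment -/
  diag_memLp_two : ∀ i, MemLp (fun ω => X ω i i) 2 P
  /-- d) the diagonal entries are centred -/
  diag_mean_eq_zero : ∀ i, ∫ ω, X ω i i ∂P = 0

/-- The shifted matrix `X - z I`, as a complex matrix. -/
noncomputable def shiftedMatrix {n : ℕ} (X : Matrix (Fin n) (Fin n) ℝ) (z : ℂ) :
    Matrix (Fin n) (Fin n) ℂ :=
  X.map (fun x : ℝ => (x : ℂ)) - z • (1 : Matrix (Fin n) (Fin n) ℂ)

/-- The spectral norm of a complex square matrix: its operator norm on Euclidean space. -/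
noncomputable def spectralNorm2 {n : ℕ} (A : Matrix (Fin n) (Fin n) ℂ) : ℝ :=
  ‖Matrix.toEuclideanCLM (n := Fin n) (𝕜 := ℂ) A‖

/-- The smallest singular value `s_n(A)` of an `n × n` matrix, `n ≥ 1`. Mathlib lists the singular
values in decreasing order, starting at index `0`. -/
noncomputable def smallestSingularValue {n : ℕ} (A : Matrix (Fin n) (Fin n) ℂ) : ℝ :=
  (Matrix.toEuclideanLin A).singularValues (n - 1)

/-! The diagonal is independent of the other entries, so it may be frozen, and the shift by `z`
joins it. What remains is `A = withDiag X d` of size `n`, with a deterministic diagonal `d`. Unit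
vectors are divided according to whether a fixed proportion of their coordinates is at least of
order `1/√n` (`Spread`).

Unit vectors that are not spread lie close to few grid points: coordinates below `a/√n` are dropped,
the others are rounded, and the number of resulting points is exponential in `n` with a rate as
small as desired. If `T` is the support of a grid point, the rows outside `T` meet the columns in
`T` at positions no two of which are transposes of each other, so the entries there are independent.
Hence a short image of one grid point is exponentially unlikely, and a union bound finishes
(`exists_not_spread_le`). Because images close to a fixed line are treated too, the same estimate
shows that solutions of `B x = w` and `Bᵀ x = w` with fixed `w` are spread
(`exists_inv_not_spread_le`).

If `x` is spread and `A x` is short, then for many `k` the `k`-th column lies close to the span of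
the others. By `norm_mul_schur_le` the distance is `|A k k - vᵀ G u| / √(1 + |Gᵀ v|²)`, where `u`
and `v` are the `k`-th column and row without the diagonal entry and `G` is the inverse of the
complementary minor, which is independent of `(u, v)`. Averaging over `k` reduces the theorem to
`exists_schur_smallBall`.

The form `vᵀ G u` is a sum over correlated pairs `(u i, v i)`, so `u` cannot be frozen while `v`
stays random. Instead the coordinates in a set `J` are sampled twice (`sq_measureReal_pi_le`). The
square of the small ball probability is at most the probability that both values of the form are
close to `z`; then their difference is small, and this difference is affine in the coordinates
outside `J`. Its coefficient vectors are `G` and `Gᵀ` applied to differences of samples. They are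
spread with high probability, and for one of boundedly many sets `J` the first is rarely much
shorter than the Hilbert–Schmidt norm of `G` (`exists_l2_mulVec_smallBall`). Markov's inequality
controls the denominator by the same norm, which therefore cancels.

Linear forms with many comparable coefficients are handled by an Esseen inequality
(`exists_smallBall`). The assumption `|ρ| < 1` enters there: it bounds the covariance of a pair from
below, so that the characteristic function decays. The exponent `1/8` in `ε` comes from a length
threshold of relative size `ε^(1/4)`, followed by the square root from decoupling. -/

/-! ### Moments and characteristic function of a correlated pair -/

/-- A pair of centred real random variables with unit variances, fourth moments at most `M` and
correlation at most `ρ` in absolute value. -/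
structure PairMoments {Ω : Type*} [MeasurableSpace Ω] (P : Measure Ω) (U V : Ω → ℝ)
    (ρ M : ℝ) : Prop where
  measurable_left : Measurable U
  measurable_right : Measurable V
  memLp_left : MemLp U 4 P
  memLp_right : MemLp V 4 P
  mean_left : ∫ ω, U ω ∂P = 0
  mean_right : ∫ ω, V ω ∂P = 0
  var_left : ∫ ω, U ω ^ 2 ∂P = 1
  var_right : ∫ ω, V ω ^ 2 ∂P = 1
  fourth_left : ∫ ω, U ω ^ 4 ∂P ≤ M
  fourth_right : ∫ ω, V ω ^ 4 ∂P ≤ M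
  corr : |∫ ω, U ω * V ω ∂P| ≤ ρ

/-- The quadratic bound valid on `[-π, π]` extends to the whole line by a quartic term that
outweighs the quadratic one beyond `π`. In expectation the variance then yields the decay, and the
fourth moment is a higher order error. -/
lemma cos_le_quartic (x : ℝ) :
    Real.cos x ≤ 1 - 2 / Real.pi ^ 2 * x ^ 2 + 2 / Real.pi ^ 4 * x ^ 4 := by
  have hp := Real.pi_pos
  rcases le_or_gt |x| Real.pi with h | h
  · have := Real.cos_le_one_sub_mul_cos_sq h
    have : 0 ≤ 2 / Real.pi ^ 4 * x ^ 4 := by positivity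
    linarith
  · have h1 := Real.cos_le_one x
    have h2 : Real.pi ^ 2 ≤ x ^ 2 := by
      rw [← sq_abs x]; gcongr
    have : 2 / Real.pi ^ 4 * x ^ 4 - 2 / Real.pi ^ 2 * x ^ 2
        = 2 / Real.pi ^ 4 * x ^ 2 * (x ^ 2 - Real.pi ^ 2) := by
      field_simp
    have : 0 ≤ 2 / Real.pi ^ 4 * x ^ 2 * (x ^ 2 - Real.pi ^ 2) := by
      apply mul_nonneg (by positivity); linarith
    linarith

/-- For centred `Y` the linear term drops out, so `E sin Y` is bounded by the second moment. Its
square is then of second order in the variance and can be absorbed. -/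
lemma abs_sin_sub_self_le_sq (y : ℝ) : |Real.sin y - y| ≤ y ^ 2 := by
  have key : ∀ y : ℝ, 0 ≤ y → |Real.sin y - y| ≤ y ^ 2 := by
    intro y hy
    rcases hy.eq_or_lt with rfl | hy
    · simp
    have h1 := Real.sin_lt hy
    rw [abs_of_neg (by linarith)]
    rcases le_or_gt y 2 with h | h
    · have := Real.sin_gt_sub_cube hy
      nlinarith [sq_nonneg y]
    · have := Real.neg_one_le_sin y
      nlinarith
  rcases le_total 0 y with h | h
  · exact key y h
  · have := key (-y) (by linarith)
    rw [Real.sin_neg, ← abs_neg] at this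
    ring_nf at this ⊢
    exact this

namespace PairMoments

variable {Ω : Type*} [MeasurableSpace Ω] {P : Measure Ω} {U V : Ω → ℝ} {ρ M : ℝ}

lemma symm (h : PairMoments P U V ρ M) : PairMoments P V U ρ M :=
  ⟨h.2, h.1, h.4, h.3, h.6, h.5, h.8, h.7, h.10, h.9, by simpa [mul_comm] using h.11⟩

lemma map (h : PairMoments P U V ρ M) :
    PairMoments (P.map fun ω => (U ω, V ω)) Prod.fst Prod.snd ρ M := by
  have hm : Measurable fun ω => (U ω, V ω) := h.1.prodMk h.2
  have hi : ∀ f : ℝ × ℝ → ℝ, Measurable f →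
      ∫ z, f z ∂(P.map fun ω => (U ω, V ω)) = ∫ ω, f (U ω, V ω) ∂P := fun f hf =>
    integral_map hm.aemeasurable hf.aestronglyMeasurable
  refine ⟨measurable_fst, measurable_snd, ?_, ?_, ?_, ?_, ?_, ?_, ?_, ?_, ?_⟩
  · exact (memLp_map_measure_iff measurable_fst.aestronglyMeasurable hm.aemeasurable).2 h.3
  · exact (memLp_map_measure_iff measurable_snd.aestronglyMeasurable hm.aemeasurable).2 h.4
  · rw [hi _ (by fun_prop)]; exact h.5
  · rw [hi _ (by fun_prop)]; exact h.6
  · rw [hi _ (by fun_prop)]; exact h.7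
  · rw [hi _ (by fun_prop)]; exact h.8
  · rw [hi _ (by fun_prop)]; exact h.9
  · rw [hi _ (by fun_prop)]; exact h.10
  · rw [hi _ (by fun_prop)]; exact h.11

lemma integrable_pow_four_of_memLp {W : Ω → ℝ} (h : MemLp W 4 P) :
    Integrable (fun ω => W ω ^ 4) P := by
  have := h.integrable_norm_pow (p := 4) (by norm_num)
  refine this.congr (Filter.Eventually.of_forall fun ω => ?_)
  simp only [Real.norm_eq_abs]
  exact (show Even 4 by decide).pow_abs (W ω)

lemma memLp_comb (h : PairMoments P U V ρ M) (a b : ℝ) :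
    MemLp (fun ω => a * U ω + b * V ω) 4 P :=
  (h.memLp_left.const_mul a).add (h.memLp_right.const_mul b)

lemma fourth_moment_comb_le (h : PairMoments P U V ρ M) (a b : ℝ) :
    ∫ ω, (a * U ω + b * V ω) ^ 4 ∂P ≤ 8 * M * (a ^ 2 + b ^ 2) ^ 2 := by
  have h1 := integrable_pow_four_of_memLp h.memLp_left
  have h2 := integrable_pow_four_of_memLp h.memLp_right
  have hM : 0 ≤ M := le_trans (integral_nonneg fun ω => by positivity) h.fourth_left
  calc ∫ ω, (a * U ω + b * V ω) ^ 4 ∂P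
      ≤ ∫ ω, (8 * a ^ 4 * U ω ^ 4 + 8 * b ^ 4 * V ω ^ 4) ∂P := by
        refine integral_mono (integrable_pow_four_of_memLp (h.memLp_comb a b))
          ((h1.const_mul _).add (h2.const_mul _)) fun ω => ?_
        have h3 : ∀ x y : ℝ, (x + y) ^ 4 ≤ 8 * x ^ 4 + 8 * y ^ 4 := fun x y => by
          nlinarith [sq_nonneg (x ^ 2 - y ^ 2), sq_nonneg (x - y), sq_nonneg ((x - y) ^ 2),
            sq_nonneg (x + y), mul_nonneg (sq_nonneg (x - y)) (sq_nonneg (x + y))]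
        have := h3 (a * U ω) (b * V ω)
        simp only [mul_pow] at this
        show (a * U ω + b * V ω) ^ 4 ≤ _
        linarith
    _ = 8 * a ^ 4 * ∫ ω, U ω ^ 4 ∂P + 8 * b ^ 4 * ∫ ω, V ω ^ 4 ∂P := by
        rw [integral_add (h1.const_mul _) (h2.const_mul _), integral_const_mul,
          integral_const_mul]
    _ ≤ 8 * a ^ 4 * M + 8 * b ^ 4 * M := by
        have := h.fourth_left
        have := h.fourth_right
        gcongr
    _ ≤ 8 * M * (a ^ 2 + b ^ 2) ^ 2 := by
        have : 0 ≤ M * (a ^ 2 * b ^ 2) := by positivity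
        nlinarith

variable [IsProbabilityMeasure P]

lemma memLp_two_left (h : PairMoments P U V ρ M) : MemLp U 2 P :=
  h.memLp_left.mono_exponent (by norm_num)

lemma integrable_left (h : PairMoments P U V ρ M) : Integrable U P :=
  h.memLp_left.integrable (by norm_num)

lemma mean_comb (h : PairMoments P U V ρ M) (a b : ℝ) :
    ∫ ω, (a * U ω + b * V ω) ∂P = 0 := by
  rw [integral_add (h.integrable_left.const_mul a) (h.symm.integrable_left.const_mul b),
    integral_const_mul, integral_const_mul, h.mean_left, h.mean_right]
  simp

lemma second_moment_comb (h : PairMoments P U V ρ M) (a b : ℝ) :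
    ∫ ω, (a * U ω + b * V ω) ^ 2 ∂P = a ^ 2 + b ^ 2 + 2 * a * b * ∫ ω, U ω * V ω ∂P := by
  have h1 := h.memLp_two_left.integrable_sq
  have h2 := h.symm.memLp_two_left.integrable_sq
  have h3 : Integrable (fun ω => U ω * V ω) P :=
    h.memLp_two_left.integrable_mul h.symm.memLp_two_left
  have : ∀ ω, (a * U ω + b * V ω) ^ 2
      = a ^ 2 * U ω ^ 2 + b ^ 2 * V ω ^ 2 + 2 * a * b * (U ω * V ω) := fun ω => by ring
  have h4 : Integrable (fun ω => a ^ 2 * U ω ^ 2 + b ^ 2 * V ω ^ 2) P :=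
    (h1.const_mul _).add (h2.const_mul _)
  simp_rw [this]
  rw [integral_add h4 (h3.const_mul _),
    integral_add (h1.const_mul _) (h2.const_mul _), integral_const_mul, integral_const_mul,
    integral_const_mul, h.var_left, h.var_right]
  ring

/-- The covariance matrix has unit diagonal, so its eigenvalues are `1 ± E(UV)`, both at least `1 -
ρ`. This is the source of all non-degeneracy in the proof. -/
lemma le_second_moment_comb (h : PairMoments P U V ρ M) (a b : ℝ) :
    (1 - ρ) * (a ^ 2 + b ^ 2) ≤ ∫ ω, (a * U ω + b * V ω) ^ 2 ∂P := by
  rw [h.second_moment_comb]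
  have h1 := abs_le.1 h.corr
  nlinarith [mul_nonneg (sub_nonneg.2 h1.2) (sq_nonneg (a - b)),
    mul_nonneg (neg_le_iff_add_nonneg.1 h1.1) (sq_nonneg (a + b))]

lemma second_moment_comb_le (h : PairMoments P U V ρ M) (hρ : ρ ≤ 1) (a b : ℝ) :
    ∫ ω, (a * U ω + b * V ω) ^ 2 ∂P ≤ 2 * (a ^ 2 + b ^ 2) := by
  rw [h.second_moment_comb]
  have h1 := abs_le.1 (h.corr.trans hρ)
  nlinarith [mul_nonneg (sub_nonneg.2 h1.2) (sq_nonneg (a + b)),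
    mul_nonneg (neg_le_iff_add_nonneg.1 h1.1) (sq_nonneg (a - b))]

end PairMoments

/-- The characteristic function of a linear combination of a non-degenerate pair decays like a
Gaussian near the origin. -/
theorem exists_norm_charFun_comb_le {ρ : ℝ} (hρ0 : 0 ≤ ρ) (hρ : ρ < 1) (M : ℝ) :
    ∃ c t : ℝ, 0 < c ∧ 0 < t ∧ ∀ (Ω : Type*) [MeasurableSpace Ω] (P : Measure Ω)
      [IsProbabilityMeasure P] (U V : Ω → ℝ), PairMoments P U V ρ M → ∀ a b : ℝ,
      a ^ 2 + b ^ 2 ≤ t →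
      ‖∫ ω, Complex.exp ((a * U ω + b * V ω : ℝ) * Complex.I) ∂P‖
        ≤ Real.exp (-c * (a ^ 2 + b ^ 2)) := by
  have hp := Real.pi_pos
  have hp3 := Real.pi_gt_three
  set κ : ℝ := 2 / Real.pi ^ 2 * (1 - ρ) with hκ
  have hκ0 : 0 < κ := mul_pos (by positivity) (by linarith)
  have hκ1 : κ ≤ 1 := by
    have : 2 / Real.pi ^ 2 ≤ 1 := by
      rw [div_le_one (by positivity)]; nlinarith
    calc κ ≤ 1 * 1 := by
          apply mul_le_mul this (by linarith) (by linarith) (by norm_num)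
      _ = 1 := by ring
  set D : ℝ := 2 / Real.pi ^ 4 * (8 * |M|) with hD
  have hD0 : 0 ≤ D := by positivity
  -- With `s = a² + b²`, the bound `s ≤ κ/(2(D+1))` gives `E cos ≤ 1 - κ s/2`. The bound `s ≤ κ/10`
  -- lets the sine contribution `4 s²` be absorbed, so that the squared modulus is at most `1 - κ
  -- s/2 ≤ exp(-κ s/2)`.
  refine ⟨κ / 4, min (κ / 10) (κ / (2 * (D + 1))), by positivity, by positivity, ?_⟩
  intro Ω _ P _ U V h a b hs
  set s := a ^ 2 + b ^ 2 with hsdef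
  have hs0 : 0 ≤ s := by positivity
  have hs1 : s ≤ κ / 10 := hs.trans (min_le_left _ _)
  have hs2 : (D + 1) * s ≤ κ / 2 := by
    have := hs.trans (min_le_right _ _)
    rw [le_div_iff₀ (by positivity)] at this
    linarith
  set Y : Ω → ℝ := fun ω => a * U ω + b * V ω with hY
  have hYm : Measurable Y := (h.1.const_mul a).add (h.2.const_mul b)
  have hY4 : MemLp Y 4 P := h.memLp_comb a b
  have hI4 := PairMoments.integrable_pow_four_of_memLp hY4
  have hI2 : Integrable (fun ω => Y ω ^ 2) P := (hY4.mono_exponent (by norm_num)).integrable_sq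
  have hI1 : Integrable Y P := hY4.integrable (by norm_num)
  have m2l : (1 - ρ) * s ≤ ∫ ω, Y ω ^ 2 ∂P := h.le_second_moment_comb a b
  have m2u : ∫ ω, Y ω ^ 2 ∂P ≤ 2 * s := h.second_moment_comb_le hρ.le a b
  have m4 : ∫ ω, Y ω ^ 4 ∂P ≤ 8 * |M| * s ^ 2 :=
    (h.fourth_moment_comb_le a b).trans (by gcongr; exact le_abs_self M)
  have hcosI : Integrable (fun ω => Real.cos (Y ω)) P := by
    refine (integrable_const (1 : ℝ)).mono (by fun_prop) (Filter.Eventually.of_forall fun ω => ?_)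
    simpa using Real.abs_cos_le_one _
  have hsinI : Integrable (fun ω => Real.sin (Y ω)) P := by
    refine (integrable_const (1 : ℝ)).mono (by fun_prop) (Filter.Eventually.of_forall fun ω => ?_)
    simpa using Real.abs_sin_le_one _
  have hcosu : ∫ ω, Real.cos (Y ω) ∂P ≤ 1 - κ * s + D * s ^ 2 := by
    have i1 : Integrable (fun ω => 1 - 2 / Real.pi ^ 2 * Y ω ^ 2) P :=
      (integrable_const _).sub (hI2.const_mul _)
    calc ∫ ω, Real.cos (Y ω) ∂P
        ≤ ∫ ω, (1 - 2 / Real.pi ^ 2 * Y ω ^ 2 + 2 / Real.pi ^ 4 * Y ω ^ 4) ∂P :=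
          integral_mono hcosI (i1.add (hI4.const_mul _)) fun ω => cos_le_quartic _
      _ = 1 - 2 / Real.pi ^ 2 * (∫ ω, Y ω ^ 2 ∂P) + 2 / Real.pi ^ 4 * ∫ ω, Y ω ^ 4 ∂P := by
          rw [integral_add i1 (hI4.const_mul _), integral_sub (integrable_const _)
            (hI2.const_mul _), integral_const_mul, integral_const_mul]
          simp
      _ ≤ 1 - 2 / Real.pi ^ 2 * ((1 - ρ) * s) + 2 / Real.pi ^ 4 * (8 * |M| * s ^ 2) := by
          gcongr
      _ = _ := by rw [hκ, hD]; ring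
  -- Nonnegativity is needed to square the upper bound.
  have hcosl : 0 ≤ ∫ ω, Real.cos (Y ω) ∂P := by
    calc (0 : ℝ) ≤ 1 - (∫ ω, Y ω ^ 2 ∂P) / 2 := by linarith
      _ = ∫ ω, (1 - Y ω ^ 2 / 2) ∂P := by
          rw [integral_sub (integrable_const _) (hI2.div_const _), integral_div]; simp
      _ ≤ _ := integral_mono ((integrable_const _).sub (hI2.div_const _)) hcosI fun ω =>
          Real.one_sub_sq_div_two_le_cos
  have hsin : |∫ ω, Real.sin (Y ω) ∂P| ≤ 2 * s := by
    have e : ∫ ω, Real.sin (Y ω) ∂P = ∫ ω, (Real.sin (Y ω) - Y ω) ∂P := by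
      rw [integral_sub hsinI hI1]
      have : ∫ ω, Y ω ∂P = 0 := h.mean_comb a b
      rw [this, sub_zero]
    rw [e]
    calc |∫ ω, (Real.sin (Y ω) - Y ω) ∂P| ≤ ∫ ω, |Real.sin (Y ω) - Y ω| ∂P :=
          abs_integral_le_integral_abs
      _ ≤ ∫ ω, Y ω ^ 2 ∂P := integral_mono (hsinI.sub hI1).abs hI2 fun ω =>
          abs_sin_sub_self_le_sq _
      _ ≤ 2 * s := m2u
  have hφ : ∫ ω, Complex.exp ((Y ω : ℝ) * Complex.I) ∂P
      = ((∫ ω, Real.cos (Y ω) ∂P : ℝ) : ℂ) + ((∫ ω, Real.sin (Y ω) ∂P : ℝ) : ℂ) * Complex.I := by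
    rw [← integral_complex_ofReal, ← integral_complex_ofReal, ← integral_mul_const,
      ← integral_add hcosI.ofReal (hsinI.ofReal.mul_const _)]
    congr 1 with ω
    rw [Complex.exp_mul_I]
    push_cast
    rfl
  have hn : ‖∫ ω, Complex.exp ((Y ω : ℝ) * Complex.I) ∂P‖ ^ 2
      = (∫ ω, Real.cos (Y ω) ∂P) ^ 2 + (∫ ω, Real.sin (Y ω) ∂P) ^ 2 := by
    rw [hφ, ← Complex.normSq_eq_norm_sq, Complex.normSq_add_mul_I]
  have hfin : ‖∫ ω, Complex.exp ((Y ω : ℝ) * Complex.I) ∂P‖ ^ 2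
      ≤ Real.exp (-(κ / 4) * s) ^ 2 := by
    rw [hn, ← Real.exp_nat_mul]
    have h1 : (∫ ω, Real.cos (Y ω) ∂P) ^ 2 ≤ (1 - κ * s / 2) ^ 2 := by
      apply pow_le_pow_left₀ hcosl
      nlinarith
    have h2 : (∫ ω, Real.sin (Y ω) ∂P) ^ 2 ≤ (2 * s) ^ 2 := by
      rw [← sq_abs]; gcongr
    have h3 := Real.add_one_le_exp (((2 : ℕ) : ℝ) * (-(κ / 4) * s))
    push_cast at h3 ⊢
    nlinarith [mul_nonneg hs0 hs0, mul_nonneg hs0 (sub_nonneg.2 hs1),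
      mul_nonneg (mul_nonneg hs0 hs0) (sub_nonneg.2 hκ1)]
  exact (pow_le_pow_iff_left₀ (norm_nonneg _) (Real.exp_nonneg _) two_ne_zero).1 hfin

/-! ### Esseen's inequality and small balls of linear forms -/

/-- The Fourier transform of the triangular kernel. -/
lemma integral_one_sub_mul_cos {y : ℝ} (hy : y ≠ 0) :
    ∫ t in (0 : ℝ)..1, (1 - t) * Real.cos (t * y) = (1 - Real.cos y) / y ^ 2 := by
  have hd : ∀ t ∈ Set.uIcc (0 : ℝ) 1, HasDerivAt
      (fun t => (1 - t) * Real.sin (t * y) / y - Real.cos (t * y) / y ^ 2)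
      ((1 - t) * Real.cos (t * y)) t := by
    intro t _
    have h1 : HasDerivAt (fun t : ℝ => t * y) y t := by simpa using (hasDerivAt_id t).mul_const y
    have h2 : HasDerivAt (fun t : ℝ => 1 - t) (-1) t := by
      simpa using (hasDerivAt_id t).const_sub 1
    have h3 := ((h2.mul h1.sin).div_const y).sub (h1.cos.div_const (y ^ 2))
    convert! h3 using 1
    field_simp
    ring
  rw [intervalIntegral.integral_eq_sub_of_hasDerivAt hd (by
    apply Continuous.intervalIntegrable; fun_prop)]
  simp
  ring

/-- Positivity of this Fejér-type kernel allows the expectation outside the ball to be discarded. -/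
lemma integral_one_sub_mul_cos_nonneg (y : ℝ) :
    0 ≤ ∫ t in (0 : ℝ)..1, (1 - t) * Real.cos (t * y) := by
  rcases eq_or_ne y 0 with rfl | hy
  · apply intervalIntegral.integral_nonneg (by norm_num)
    intro t ht
    simp [ht.2]
  · rw [integral_one_sub_mul_cos hy]
    have := Real.cos_le_one y
    apply div_nonneg (by linarith) (by positivity)

/-- The closed form is at least `2/π²`, and `π² < 10`. -/
lemma one_fifth_le_integral_one_sub_mul_cos {y : ℝ} (hy : |y| ≤ 1) :
    1 / 5 ≤ ∫ t in (0 : ℝ)..1, (1 - t) * Real.cos (t * y) := by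
  rcases eq_or_ne y 0 with rfl | hy0
  · simp only [mul_zero, Real.cos_zero, mul_one]
    rw [intervalIntegral.integral_sub (by simp) (by simp)]
    simp
    norm_num
  · rw [integral_one_sub_mul_cos hy0]
    have hp := Real.pi_gt_three
    have hp' := Real.pi_lt_d2
    have h1 := Real.cos_le_one_sub_mul_cos_sq (x := y) (by linarith)
    rw [le_div_iff₀ (by positivity)]
    have h2 : (1 : ℝ) / 5 ≤ 2 / Real.pi ^ 2 := by
      rw [div_le_div_iff₀ (by norm_num) (by positivity)]
      nlinarith
    nlinarith [sq_nonneg y]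

/-- A form of Esseen's inequality: a Gaussian bound for the characteristic function near the origin
gives a small ball estimate. -/
theorem measureReal_abs_sub_le_of_charFun_le {Ω : Type*} [MeasurableSpace Ω] {P : Measure Ω}
    [IsProbabilityMeasure P] {S : Ω → ℝ} (hS : Measurable S) {r κ : ℝ} (hr : 0 < r) (hκ : 0 < κ)
    (hφ : ∀ t ∈ Set.Icc (0 : ℝ) 1,
      ‖∫ ω, Complex.exp ((t / r * S ω : ℝ) * Complex.I) ∂P‖ ≤ Real.exp (-κ * t ^ 2)) (w : ℝ) :
    P.real {ω | |S ω - w| ≤ r} ≤ 5 * √(Real.pi / κ) := by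
  set h : ℝ → ℝ := fun y => ∫ t in (0 : ℝ)..1, (1 - t) * Real.cos (t * y) with hh
  set F : Ω → ℝ → ℝ := fun ω t => (1 - t) * Real.cos (t * ((S ω - w) / r)) with hF
  have hFm : Measurable (Function.uncurry F) := by
    simp only [hF, Function.uncurry_def]
    fun_prop
  have : IsFiniteMeasure (volume.restrict (Set.uIoc (0 : ℝ) 1)) := by
    rw [Set.uIoc_of_le zero_le_one]; infer_instance
  have hFi : Integrable (Function.uncurry F)
      (P.prod (volume.restrict (Set.uIoc (0 : ℝ) 1))) := by
    refine Integrable.mono' (integrable_const (1 : ℝ)) hFm.aestronglyMeasurable ?_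
    have : ∀ᵐ z ∂(P.prod (volume.restrict (Set.uIoc (0 : ℝ) 1))), z.2 ∈ Set.uIoc (0 : ℝ) 1 := by
      refine (Measure.quasiMeasurePreserving_snd).ae ?_
      exact ae_restrict_mem measurableSet_uIoc
    filter_upwards [this] with z hz
    rw [Set.uIoc_of_le zero_le_one] at hz
    rw [Function.uncurry_def, Real.norm_eq_abs, abs_mul]
    calc |1 - z.2| * |Real.cos (z.2 * ((S z.1 - w) / r))| ≤ 1 * 1 := by
          gcongr
          · rw [abs_le]; constructor <;> linarith [hz.1, hz.2]
          · exact Real.abs_cos_le_one _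
      _ = 1 := by norm_num
  have hmeas : MeasurableSet {ω | |S ω - w| ≤ r} :=
    measurableSet_le (by fun_prop) measurable_const
  have hint : Integrable (fun ω => ∫ t in (0 : ℝ)..1, F ω t) P := by
    simp_rw [intervalIntegral.integral_of_le (zero_le_one (α := ℝ))]
    rw [Set.uIoc_of_le zero_le_one] at hFi
    exact hFi.integral_prod_left
  -- The kernel at `(S - w)/r` is at least `1/5` on the ball and nonnegative elsewhere.
  have h1 : 1 / 5 * P.real {ω | |S ω - w| ≤ r} ≤ ∫ ω, (∫ t in (0 : ℝ)..1, F ω t) ∂P := by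
    rw [mul_comm, ← smul_eq_mul, ← setIntegral_const]
    calc ∫ _ in {ω | |S ω - w| ≤ r}, (1 / 5 : ℝ) ∂P
        ≤ ∫ ω in {ω | |S ω - w| ≤ r}, (∫ t in (0 : ℝ)..1, F ω t) ∂P := by
          refine setIntegral_mono_on (integrable_const _).integrableOn hint.integrableOn hmeas ?_
          intro ω hω
          apply one_fifth_le_integral_one_sub_mul_cos
          rw [abs_div, abs_of_pos hr, div_le_one hr]
          exact hω
      _ ≤ _ := setIntegral_le_integral hint (Filter.Eventually.of_forall fun ω =>
          integral_one_sub_mul_cos_nonneg _)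
  have h2 : ∫ ω, (∫ t in (0 : ℝ)..1, F ω t) ∂P = ∫ t in (0 : ℝ)..1, ∫ ω, F ω t ∂P :=
    (intervalIntegral_integral_swap (f := fun t ω => F ω t) (by
      have := hFi.swap
      simpa [Function.uncurry_def, Function.comp_def] using this)).symm
  have hcos : ∀ t ∈ Set.Icc (0 : ℝ) 1, ∫ ω, F ω t ∂P ≤ Real.exp (-κ * t ^ 2) := by
    intro t ht
    have hci : Integrable (fun ω => Complex.exp ((t / r * S ω : ℝ) * Complex.I)) P := by
      refine (integrable_const (1 : ℝ)).mono (by fun_prop) (Filter.Eventually.of_forall fun ω => ?_)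
      rw [Complex.norm_exp_ofReal_mul_I]; simp
    -- The centre `w` enters only through a factor of modulus one, which makes the bound uniform in
    -- `w`.
    have e : ∫ ω, Real.cos (t * ((S ω - w) / r)) ∂P
        = (Complex.exp ((-(t / r * w) : ℝ) * Complex.I) *
          ∫ ω, Complex.exp ((t / r * S ω : ℝ) * Complex.I) ∂P).re := by
      rw [← integral_const_mul]
      have := integral_re (𝕜 := ℂ) (hci.const_mul (Complex.exp ((-(t / r * w) : ℝ) * Complex.I)))
      simp only [RCLike.re_to_complex] at this
      rw [← this]
      congr 1 with ω
      rw [← Complex.exp_add, ← add_mul, ← Complex.ofReal_add, Complex.exp_ofReal_mul_I_re]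
      congr 1
      ring
    have hle : ∫ ω, Real.cos (t * ((S ω - w) / r)) ∂P ≤ Real.exp (-κ * t ^ 2) := by
      rw [e]
      refine (Complex.re_le_norm _).trans ?_
      rw [norm_mul, Complex.norm_exp_ofReal_mul_I, one_mul]
      exact hφ t ht
    simp only [hF]
    rw [integral_const_mul]
    have h0 := Real.exp_nonneg (-κ * t ^ 2)
    nlinarith [ht.1, ht.2]
  have hgauss : Integrable (fun t : ℝ => Real.exp (-κ * t ^ 2)) := integrable_exp_neg_mul_sq hκ
  have h3 : ∫ t in (0 : ℝ)..1, ∫ ω, F ω t ∂P ≤ √(Real.pi / κ) := by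
    calc ∫ t in (0 : ℝ)..1, ∫ ω, F ω t ∂P ≤ ∫ t in (0 : ℝ)..1, Real.exp (-κ * t ^ 2) := by
          apply intervalIntegral.integral_mono_on zero_le_one
          · rw [intervalIntegrable_iff]
            exact hFi.integral_prod_right
          · exact hgauss.intervalIntegrable
          · exact hcos
      _ ≤ ∫ t : ℝ, Real.exp (-κ * t ^ 2) := by
          rw [intervalIntegral.integral_of_le zero_le_one]
          exact setIntegral_le_integral hgauss (Filter.Eventually.of_forall fun t =>
            Real.exp_nonneg _)
      _ = _ := integral_gaussian κ
  linarith

/-- Gaussian decay near the origin for the characteristic function of a linear combination of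
independent non-degenerate pairs. -/
theorem exists_norm_charFun_sum_le {ρ : ℝ} (hρ0 : 0 ≤ ρ) (hρ : ρ < 1) (M : ℝ) :
    ∃ c t : ℝ, 0 < c ∧ 0 < t ∧ ∀ (Ω : Type*) [MeasurableSpace Ω] (P : Measure Ω)
      [IsProbabilityMeasure P] (ι : Type*) [Fintype ι] (U V : ι → Ω → ℝ),
      iIndepFun (fun i ω => (U i ω, V i ω)) P → (∀ i, PairMoments P (U i) (V i) ρ M) →
      ∀ (a b : ι → ℝ) (S : Finset ι), (∀ i ∈ S, a i ^ 2 + b i ^ 2 ≤ t) →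
      ‖∫ ω, Complex.exp ((∑ i, (a i * U i ω + b i * V i ω) : ℝ) * Complex.I) ∂P‖
        ≤ Real.exp (-c * ∑ i ∈ S, (a i ^ 2 + b i ^ 2)) := by
  classical
  obtain ⟨c, t, hc, ht, H⟩ := exists_norm_charFun_comb_le hρ0 hρ M
  refine ⟨c, t, hc, ht, fun Ω _ P _ ι _ U V hind hm a b S hS => ?_⟩
  set f : ι → ℝ × ℝ → ℂ := fun i z =>
    Complex.exp ((a i * z.1 + b i * z.2 : ℝ) * Complex.I) with hf
  have e : ∫ ω, Complex.exp ((∑ i, (a i * U i ω + b i * V i ω) : ℝ) * Complex.I) ∂P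
      = ∏ i, ∫ ω, f i (U i ω, V i ω) ∂P := by
    rw [← hind.integral_fun_prod_comp
      (fun i => ((hm i).1.prodMk (hm i).2).aemeasurable)
      (fun i => by simp only [hf]; fun_prop)]
    congr 1 with ω
    rw [Complex.ofReal_sum, Finset.sum_mul, Complex.exp_sum]
  -- Coordinates outside `S` contribute factors of modulus at most one. Coefficients too large for
  -- the estimate of a single pair may thus be ignored.
  have hle1 : ∀ i, ‖∫ ω, f i (U i ω, V i ω) ∂P‖ ≤ 1 := fun i => by
    refine (norm_integral_le_of_norm_le_const (C := 1)
      (Filter.Eventually.of_forall fun ω => ?_)).trans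
      (by simp)
    simp only [hf]
    rw [Complex.norm_exp_ofReal_mul_I]
  rw [e, norm_prod, Finset.mul_sum, Real.exp_sum, ← Finset.prod_mul_prod_compl S]
  calc _ ≤ (∏ i ∈ S, Real.exp (-c * (a i ^ 2 + b i ^ 2))) * 1 := by
        apply mul_le_mul
        · exact Finset.prod_le_prod (fun i _ => norm_nonneg _) fun i hi =>
            H Ω P (U i) (V i) (hm i) (a i) (b i) (hS i hi)
        · exact Finset.prod_le_one (fun i _ => norm_nonneg _) fun i _ => hle1 i
        · exact Finset.prod_nonneg fun i _ => norm_nonneg _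
        · exact Finset.prod_nonneg fun i _ => Real.exp_nonneg _
    _ = _ := mul_one _

/-- Small ball estimate for real linear combinations of independent pairs, many of whose
coefficients are of comparable size. -/
theorem exists_smallBall_real {ρ : ℝ} (hρ0 : 0 ≤ ρ) (hρ : ρ < 1) (M : ℝ) {Λ : ℝ} (hΛ : 0 < Λ) :
    ∃ C : ℝ, 0 < C ∧ ∀ (Ω : Type*) [MeasurableSpace Ω] (P : Measure Ω)
      [IsProbabilityMeasure P] (ι : Type*) [Fintype ι] (U V : ι → Ω → ℝ),
      iIndepFun (fun i ω => (U i ω, V i ω)) P → (∀ i, PairMoments P (U i) (V i) ρ M) →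
      ∀ (a b : ι → ℝ) (S : Finset ι) (s : ℝ), S.Nonempty → 0 < s →
      (∀ i ∈ S, s ^ 2 ≤ a i ^ 2 + b i ^ 2 ∧ a i ^ 2 + b i ^ 2 ≤ Λ * s ^ 2) →
      ∀ (r : ℝ), 0 ≤ r → ∀ w : ℝ,
      P.real {ω | |∑ i, (a i * U i ω + b i * V i ω) - w| ≤ r} ≤ C * (r / s + 1) / √(S.card) := by
  obtain ⟨c, t₀, hc, ht, H⟩ := exists_norm_charFun_sum_le hρ0 hρ M
  set q := √(Λ / t₀) with hq
  have hq0 : 0 < q := Real.sqrt_pos.2 (by positivity)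
  refine ⟨5 * √(Real.pi / c) * (1 + q), by positivity, ?_⟩
  intro Ω _ P _ ι _ U V hind hm a b S s hS hs hab r hr w
  -- Enlarging the radius by `q s` keeps the coefficients scaled by `t / R`, `t ≤ 1`, in the range
  -- where the Gaussian decay holds: `(q s / R)² ≤ 1` and `q² = Λ / t₀`. This enlargement produces
  -- the summand `1` next to `r / s`.
  set R := r + q * s with hR
  have hR0 : 0 < R := by positivity
  have hcard : (0 : ℝ) < S.card := by exact_mod_cast hS.card_pos
  set κ := c * S.card * s ^ 2 / R ^ 2 with hκ
  have hκ0 : 0 < κ := by positivity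
  have hmeas : Measurable fun ω => ∑ i, (a i * U i ω + b i * V i ω) :=
    Finset.measurable_sum _ fun i _ => ((hm i).1.const_mul _).add ((hm i).2.const_mul _)
  have key := measureReal_abs_sub_le_of_charFun_le (P := P) hmeas hR0 hκ0 ?_ w
  · calc _ ≤ P.real {ω | |∑ i, (a i * U i ω + b i * V i ω) - w| ≤ R} := by
          apply measureReal_mono _ (measure_ne_top _ _)
          intro ω hω
          have : r ≤ R := by rw [hR]; nlinarith
          exact le_trans hω this
      _ ≤ _ := key
      _ = 5 * √(Real.pi / c) * (R / s) / √(S.card) := by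
          have : Real.pi / κ = Real.pi / c * (R / s) ^ 2 / S.card := by
            rw [hκ]; field_simp
          rw [this, Real.sqrt_div (by positivity), Real.sqrt_mul (by positivity),
            Real.sqrt_sq (by positivity)]
          ring
      _ ≤ _ := by
          have : R / s ≤ (1 + q) * (r / s + 1) := by
            rw [hR, add_div, mul_div_assoc, div_self hs.ne']
            have : 0 ≤ q * (r / s) := by positivity
            nlinarith
          rw [mul_assoc (5 * √(Real.pi / c))]
          gcongr
  · intro t ht'
    have h1 := H Ω P ι U V hind hm (fun i => t / R * a i) (fun i => t / R * b i) S ?_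
    · have e : ∀ ω, ∑ i, (t / R * a i * U i ω + t / R * b i * V i ω)
          = t / R * ∑ i, (a i * U i ω + b i * V i ω) := fun ω => by
        rw [Finset.mul_sum]; congr 1 with i; ring
      simp only [e] at h1
      refine h1.trans (Real.exp_le_exp.2 ?_)
      have : S.card * ((t / R) ^ 2 * s ^ 2)
          ≤ ∑ i ∈ S, ((t / R * a i) ^ 2 + (t / R * b i) ^ 2) := by
        rw [← nsmul_eq_mul]
        apply Finset.card_nsmul_le_sum
        intro i hi
        rw [mul_pow, mul_pow, ← mul_add]
        gcongr
        exact (hab i hi).1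
      have e2 : κ * t ^ 2 = c * (S.card * ((t / R) ^ 2 * s ^ 2)) := by
        rw [hκ]; field_simp
      rw [neg_mul, neg_mul, neg_le_neg_iff, e2]
      gcongr
    · intro i hi
      have h2 : (t / R) ^ 2 * (q * s) ^ 2 ≤ 1 := by
        rw [← mul_pow]
        apply pow_le_one₀ (by have := ht'.1; positivity)
        rw [div_mul_eq_mul_div, div_le_one hR0]
        have := mul_le_mul_of_nonneg_right ht'.2 (by positivity : 0 ≤ q * s)
        linarith
      rw [mul_pow, hq, Real.sq_sqrt (by positivity)] at h2
      calc (t / R * a i) ^ 2 + (t / R * b i) ^ 2 = (t / R) ^ 2 * (a i ^ 2 + b i ^ 2) := by ring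
        _ ≤ (t / R) ^ 2 * (Λ * s ^ 2) := by gcongr; exact (hab i hi).2
        _ = (t / R) ^ 2 * (Λ / t₀ * s ^ 2) * t₀ := by field_simp
        _ ≤ 1 * t₀ := by gcongr
        _ = t₀ := one_mul _

/-- Small ball estimate for complex linear combinations of independent pairs. -/
theorem exists_smallBall {ρ : ℝ} (hρ0 : 0 ≤ ρ) (hρ : ρ < 1) (M : ℝ) {Λ : ℝ} (hΛ : 0 < Λ) :
    ∃ C : ℝ, 0 < C ∧ ∀ (Ω : Type*) [MeasurableSpace Ω] (P : Measure Ω)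
      [IsProbabilityMeasure P] (ι : Type*) [Fintype ι] (U V : ι → Ω → ℝ),
      iIndepFun (fun i ω => (U i ω, V i ω)) P → (∀ i, PairMoments P (U i) (V i) ρ M) →
      ∀ (α β : ι → ℂ) (S : Finset ι) (s : ℝ), S.Nonempty → 0 < s →
      (∀ i ∈ S, s ^ 2 ≤ ‖α i‖ ^ 2 + ‖β i‖ ^ 2 ∧ ‖α i‖ ^ 2 + ‖β i‖ ^ 2 ≤ Λ * s ^ 2) →
      ∀ (r : ℝ), 0 ≤ r → ∀ w : ℂ,
      P.real {ω | ‖∑ i, (α i * U i ω + β i * V i ω) - w‖ ≤ r} ≤ C * (r / s + 1) / √(S.card) := by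
  classical
  obtain ⟨C, hC, H⟩ := exists_smallBall_real hρ0 hρ M (Λ := 2 * Λ) (by positivity)
  have h2 : 0 < √(2 : ℝ) := by positivity
  refine ⟨2 * C, by positivity, ?_⟩
  intro Ω _ P _ ι _ U V hind hm α β S s hS hs hab r hr w
  have hsq : ∀ z : ℂ, ‖z‖ ^ 2 = z.re ^ 2 + z.im ^ 2 := fun z => by
    rw [← Complex.normSq_eq_norm_sq, Complex.normSq_apply]; ring
  have hcard : (0 : ℝ) < S.card := by exact_mod_cast hS.card_pos
  have hs2 : (s / √2) ^ 2 = s ^ 2 / 2 := by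
    rw [div_pow, Real.sq_sqrt (by norm_num)]
  -- The real estimate is applied to real or imaginary parts, whichever carry half of `‖α i‖² + ‖β
  -- i‖²` for at least half of the indices. The scale becomes `s/√2`, hence the doubled `Λ`; the
  -- scale and the halved index set cost a factor `√2` each.
  have main : ∀ (f : ℂ →ₗ[ℝ] ℝ), (∀ z, |f z| ≤ ‖z‖) → ∀ T ⊆ S, (S.card : ℝ) ≤ 2 * T.card →
      (∀ i ∈ T, s ^ 2 / 2 ≤ f (α i) ^ 2 + f (β i) ^ 2) →
      P.real {ω | ‖∑ i, (α i * U i ω + β i * V i ω) - w‖ ≤ r}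
        ≤ 2 * C * (r / s + 1) / √(S.card) := by
    intro f hf T hTS hT hlow
    have hTc : (0 : ℝ) < T.card := by linarith
    have h1 := H Ω P ι U V hind hm (fun i => f (α i)) (fun i => f (β i)) T (s / √2)
      (Finset.card_pos.1 (by exact_mod_cast hTc)) (by positivity) (fun i hi => by
        refine ⟨by rw [hs2]; exact hlow i hi, ?_⟩
        rw [hs2]
        have h3 : ∀ z, f z ^ 2 ≤ ‖z‖ ^ 2 := fun z => by
          rw [← sq_abs]; gcongr; exact hf z
        have := (hab i (hTS hi)).2
        linarith [h3 (α i), h3 (β i)]) r hr (f w)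
    calc _ ≤ P.real {ω | |∑ i, (f (α i) * U i ω + f (β i) * V i ω) - f w| ≤ r} := by
          apply measureReal_mono _ (measure_ne_top _ _)
          intro ω hω
          have e : f (∑ i, (α i * U i ω + β i * V i ω) - w)
              = ∑ i, (f (α i) * U i ω + f (β i) * V i ω) - f w := by
            rw [map_sub, map_sum]
            congr 2 with i
            rw [map_add, mul_comm (α i), mul_comm (β i), ← Complex.real_smul, ← Complex.real_smul,
              map_smul, map_smul, smul_eq_mul, smul_eq_mul]
            ring
          have := (hf _).trans hω
          rwa [e] at this
      _ ≤ _ := h1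
      _ ≤ C * (√2 * (r / s + 1)) / (√(S.card) / √2) := by
          have h3 : √(S.card : ℝ) / √2 ≤ √(T.card) := by
            rw [← Real.sqrt_div (by positivity)]
            apply Real.sqrt_le_sqrt; linarith
          have h4 : r / (s / √2) + 1 ≤ √2 * (r / s + 1) := by
            have : r / (s / √2) = √2 * (r / s) := by field_simp
            rw [this, mul_add, mul_one]
            gcongr
            rw [Real.one_le_sqrt]; norm_num
          gcongr
      _ = _ := by
          have : √2 * √2 = (2 : ℝ) := Real.mul_self_sqrt (by norm_num)
          field_simp
          linear_combination this
  set T₁ := S.filter fun i => s ^ 2 / 2 ≤ (α i).re ^ 2 + (β i).re ^ 2 with hT₁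
  set T₂ := S.filter fun i => ¬ s ^ 2 / 2 ≤ (α i).re ^ 2 + (β i).re ^ 2 with hT₂
  have hsum : T₁.card + T₂.card = S.card := Finset.card_filter_add_card_filter_not _
  have hsum' : (T₁.card : ℝ) + T₂.card = S.card := by exact_mod_cast hsum
  rcases le_total (T₂.card : ℝ) T₁.card with h | h
  · exact main Complex.reLm Complex.abs_re_le_norm T₁ (Finset.filter_subset _ _) (by linarith)
      fun i hi => (Finset.mem_filter.1 hi).2
  · refine main Complex.imLm Complex.abs_im_le_norm T₂ (Finset.filter_subset _ _) (by linarith)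
      fun i hi => ?_
    have h3 := (Finset.mem_filter.1 hi)
    have h4 := (hab i h3.1).1
    rw [hsq, hsq] at h4
    have := h3.2
    simp only [Complex.imLm_coe]
    linarith

/-! ### Independence among off-diagonal entries -/

/-- The off-diagonal entries of an elliptic random matrix: the pairs of entries at transposed
positions are independent, and have uniformly controlled moments. -/
structure EllipticEntries {Ω : Type*} [MeasurableSpace Ω] (P : Measure Ω) {ι : Type*}
    [LinearOrder ι] (X : Ω → ι → ι → ℝ) (ρ M : ℝ) : Prop where
  indep : iIndepFun (fun (p : {p : ι × ι // p.1 < p.2}) ω =>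
    (X ω p.1.1 p.1.2, X ω p.1.2 p.1.1)) P
  moments : ∀ i j, i ≠ j → PairMoments P (fun ω => X ω i j) (fun ω => X ω j i) ρ M

/-- The joint law is a product measure, and currying turns it into the product over `i` of the laws
of the rows. It makes the rows of a block of independent entries independent as vectors. -/
lemma ProbabilityTheory.iIndepFun.curry {Ω : Type*} [MeasurableSpace Ω] {P : Measure Ω}
    {I J : Type*} [Fintype I] [Fintype J] {Z : I × J → Ω → ℝ}
    (hZ : ∀ p, Measurable (Z p)) (h : iIndepFun Z P) :
    iIndepFun (fun i ω j => Z (i, j) ω) P := by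
  have := h.isProbabilityMeasure
  have : ∀ i j, IsProbabilityMeasure (P.map (Z (i, j))) :=
    fun i j => Measure.isProbabilityMeasure_map (hZ _).aemeasurable
  rw [iIndepFun_iff_map_fun_eq_infinitePi_map (fun i => measurable_pi_lambda _ fun j => hZ _)]
  have h1 : ∀ i, P.map (fun ω j => Z (i, j) ω)
      = Measure.infinitePi fun j => P.map (Z (i, j)) := fun i =>
    (iIndepFun_iff_map_fun_eq_infinitePi_map (fun j => hZ _)).1
      (h.precomp (g := fun j : J => (i, j)) (fun a b hab => (Prod.mk.inj hab).2))
  simp_rw [h1]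
  rw [← Measure.infinitePi_map_curry (fun i j => P.map (Z (i, j)))]
  have h2 := (iIndepFun_iff_map_fun_eq_infinitePi_map hZ).1 h
  rw [← h2, Measure.map_map (by fun_prop) (measurable_pi_lambda _ hZ)]
  rfl

namespace EllipticEntries

variable {Ω : Type*} [MeasurableSpace Ω] {P : Measure Ω} {ι : Type*} [LinearOrder ι]
  {X : Ω → ι → ι → ℝ} {ρ M : ℝ}

lemma measurable (h : EllipticEntries P X ρ M) {i j : ι} (hij : i ≠ j) :
    Measurable fun ω => X ω i j := (h.moments i j hij).1

/-- Pairs of entries at distinct unordered positions are independent. -/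
lemma indep_pairs (h : EllipticEntries P X ρ M) {σ : Type*} (f g : σ → ι)
    (hne : ∀ s, f s ≠ g s)
    (hinj : ∀ s t, (f s = f t ∧ g s = g t) ∨ (f s = g t ∧ g s = f t) → s = t) :
    iIndepFun (fun s ω => (X ω (f s) (g s), X ω (g s) (f s))) P := by
  -- Each position is sent to its representative above the diagonal; the swap `φ` below restores the
  -- orientation.
  set o : σ → {p : ι × ι // p.1 < p.2} := fun s =>
    ⟨(min (f s) (g s), max (f s) (g s)), min_lt_max.2 (hne s)⟩ with ho
  have hoi : Function.Injective o := by
    intro s t hst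
    have h1 : min (f s) (g s) = min (f t) (g t) := congrArg (fun p => p.1.1) hst
    have h2 : max (f s) (g s) = max (f t) (g t) := congrArg (fun p => p.1.2) hst
    apply hinj
    have := hne s
    have := hne t
    grind
  set φ : σ → ℝ × ℝ → ℝ × ℝ := fun s => if f s < g s then id else Prod.swap with hφ
  have hφm : ∀ s, Measurable (φ s) := fun s => by
    simp only [hφ]; split_ifs
    exacts [measurable_id, measurable_swap]
  have := (h.indep.precomp hoi).comp φ hφm
  convert! this using 2 with s
  funext ω
  simp only [ho, hφ, Function.comp]
  rcases lt_or_gt_of_ne (hne s) with hlt | hlt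
  · rw [if_pos hlt, min_eq_left hlt.le, max_eq_right hlt.le]; rfl
  · rw [if_neg hlt.not_gt, min_eq_right hlt.le, max_eq_left hlt.le]; rfl

lemma transpose (h : EllipticEntries P X ρ M) :
    EllipticEntries P (fun ω i j => X ω j i) ρ M where
  indep := by
    refine h.indep_pairs (σ := {p : ι × ι // p.1 < p.2}) (fun p => p.1.2) (fun p => p.1.1)
      (fun p => p.2.ne') ?_
    rintro ⟨⟨a, b⟩, hab⟩ ⟨⟨c, d⟩, hcd⟩ hh
    simp only [Subtype.mk.injEq, Prod.mk.injEq] at *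
    grind
  moments := fun i j hij => (h.moments i j hij).symm

lemma restrict (h : EllipticEntries P X ρ M) (p : ι → Prop) :
    EllipticEntries P (fun ω (i j : {i // p i}) => X ω i j) ρ M where
  indep := by
    refine h.indep_pairs (fun q : {q : {i // p i} × {i // p i} // q.1 < q.2} => (q.1.1 : ι))
      (fun q => q.1.2) (fun q => (Subtype.coe_lt_coe.2 q.2).ne) ?_
    rintro ⟨⟨⟨a, _⟩, ⟨b, _⟩⟩, hab⟩ ⟨⟨⟨c, _⟩, ⟨d, _⟩⟩, hcd⟩ hh
    simp only [Subtype.mk.injEq, Prod.mk.injEq] at *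
    grind
  moments := fun i j hij => h.moments i j (fun e => hij (Subtype.ext e))

end EllipticEntries

/-! ### The image of a fixed vector with small support -/

/-- A Gaussian weight is dominated by a bounded trigonometric function, whose expectation is
controlled by a single value of the characteristic function. This turns the lower tail of a sum of
squares into a product of such expectations. -/
lemma exp_neg_le_two_add_cos (x : ℝ) : Real.exp (-(x ^ 2 / 2)) ≤ (2 + Real.cos x) / 3 := by
  have h2 : Real.exp (-(x ^ 2 / 2)) ≤ 1 / (1 + x ^ 2 / 2) := by
    rw [Real.exp_neg, ← one_div]
    have := Real.add_one_le_exp (x ^ 2 / 2)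
    apply one_div_le_one_div_of_le (by positivity); linarith
  rcases le_or_gt (x ^ 2) 4 with h | h
  · have h1 := Real.one_sub_sq_div_two_le_cos (x := x)
    have h3 : 1 / (1 + x ^ 2 / 2) ≤ 1 - x ^ 2 / 6 := by
      rw [div_le_iff₀ (by positivity)]
      nlinarith [sq_nonneg x]
    linarith
  · have h3 : 1 / (1 + x ^ 2 / 2) ≤ 1 / 3 := by
      apply one_div_le_one_div_of_le (by norm_num); linarith
    linarith [Real.neg_one_le_cos x]

/-- The image of a fixed vector of norm of order one with small support, shifted by an arbitrary
vector, is very unlikely to be short. -/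
theorem exists_sum_sq_image_real_le {ρ : ℝ} (hρ0 : 0 ≤ ρ) (hρ : ρ < 1) (M : ℝ) :
    ∃ c q : ℝ, 0 < c ∧ 0 < q ∧ q < 1 ∧ ∀ (Ω : Type*) [MeasurableSpace Ω] (P : Measure Ω)
      [IsProbabilityMeasure P] (ι : Type*) [Fintype ι] [LinearOrder ι] (X : Ω → ι → ι → ℝ),
      EllipticEntries P X ρ M → ∀ (e : ι → ℝ) (T : Finset ι), (∀ j ∉ T, e j = 0) →
      2 * T.card ≤ Fintype.card ι → 1 / 8 ≤ ∑ j, e j ^ 2 → (∀ j, e j ^ 2 ≤ 4) → ∀ v : ι → ℝ,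
      P.real {ω | ∑ i ∈ Tᶜ, (∑ j, X ω i j * e j + v i) ^ 2 ≤ c * Fintype.card ι}
        ≤ q ^ Fintype.card ι := by
  obtain ⟨c₀, t₀, hc₀, ht₀, H⟩ := exists_norm_charFun_sum_le hρ0 hρ M
  -- The frequency is chosen so that `(τ e j)² ≤ t₀` whenever `e j ^ 2 ≤ 4`.
  set τ := √t₀ / 2 with hτ
  have hτ0 : 0 < τ := by positivity
  have hτ2 : τ ^ 2 = t₀ / 4 := by rw [hτ, div_pow, Real.sq_sqrt ht₀.le]; norm_num
  set q₀ := Real.exp (-c₀ * (τ ^ 2 / 8)) with hq₀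
  have hq₀1 : q₀ < 1 := by
    rw [hq₀, Real.exp_lt_one_iff, neg_mul, neg_lt_zero]; positivity
  have hq₀0 : 0 < q₀ := Real.exp_pos _
  set q₁ := (2 + q₀) / 3 with hq₁
  have hq₁0 : 0 < q₁ := by positivity
  have hq₁1 : q₁ < 1 := by rw [hq₁]; linarith
  have hlog : Real.log q₁ < 0 := Real.log_neg hq₁0 hq₁1
  -- At least `n/2` independent rows give `q₁ ^ (n/2)`. With this `c`, Markov's inequality loses `q₁
  -- ^ (-n/4)`, and `q₁ ^ (n/4)` remains.
  set c := -Real.log q₁ / (2 * τ ^ 2) with hc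
  have hc0 : 0 < c := div_pos (by linarith) (by positivity)
  refine ⟨c, Real.exp (Real.log q₁ / 4), hc0, Real.exp_pos _,
    Real.exp_lt_one_iff.2 (by linarith), ?_⟩
  intro Ω _ P _ ι _ _ X hX e T heT hT he1 he2 v
  have hne : ∀ (i : {i // i ∉ T}) (j : {j // j ∈ T}), (i : ι) ≠ j := fun i j hij =>
    i.2 (hij ▸ j.2)
  set n := Fintype.card ι with hn
  set f : ℝ → ℝ := fun y => (2 + Real.cos (τ * y)) / 3 with hf
  have hfm : Measurable f := by simp only [hf]; fun_prop
  have hf0 : ∀ y, 0 ≤ f y := fun y => by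
    simp only [hf]; linarith [Real.neg_one_le_cos (τ * y)]
  have hf1 : ∀ y, f y ≤ 1 := fun y => by
    simp only [hf]; linarith [Real.cos_le_one (τ * y)]
  set R : {i // i ∉ T} → ({j // j ∈ T} → ℝ) → ℝ := fun i z => ∑ j, z j * e j + v i with hR
  have hRm : ∀ i, Measurable (R i) := fun i => by simp only [hR]; fun_prop
  have hsum : ∀ ω (i : {i // i ∉ T}), ∑ j, X ω i j * e j + v i
      = R i (fun j : {j // j ∈ T} => X ω i j) := by
    intro ω i
    simp only [hR]
    congr 1
    rw [Finset.univ_eq_attach, Finset.sum_attach T (fun j => X ω i j * e j)]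
    exact (Finset.sum_subset (Finset.subset_univ _) fun j _ hj => by rw [heT j hj, mul_zero]).symm
  have hZm : ∀ p : {i // i ∉ T} × {j // j ∈ T}, Measurable fun ω => X ω p.1 p.2 := fun p =>
    hX.measurable (hne _ _)
  -- In the block of rows outside `T` and columns in `T` no position is the transpose of another, so
  -- the correlation within pairs is invisible. The block also avoids the diagonal.
  have hrows : iIndepFun (fun (i : {i // i ∉ T}) ω (j : {j // j ∈ T}) => X ω i j) P := by
    have h1 := hX.indep_pairs (fun p : {i // i ∉ T} × {j // j ∈ T} => (p.1 : ι)) (fun p => p.2)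
      (fun p => hne _ _) (by
        rintro ⟨⟨a, ha⟩, ⟨b, hb⟩⟩ ⟨⟨c, hc⟩, ⟨d, hd⟩⟩ hh
        simp only [Prod.mk.injEq, Subtype.mk.injEq] at *
        grind)
    exact (h1.comp (fun _ => Prod.fst) fun _ => measurable_fst).curry hZm
  have hrowm : ∀ i : {i // i ∉ T}, Measurable fun ω (j : {j // j ∈ T}) => X ω i j := fun i =>
    measurable_pi_lambda _ fun j => hZm (i, j)
  have hsq : ∑ j : {j // j ∈ T}, e j ^ 2 = ∑ j, e j ^ 2 := by
    rw [Finset.univ_eq_attach, Finset.sum_attach T (fun j => e j ^ 2)]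
    exact (Finset.sum_subset (Finset.subset_univ _) fun j _ hj => by
      rw [heT j hj]; norm_num)
  have hE : ∀ i : {i // i ∉ T}, ∫ ω, f (R i fun j => X ω i j) ∂P ≤ q₁ := by
    intro i
    have h1 := H Ω P {j // j ∈ T} (fun j ω => X ω i j) (fun j ω => X ω j i)
      (hX.indep_pairs (fun _ => (i : ι)) (fun j : {j // j ∈ T} => (j : ι)) (fun j => hne i j) (by
        rintro ⟨a, ha⟩ ⟨b, hb⟩ hh
        have := i.2
        simp only [Subtype.mk.injEq] at *
        grind)) (fun j => hX.moments _ _ (hne i j)) (fun j => τ * e j) (fun _ => 0) Finset.univ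
        (fun j _ => by
          rw [mul_pow, hτ2]
          have := he2 j
          nlinarith)
    have h2 : Real.exp (-c₀ * ∑ j : {j // j ∈ T}, ((τ * e j) ^ 2 + 0 ^ 2)) ≤ q₀ := by
      rw [hq₀, Real.exp_le_exp, neg_mul, neg_mul, neg_le_neg_iff]
      have : ∑ j : {j // j ∈ T}, ((τ * e j) ^ 2 + 0 ^ 2) = τ ^ 2 * ∑ j, e j ^ 2 := by
        rw [← hsq, Finset.mul_sum]; congr 1 with j; ring
      rw [this]
      have h3 : τ ^ 2 / 8 ≤ τ ^ 2 * ∑ j, e j ^ 2 := by nlinarith [sq_nonneg τ]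
      gcongr
    set W : Ω → ℝ := fun ω => ∑ j : {j // j ∈ T}, (τ * e j * X ω i j + 0 * X ω j i) with hW
    have hWm : Measurable W := Finset.measurable_sum _ fun j _ =>
      ((hZm (i, j)).const_mul _).add ((hX.measurable (hne i j).symm).const_mul _)
    have hWR : ∀ ω, τ * R i (fun j => X ω i j) = W ω + τ * v i := fun ω => by
      simp only [hR, hW, mul_add, Finset.mul_sum, zero_mul, add_zero]
      congr 2 with j; ring
    have hci : Integrable (fun ω => Complex.exp ((W ω : ℝ) * Complex.I)) P := by
      refine (integrable_const (1 : ℝ)).mono (by fun_prop) (Filter.Eventually.of_forall fun ω => ?_)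
      rw [Complex.norm_exp_ofReal_mul_I]; simp
    have hcos : ∫ ω, Real.cos (W ω + τ * v i) ∂P ≤ q₀ := by
      have e1 : ∫ ω, Real.cos (W ω + τ * v i) ∂P
          = (Complex.exp ((τ * v i : ℝ) * Complex.I) *
            ∫ ω, Complex.exp ((W ω : ℝ) * Complex.I) ∂P).re := by
        rw [← integral_const_mul]
        have := integral_re (𝕜 := ℂ) (hci.const_mul (Complex.exp ((τ * v i : ℝ) * Complex.I)))
        simp only [RCLike.re_to_complex] at this
        rw [← this]
        congr 1 with ω
        rw [← Complex.exp_add, ← add_mul, ← Complex.ofReal_add, Complex.exp_ofReal_mul_I_re,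
          add_comm]
      rw [e1]
      refine (Complex.re_le_norm _).trans ?_
      rw [norm_mul, Complex.norm_exp_ofReal_mul_I, one_mul]
      exact h1.trans h2
    have hcosI : Integrable (fun ω => Real.cos (W ω + τ * v i)) P := by
      refine (integrable_const (1 : ℝ)).mono (by fun_prop) (Filter.Eventually.of_forall fun ω => ?_)
      simpa using Real.abs_cos_le_one _
    simp only [hf, hWR]
    rw [integral_div, integral_add (integrable_const _) hcosI]
    simp only [integral_const, probReal_univ, one_smul]
    rw [hq₁]
    linarith
  have hprod : ∫ ω, ∏ i : {i // i ∉ T}, f (R i fun j => X ω i j) ∂P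
      ≤ q₁ ^ Fintype.card {i // i ∉ T} := by
    rw [hrows.integral_fun_prod_comp (f := fun i z => f (R i z))
      (fun i => (hrowm i).aemeasurable)
      (fun i => (hfm.comp (hRm i)).aestronglyMeasurable)]
    calc _ ≤ ∏ _i : {i // i ∉ T}, q₁ :=
          Finset.prod_le_prod (fun i _ => integral_nonneg fun ω => hf0 _) fun i _ => hE i
      _ = _ := by rw [Finset.prod_const, Finset.card_univ]
  have hcardT : (Fintype.card {i // i ∉ T} : ℝ) ≥ n / 2 := by
    have h1 : Fintype.card {i // i ∉ T} = n - T.card := by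
      rw [Fintype.card_subtype_compl]; simp [hn]
    have h2 : T.card ≤ n := Finset.card_le_univ T
    rw [h1, Nat.cast_sub h2]
    have : (2 * T.card : ℝ) ≤ n := by exact_mod_cast hT
    linarith
  set θ := Real.exp (-(τ ^ 2 * (c * n) / 2)) with hθ
  have hmark : θ * P.real {ω | θ ≤ ∏ i : {i // i ∉ T}, f (R i fun j => X ω i j)}
      ≤ ∫ ω, ∏ i : {i // i ∉ T}, f (R i fun j => X ω i j) ∂P := by
    apply mul_meas_ge_le_integral_of_nonneg
    · exact Filter.Eventually.of_forall fun ω => Finset.prod_nonneg fun i _ => hf0 _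
    · refine (integrable_const (1 : ℝ)).mono ?_ (Filter.Eventually.of_forall fun ω => ?_)
      · exact (Finset.measurable_prod _ fun i _ =>
          hfm.comp ((hRm i).comp (hrowm i))).aestronglyMeasurable
      · rw [Real.norm_of_nonneg (Finset.prod_nonneg fun i _ => hf0 _), norm_one]
        exact Finset.prod_le_one (fun i _ => hf0 _) fun i _ => hf1 _
  have hsub : {ω | ∑ i ∈ Tᶜ, (∑ j, X ω i j * e j + v i) ^ 2 ≤ c * n}
      ⊆ {ω | θ ≤ ∏ i : {i // i ∉ T}, f (R i fun j => X ω i j)} := by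
    intro ω hω
    simp only [Set.mem_ofPred_eq] at hω ⊢
    have e1 : ∑ i ∈ Tᶜ, (∑ j, X ω i j * e j + v i) ^ 2
        = ∑ i : {i // i ∉ T}, (R i fun j => X ω i j) ^ 2 := by
      simp_rw [← hsum]
      exact Finset.sum_subtype Tᶜ (p := fun i => i ∉ T) (fun x => by simp)
        (fun i => (∑ j, X ω i j * e j + v i) ^ 2)
    calc θ ≤ Real.exp (∑ i : {i // i ∉ T}, -((τ * R i fun j => X ω i j) ^ 2 / 2)) := by
          rw [hθ, Real.exp_le_exp, Finset.sum_neg_distrib, neg_le_neg_iff, ← Finset.sum_div]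
          simp_rw [mul_pow]
          rw [← Finset.mul_sum, ← e1]
          gcongr
      _ = ∏ i : {i // i ∉ T}, Real.exp (-((τ * R i fun j => X ω i j) ^ 2 / 2)) :=
          Real.exp_sum _ _
      _ ≤ _ := Finset.prod_le_prod (fun i _ => Real.exp_nonneg _) fun i _ =>
          exp_neg_le_two_add_cos _
  have hθ0 : 0 < θ := Real.exp_pos _
  calc _ ≤ P.real {ω | θ ≤ ∏ i : {i // i ∉ T}, f (R i fun j => X ω i j)} :=
        measureReal_mono hsub (measure_ne_top _ _)
    _ ≤ q₁ ^ Fintype.card {i // i ∉ T} / θ := by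
        rw [le_div_iff₀ hθ0, mul_comm]
        exact hmark.trans hprod
    _ ≤ Real.exp (Real.log q₁ * (n / 2)) / θ := by
        gcongr
        rw [← Real.rpow_natCast, Real.rpow_def_of_pos hq₁0, Real.exp_le_exp]
        nlinarith
    _ = Real.exp (Real.log q₁ / 4) ^ n := by
        rw [hθ, ← Real.exp_sub, ← Real.exp_nat_mul]
        congr 1
        rw [hc]
        field_simp
        ring

/-- Complex form of `exists_sum_sq_image_real_le`. -/
theorem exists_sum_sq_image_le {ρ : ℝ} (hρ0 : 0 ≤ ρ) (hρ : ρ < 1) (M : ℝ) :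
    ∃ c q : ℝ, 0 < c ∧ 0 < q ∧ q < 1 ∧ ∀ (Ω : Type*) [MeasurableSpace Ω] (P : Measure Ω)
      [IsProbabilityMeasure P] (ι : Type*) [Fintype ι] [LinearOrder ι] (X : Ω → ι → ι → ℝ),
      EllipticEntries P X ρ M → ∀ (y : ι → ℂ) (T : Finset ι), (∀ j ∉ T, y j = 0) →
      2 * T.card ≤ Fintype.card ι → 1 / 4 ≤ ∑ j, ‖y j‖ ^ 2 → ∑ j, ‖y j‖ ^ 2 ≤ 4 → ∀ v : ι → ℂ,
      P.real {ω | ∑ i ∈ Tᶜ, ‖∑ j, (X ω i j : ℂ) * y j + v i‖ ^ 2 ≤ c * Fintype.card ι}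
        ≤ q ^ Fintype.card ι := by
  obtain ⟨c, q, hc, hq, hq1, H⟩ := exists_sum_sq_image_real_le hρ0 hρ M
  refine ⟨c, q, hc, hq, hq1, fun Ω _ P _ ι _ _ X hX y T hyT hT hy1 hy2 v => ?_⟩
  have hsq : ∀ z : ℂ, ‖z‖ ^ 2 = z.re ^ 2 + z.im ^ 2 := fun z => by
    rw [← Complex.normSq_eq_norm_sq, Complex.normSq_apply]; ring
  -- Real or imaginary parts carry at least `1/8` of the squared length of `y`, and passing to them
  -- only decreases the sum of squares of the image.
  have main : ∀ f : ℂ →ₗ[ℝ] ℝ, (∀ z, |f z| ≤ ‖z‖) → 1 / 8 ≤ ∑ j, f (y j) ^ 2 →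
      P.real {ω | ∑ i ∈ Tᶜ, ‖∑ j, (X ω i j : ℂ) * y j + v i‖ ^ 2 ≤ c * Fintype.card ι}
        ≤ q ^ Fintype.card ι := by
    intro f hf h8
    have hf2 : ∀ z, f z ^ 2 ≤ ‖z‖ ^ 2 := fun z => by
      rw [← sq_abs]; gcongr; exact hf z
    refine le_trans (measureReal_mono ?_ (measure_ne_top _ _))
      (H Ω P ι X hX (fun j => f (y j)) T (fun j hj => by simp [hyT j hj]) hT h8 (fun j => ?_)
        (fun i => f (v i)))
    · intro ω hω
      simp only [Set.mem_ofPred_eq] at hω ⊢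
      refine (Finset.sum_le_sum fun i _ => ?_).trans hω
      have e : ∑ j, X ω i j * f (y j) + f (v i) = f (∑ j, (X ω i j : ℂ) * y j + v i) := by
        rw [map_add, map_sum]
        congr 2 with j
        rw [← Complex.real_smul, map_smul, smul_eq_mul]
      rw [e]
      exact hf2 _
    · exact (hf2 _).trans ((Finset.single_le_sum (f := fun j => ‖y j‖ ^ 2)
        (fun i _ => by positivity) (Finset.mem_univ j)).trans hy2)
  have hsum : ∑ j, ‖y j‖ ^ 2 = ∑ j, (y j).re ^ 2 + ∑ j, (y j).im ^ 2 := by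
    rw [← Finset.sum_add_distrib]; simp_rw [hsq]
  rcases le_total (1 / 8) (∑ j, (y j).re ^ 2) with h | h
  · exact main Complex.reLm Complex.abs_re_le_norm h
  · exact main Complex.imLm Complex.abs_im_le_norm (by simp only [Complex.imLm_coe]; linarith)

/-! ### Euclidean norms, operator bounds and spread vectors -/

/-- The Euclidean norm of a complex vector. -/
noncomputable def l2 {ι : Type*} [Fintype ι] (x : ι → ℂ) : ℝ := √(∑ i, ‖x i‖ ^ 2)

section l2

variable {ι : Type*} [Fintype ι]

lemma l2_eq_norm (x : ι → ℂ) : l2 x = ‖WithLp.toLp 2 x‖ := (EuclideanSpace.norm_eq _).symm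

lemma l2_nonneg (x : ι → ℂ) : 0 ≤ l2 x := Real.sqrt_nonneg _

lemma l2_sq (x : ι → ℂ) : l2 x ^ 2 = ∑ i, ‖x i‖ ^ 2 :=
  Real.sq_sqrt (Finset.sum_nonneg fun _ _ => by positivity)

lemma l2_add_le (x y : ι → ℂ) : l2 (x + y) ≤ l2 x + l2 y := by
  simp only [l2_eq_norm, WithLp.toLp_add]; exact norm_add_le _ _

lemma l2_sub_le (x y : ι → ℂ) : l2 (x - y) ≤ l2 x + l2 y := by
  simp only [l2_eq_norm, WithLp.toLp_sub]; exact norm_sub_le _ _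

lemma l2_smul (c : ℂ) (x : ι → ℂ) : l2 (c • x) = ‖c‖ * l2 x := by
  simp only [l2_eq_norm, WithLp.toLp_smul]; exact norm_smul _ _

lemma l2_eq_zero {x : ι → ℂ} : l2 x = 0 ↔ x = 0 := by
  rw [l2_eq_norm, norm_eq_zero, WithLp.toLp_eq_zero]

lemma l2_le_of_sum_sq_le {x : ι → ℂ} {r : ℝ} (hr : 0 ≤ r) (h : ∑ i, ‖x i‖ ^ 2 ≤ r ^ 2) :
    l2 x ≤ r := Real.sqrt_le_iff.2 ⟨hr, h⟩

lemma norm_sum_mul_le_l2 (x y : ι → ℂ) : ‖∑ i, x i * y i‖ ≤ l2 x * l2 y :=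
  calc ‖∑ i, x i * y i‖ ≤ ∑ i, ‖x i‖ * ‖y i‖ :=
        (norm_sum_le _ _).trans_eq (by simp_rw [norm_mul])
    _ ≤ _ := Real.sum_mul_le_sqrt_mul_sqrt _ _ _

end l2

/-- `A` has operator norm at most `k` on Euclidean space. -/
def OpBound {ι : Type*} [Fintype ι] (A : Matrix ι ι ℂ) (k : ℝ) : Prop :=
  ∀ x : ι → ℂ, l2 (A.mulVec x) ≤ k * l2 x

open Classical in
/-- A positive proportion `b` of the coordinates of `x` are at least `a` times their typical
size. -/
def Spread {ι : Type*} [Fintype ι] (a b : ℝ) (x : ι → ℂ) : Prop :=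
  b * Fintype.card ι
    ≤ ((Finset.univ.filter fun i => a * l2 x ≤ √(Fintype.card ι) * ‖x i‖).card : ℝ)

/-- The complex matrix with off-diagonal entries from `Y` and diagonal `d`. -/
def withDiag {ι : Type*} [DecidableEq ι] (Y : ι → ι → ℝ) (d : ι → ℂ) : Matrix ι ι ℂ :=
  Matrix.of fun i j => if i = j then d i else (Y i j : ℂ)

/-! ### Nets for vectors that are not spread -/

lemma sum_pow_natAbs_le {r : ℝ} (hr0 : 0 < r) (hr1 : r ≤ 1 / 2) (N : ℕ) :
    ∑ z ∈ Finset.Icc (-N : ℤ) N, r ^ z.natAbs ≤ 1 + 4 * r := by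
  -- The subtracted tail makes the induction close, since `2 r^(N+1) ≤ 4 r^(N+1) - 4 r^(N+2)` for `r
  -- ≤ 1/2`.
  have h : ∀ N : ℕ, ∑ z ∈ Finset.Icc (-N : ℤ) N, r ^ z.natAbs
      ≤ 1 + 4 * r - 4 * r ^ (N + 1) := by
    intro N
    induction N with
    | zero => simp
    | succ N ih =>
      have e : Finset.Icc (-((N + 1 : ℕ) : ℤ)) ((N + 1 : ℕ) : ℤ)
          = insert (-((N + 1 : ℕ) : ℤ)) (insert ((N + 1 : ℕ) : ℤ) (Finset.Icc (-N : ℤ) N)) := by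
        ext z
        simp only [Finset.mem_Icc, Finset.mem_insert]
        omega
      rw [e, Finset.sum_insert (by simp only [Finset.mem_insert, Finset.mem_Icc]; omega),
        Finset.sum_insert (by simp only [Finset.mem_Icc]; omega), Int.natAbs_neg,
        Int.natAbs_natCast]
      have : r ^ (N + 1 + 1) ≤ 1 / 2 * r ^ (N + 1) := by
        rw [pow_succ, mul_comm]; gcongr
      linarith
  have := h N
  have : 0 < r ^ (N + 1) := by positivity
  linarith

/-- A count of Gaussian integer vectors with small `ℓ¹` norm. -/
lemma card_filter_sum_natAbs_le {ι : Type*} [Fintype ι] [DecidableEq ι] {r : ℝ} (hr0 : 0 < r)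
    (hr1 : r ≤ 1 / 2) (N : ℕ) (T : ℝ) :
    (((Fintype.piFinset fun _ : ι =>
        Finset.Icc (-N : ℤ) N ×ˢ Finset.Icc (-N : ℤ) N).filter fun z =>
        ((∑ i, ((z i).1.natAbs + (z i).2.natAbs) : ℕ) : ℝ) ≤ T).card : ℝ)
      ≤ Real.exp (-Real.log r * T) * ((1 + 4 * r) ^ 2) ^ Fintype.card ι := by
  set Z := Fintype.piFinset fun _ : ι => Finset.Icc (-N : ℤ) N ×ˢ Finset.Icc (-N : ℤ) N
  set g : (ι → ℤ × ℤ) → ℕ := fun z => ∑ i, ((z i).1.natAbs + (z i).2.natAbs) with hg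
  have hlog : Real.log r < 0 := Real.log_neg hr0 (by linarith)
  -- A Chernoff bound for counting: the weight is at least one on the counted vectors, and its sum
  -- over the whole box factorizes over the coordinates.
  have h1 : ∀ z, (g z : ℝ) ≤ T → 1 ≤ Real.exp (-Real.log r * T) * r ^ g z := by
    intro z hz
    rw [← Real.rpow_natCast, Real.rpow_def_of_pos hr0, ← Real.exp_add, Real.one_le_exp_iff]
    nlinarith
  calc ((Z.filter fun z => (g z : ℝ) ≤ T).card : ℝ)
      = ∑ z ∈ Z.filter fun z => (g z : ℝ) ≤ T, (1 : ℝ) := by simp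
    _ ≤ ∑ z ∈ Z.filter fun z => (g z : ℝ) ≤ T, Real.exp (-Real.log r * T) * r ^ g z :=
        Finset.sum_le_sum fun z hz => h1 z (Finset.mem_filter.1 hz).2
    _ ≤ ∑ z ∈ Z, Real.exp (-Real.log r * T) * r ^ g z :=
        Finset.sum_le_sum_of_subset_of_nonneg (Finset.filter_subset _ _) fun z _ _ => by positivity
    _ = Real.exp (-Real.log r * T) * ∏ _i : ι, ∑ p ∈ Finset.Icc (-N : ℤ) N ×ˢ Finset.Icc (-N : ℤ) N,
          r ^ (p.1.natAbs + p.2.natAbs) := by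
        rw [← Finset.mul_sum, Finset.prod_univ_sum]
        congr 1
        refine Finset.sum_congr rfl fun z _ => ?_
        rw [hg, Finset.prod_pow_eq_pow_sum]
    _ ≤ _ := by
        rw [Finset.prod_const, Finset.card_univ]
        have h2 := sum_pow_natAbs_le hr0 hr1 N
        have h3 : 0 ≤ ∑ z ∈ Finset.Icc (-N : ℤ) N, r ^ z.natAbs :=
          Finset.sum_nonneg fun _ _ => by positivity
        simp_rw [pow_add]
        rw [Finset.sum_product]
        dsimp only
        rw [← Finset.sum_mul_sum, ← sq]
        gcongr

/-- Numbers below `1/2` in modulus round to zero, and the others move by at most `1/2 ≤ |y|`. -/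
lemma abs_round_le_two_mul (y : ℝ) : |(round y : ℝ)| ≤ 2 * |y| := by
  rcases lt_or_ge |y| (1 / 2) with h | h
  · have h1 : round y = 0 := by
      rw [round_eq_zero_iff]
      rw [abs_lt] at h
      exact ⟨h.1.le, h.2⟩
    simp [h1]
  · have h1 := abs_sub_round y
    have h2 : |(round y : ℝ)| ≤ |y| + |y - round y| := by
      have := abs_sub y (y - round y)
      simpa using this
    linarith

lemma norm_sub_round_le (x : ℂ) {h : ℝ} (hh : 0 < h) :
    ‖x - (h : ℂ) * ((round (x.re / h) : ℂ) + (round (x.im / h) : ℂ) * Complex.I)‖ ^ 2 ≤ h ^ 2 := by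
  have e1 : ∀ t : ℝ, (t - h * round (t / h)) ^ 2 ≤ h ^ 2 / 4 := fun t => by
    have h1 := abs_sub_round (t / h)
    have h2 : t - h * round (t / h) = h * (t / h - round (t / h)) := by field_simp
    rw [h2, mul_pow, ← sq_abs (t / h - round (t / h))]
    have : |t / h - round (t / h)| ^ 2 ≤ (1 / 2) ^ 2 := by gcongr
    nlinarith [sq_nonneg h]
  rw [← Complex.normSq_eq_norm_sq, Complex.normSq_apply]
  have h3 := e1 x.re
  have h4 := e1 x.im
  simp only [Complex.sub_re, Complex.sub_im, Complex.mul_re, Complex.mul_im, Complex.ofReal_re,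
    Complex.ofReal_im, Complex.add_re, Complex.add_im, Complex.intCast_re, Complex.intCast_im,
    Complex.I_re, Complex.I_im]
  ring_nf at h3 h4 ⊢
  linarith [sq_nonneg h]

section l2

variable {ι : Type*} [Fintype ι]

/-- A unit vector that is not spread is close to a Gaussian integer multiple of the mesh, with
small support and small `ℓ¹` norm. -/
lemma exists_grid_of_not_spread {a b : ℝ} (ha : 0 < a) (hb : 0 ≤ b) [Nonempty ι] {x : ι → ℂ}
    (hx : l2 x = 1) (hs : ¬ Spread a b x) :
    ∃ z : ι → ℤ × ℤ,
      l2 (x - fun i => ((a / √(Fintype.card ι) : ℝ) : ℂ) * ((z i).1 + (z i).2 * Complex.I)) ≤ a ∧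
      ((Finset.univ.filter fun i => z i ≠ 0).card : ℝ) ≤ b * Fintype.card ι ∧
      ((∑ i, ((z i).1.natAbs + (z i).2.natAbs) : ℕ) : ℝ) ≤ 4 * √b / a * Fintype.card ι := by
  classical
  set n := Fintype.card ι with hn
  have hn0 : (0 : ℝ) < n := by exact_mod_cast Fintype.card_pos
  set h := a / √n with hh
  have hh0 : 0 < h := by positivity
  have hh2 : n * h ^ 2 = a ^ 2 := by
    rw [hh, div_pow, Real.sq_sqrt hn0.le]; field_simp
  set B := Finset.univ.filter fun i => a * l2 x ≤ √n * ‖x i‖ with hB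
  have hBc : (B.card : ℝ) ≤ b * n := by
    unfold Spread at hs
    rw [not_le] at hs
    convert hs.le
  -- Coordinates below the threshold become zero, the others are rounded to the mesh `h`. Either way
  -- the error per coordinate is at most `h = a/√n`, and the total error is at most `a`.
  set z : ι → ℤ × ℤ := fun i =>
    if i ∈ B then (round ((x i).re / h), round ((x i).im / h)) else 0 with hz
  have hzB : ∀ i, i ∉ B → z i = 0 := fun i hi => by simp only [hz]; rw [if_neg hi]
  refine ⟨z, ?_, ?_, ?_⟩
  · apply l2_le_of_sum_sq_le ha.le
    rw [← hh2, hn, ← Finset.card_univ, ← nsmul_eq_mul]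
    apply Finset.sum_le_card_nsmul
    intro i _
    by_cases hi : i ∈ B
    · have := norm_sub_round_le (x i) hh0
      simpa only [Pi.sub_apply, hz, if_pos hi] using this
    · have h1 : √n * ‖x i‖ < a := by
        have := hi
        simp only [hB, Finset.mem_filter, Finset.mem_univ, true_and, not_le, hx, mul_one] at this
        exact this
      have h2 : ‖x i‖ ≤ h := by
        rw [hh, le_div_iff₀ (by positivity)]; linarith
      simp only [Pi.sub_apply, hzB i hi]
      simp only [Prod.fst_zero, Prod.snd_zero, Int.cast_zero, zero_mul, add_zero, mul_zero,
        sub_zero]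
      gcongr
  · refine le_trans ?_ hBc
    norm_cast
    apply Finset.card_le_card
    intro i hi
    by_contra hiB
    exact (Finset.mem_filter.1 hi).2 (hzB i hiB)
  · push_cast
    have h1 : ∀ i, (((z i).1.natAbs : ℝ) + ((z i).2.natAbs : ℝ))
        ≤ if i ∈ B then 4 / h * ‖x i‖ else 0 := by
      intro i
      by_cases hi : i ∈ B
      · simp only [hz, if_pos hi]
        rw [Nat.cast_natAbs, Nat.cast_natAbs, Int.cast_abs, Int.cast_abs]
        have h3 := abs_round_le_two_mul ((x i).re / h)
        have h4 := abs_round_le_two_mul ((x i).im / h)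
        rw [abs_div, abs_of_pos hh0] at h3 h4
        have h5 : |(x i).re| / h ≤ ‖x i‖ / h := by gcongr; exact Complex.abs_re_le_norm _
        have h6 : |(x i).im| / h ≤ ‖x i‖ / h := by gcongr; exact Complex.abs_im_le_norm _
        have : 4 / h * ‖x i‖ = 4 * (‖x i‖ / h) := by ring
        linarith
      · rw [hzB i hi, if_neg hi]; simp
    -- Cauchy–Schwarz on a support of size at most `b n`. Divided by the mesh, this gives an `ℓ¹`
    -- norm of order `n √b / a`, small relative to `n` once `√b` is small compared with `a`.
    have h2 : ∑ i ∈ B, ‖x i‖ ≤ √(b * n) := by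
      apply Real.le_sqrt_of_sq_le
      calc (∑ i ∈ B, ‖x i‖) ^ 2 ≤ B.card * ∑ i ∈ B, ‖x i‖ ^ 2 := sq_sum_le_card_mul_sum_sq
        _ ≤ b * n * 1 := by
            have : ∑ i ∈ B, ‖x i‖ ^ 2 ≤ 1 := by
              calc _ ≤ ∑ i, ‖x i‖ ^ 2 := Finset.sum_le_sum_of_subset_of_nonneg
                    (Finset.subset_univ _) fun _ _ _ => by positivity
                _ = 1 := by rw [← l2_sq, hx, one_pow]
            gcongr
        _ = b * n := mul_one _
    calc ∑ i, (((z i).1.natAbs : ℝ) + ((z i).2.natAbs : ℝ))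
        ≤ ∑ i, if i ∈ B then 4 / h * ‖x i‖ else 0 := Finset.sum_le_sum fun i _ => h1 i
      _ = 4 / h * ∑ i ∈ B, ‖x i‖ := by
          rw [Finset.sum_ite_mem, Finset.univ_inter, Finset.mul_sum]
      _ ≤ 4 / h * √(b * n) := by gcongr
      _ = 4 * √b / a * n := by
          rw [hh, Real.sqrt_mul hb]
          field_simp
          rw [Real.sq_sqrt hn0.le, mul_comm]

lemma l2_zero : l2 (0 : ι → ℂ) = 0 := l2_eq_zero.2 rfl

end l2

set_option maxHeartbeats 2000000 in
/-- Vectors that are not spread are unlikely to be mapped close to a given line. -/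
theorem exists_not_spread_le {ρ : ℝ} (hρ0 : 0 ≤ ρ) (hρ : ρ < 1) (M : ℝ) {K : ℝ} (hK : 0 < K) :
    ∃ a b C : ℝ, 0 < a ∧ 0 < b ∧ b ≤ 1 ∧ 0 < C ∧ ∀ (Ω : Type*) [MeasurableSpace Ω] (P : Measure Ω)
      [IsProbabilityMeasure P] (ι : Type*) [Fintype ι] [LinearOrder ι] [Nonempty ι]
      (X : Ω → ι → ι → ℝ), EllipticEntries P X ρ M → ∀ (d w : ι → ℂ), l2 w ≤ 1 →
      P.real {ω | OpBound (withDiag (X ω) d) (K * √(Fintype.card ι)) ∧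
        ∃ (x : ι → ℂ) (s : ℂ), l2 x = 1 ∧ ¬ Spread a b x ∧ ‖s‖ ≤ K * √(Fintype.card ι) ∧
          l2 ((withDiag (X ω) d).mulVec x - s • w) ≤ a * √(Fintype.card ι)}
        ≤ C / (Fintype.card ι : ℝ) ^ 2 := by
  classical
  obtain ⟨c, q, hc, hq, hq1, H⟩ := exists_sum_sq_image_le hρ0 hρ M
  set L := -Real.log q with hL
  have hL0 : 0 < L := by have := Real.log_neg hq hq1; linarith
  -- Entropy budget: one grid vector fails with probability `exp(-n L)`. The grid may cost `exp(n
  -- L/2)`, half of it for the box factor `(1 + 4r)²`, made small by `r`, and half for the weight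
  -- `r^(-T)`, made small by `b`.
  set r := min (1 / 2) (L / 96) with hr
  have hr0 : 0 < r := by positivity
  have hr1 : r ≤ 1 / 2 := min_le_left _ _
  have hr2 : r ≤ L / 96 := min_le_right _ _
  have hrL : (1 + 4 * r) ^ 2 ≤ Real.exp (L / 4) := by
    calc (1 + 4 * r) ^ 2 ≤ Real.exp (4 * r) ^ 2 := by
          gcongr; linarith [Real.add_one_le_exp (4 * r)]
      _ = Real.exp (8 * r) := by rw [← Real.exp_nat_mul]; congr 1; push_cast; ring
      _ ≤ _ := Real.exp_le_exp.2 (by linarith)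
  set l := -Real.log r with hl
  have hl0 : 0 < l := by have := Real.log_neg hr0 (by linarith); linarith
  -- The bound `1/4` keeps the lengths of grid vectors in `[1/2, 2]`. The other bound makes the
  -- total approximation error, `(2 + K) a √n`, at most `√c √n`.
  set a := min (1 / 4) (√c / (2 + K)) with ha
  have ha0 : 0 < a := by positivity
  have ha1 : a ≤ 1 / 4 := min_le_left _ _
  have ha2 : (2 + K) * a ≤ √c := by
    have := min_le_right (1 / 4) (√c / (2 + K))
    rw [← ha, le_div_iff₀ (by positivity)] at this
    linarith
  -- Chosen after `a` and `r`, so that the `ℓ¹` bound fits the entropy budget. The bound `1/2` makes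
  -- the supports contain at most half of the indices.
  set b := min (1 / 2) ((a * L / (16 * l)) ^ 2) with hb
  have hb0 : 0 < b := by positivity
  have hb1 : b ≤ 1 / 2 := min_le_left _ _
  have hb2 : l * (4 * √b / a) ≤ L / 4 := by
    have : √b ≤ a * L / (16 * l) := by
      rw [← Real.sqrt_sq (by positivity : 0 ≤ a * L / (16 * l))]
      exact Real.sqrt_le_sqrt (min_le_right _ _)
    calc l * (4 * √b / a) ≤ l * (4 * (a * L / (16 * l)) / a) := by gcongr
      _ = L / 4 := by field_simp; ring
  set N₁ := ⌈K / a⌉₊ + 1 with hN₁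
  refine ⟨a, b, (2 * N₁ + 1) ^ 2 * (8 / L ^ 2), ha0, hb0, by linarith, by positivity, ?_⟩
  intro Ω _ P _ ι _ _ _ X hX d w hw
  set n := Fintype.card ι with hn
  have hn0 : (0 : ℝ) < n := by exact_mod_cast Fintype.card_pos
  set h := a / √n with hh
  have hh0 : 0 < h := by positivity
  set T := 4 * √b / a * n with hT
  set N := ⌈T⌉₊ with hN
  set Z := (Fintype.piFinset fun _ : ι => Finset.Icc (-N : ℤ) N ×ˢ Finset.Icc (-N : ℤ) N).filter
    fun z => ((∑ i, ((z i).1.natAbs + (z i).2.natAbs) : ℕ) : ℝ) ≤ T with hZ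
  set S : Finset (ℤ × ℤ) := Finset.Icc (-N₁ : ℤ) N₁ ×ˢ Finset.Icc (-N₁ : ℤ) N₁ with hS
  set toV : (ι → ℤ × ℤ) → ι → ℂ := fun z i =>
    (h : ℂ) * ((z i).1 + (z i).2 * Complex.I) with htoV
  set toS : ℤ × ℤ → ℂ := fun σ =>
    ((a * √n : ℝ) : ℂ) * (σ.1 + σ.2 * Complex.I) with htoS
  set Tz : (ι → ℤ × ℤ) → Finset ι := fun z => Finset.univ.filter fun i => z i ≠ 0 with hTz
  set G := Z.filter fun z => 2 * (Tz z).card ≤ n ∧ 1 / 4 ≤ ∑ j, ‖toV z j‖ ^ 2 ∧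
    ∑ j, ‖toV z j‖ ^ 2 ≤ 4 with hG
  set E : (ι → ℤ × ℤ) × (ℤ × ℤ) → Set Ω := fun p =>
    {ω | ∑ i ∈ (Tz p.1)ᶜ, ‖∑ j, (X ω i j : ℂ) * toV p.1 j + (-(toS p.2 • w)) i‖ ^ 2 ≤ c * n} with hE
  have hcover : {ω | OpBound (withDiag (X ω) d) (K * √n) ∧
        ∃ (x : ι → ℂ) (s : ℂ), l2 x = 1 ∧ ¬ Spread a b x ∧ ‖s‖ ≤ K * √n ∧
          l2 ((withDiag (X ω) d).mulVec x - s • w) ≤ a * √n} ⊆ ⋃ p ∈ G ×ˢ S, E p := by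
    rintro ω ⟨hop, x, s, hx, hsp, hs, hAx⟩
    obtain ⟨z, hz1, hz2, hz3⟩ := exists_grid_of_not_spread ha0 hb0.le hx hsp
    rw [← hn] at hz1 hz2 hz3
    set σ : ℤ × ℤ := (round (s.re / (a * √n)), round (s.im / (a * √n))) with hσ
    have han : 0 < a * √n := by positivity
    have hσ1 : ‖s - toS σ‖ ≤ a * √n := by
      have := norm_sub_round_le s han
      exact (pow_le_pow_iff_left₀ (norm_nonneg _) han.le two_ne_zero).1 this
    have hxz : l2 (x - toV z) ≤ a := hz1
    have hzS : ∀ i, (z i).1.natAbs ≤ N ∧ (z i).2.natAbs ≤ N := by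
      intro i
      have h1 : (z i).1.natAbs + (z i).2.natAbs ≤ N := by
        have h2 : (z i).1.natAbs + (z i).2.natAbs ≤ ∑ i, ((z i).1.natAbs + (z i).2.natAbs) :=
          Finset.single_le_sum (f := fun i => (z i).1.natAbs + (z i).2.natAbs)
            (fun _ _ => Nat.zero_le _) (Finset.mem_univ i)
        refine h2.trans ?_
        have h3 : ((∑ i, ((z i).1.natAbs + (z i).2.natAbs) : ℕ) : ℝ) ≤ (N : ℝ) :=
          hz3.trans (Nat.le_ceil T)
        exact_mod_cast h3
      omega
    have hzn1 : l2 (toV z) ≤ 2 := by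
      have := l2_sub_le x (x - toV z)
      rw [sub_sub_cancel] at this
      linarith
    have hzn2 : 1 / 2 ≤ l2 (toV z) := by
      have := l2_add_le (x - toV z) (toV z)
      rw [sub_add_cancel] at this
      linarith
    have hzG : z ∈ G := by
      simp only [hG, hZ, Finset.mem_filter, Fintype.mem_piFinset, Finset.mem_product,
        Finset.mem_Icc]
      refine ⟨⟨fun i => ?_, hz3⟩, ?_, ?_, ?_⟩
      · have := hzS i
        omega
      · have h1 : (2 * (Tz z).card : ℝ) ≤ n := by
          have : ((Tz z).card : ℝ) ≤ b * n := hz2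
          nlinarith
        exact_mod_cast h1
      · rw [← l2_sq]; nlinarith
      · rw [← l2_sq]; nlinarith [l2_nonneg (toV z)]
    have hround : ∀ t : ℝ, |t| ≤ K * √n → round (t / (a * √n)) ∈ Finset.Icc (-N₁ : ℤ) N₁ := by
      intro t ht
      have h1 : |t / (a * √n)| ≤ K / a := by
        rw [abs_div, abs_of_pos han, div_le_div_iff₀ han ha0]
        nlinarith
      have h2 := abs_sub_round (t / (a * √n))
      have h3 : |(round (t / (a * √n)) : ℝ)| ≤ N₁ := by
        have := abs_sub (t / (a * √n)) (t / (a * √n) - round (t / (a * √n)))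
        rw [sub_sub_cancel] at this
        have h4 := Nat.le_ceil (K / a)
        rw [hN₁]; push_cast
        linarith
      rw [Finset.mem_Icc, ← abs_le]
      exact_mod_cast h3
    have hσS : σ ∈ S := by
      rw [hS, Finset.mem_product]
      exact ⟨hround _ ((Complex.abs_re_le_norm s).trans hs),
        hround _ ((Complex.abs_im_le_norm s).trans hs)⟩
    simp only [Set.mem_iUnion]
    refine ⟨(z, σ), Finset.mem_product.2 ⟨hzG, hσS⟩, ?_⟩
    -- Three errors add up: the assumed distance to the line, the rounding of `s`, and the rounding
    -- of `x` amplified by the operator norm.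
    have hfin : l2 ((withDiag (X ω) d).mulVec (toV z) - toS σ • w) ≤ √c * √n := by
      have e : (withDiag (X ω) d).mulVec (toV z) - toS σ • w
          = ((withDiag (X ω) d).mulVec x - s • w) +
            ((s - toS σ) • w - (withDiag (X ω) d).mulVec (x - toV z)) := by
        rw [Matrix.mulVec_sub, sub_smul]; abel
      rw [e]
      refine (l2_add_le _ _).trans ?_
      have h1 := l2_sub_le ((s - toS σ) • w) ((withDiag (X ω) d).mulVec (x - toV z))
      have h2 : l2 ((s - toS σ) • w) ≤ a * √n := by
        rw [l2_smul]
        calc _ ≤ a * √n * 1 := by gcongr; exact l2_nonneg _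
          _ = _ := mul_one _
      have h3 : l2 ((withDiag (X ω) d).mulVec (x - toV z)) ≤ K * √n * a :=
        (hop _).trans (by gcongr)
      have h4 : (2 + K) * a * √n ≤ √c * √n := by gcongr
      linarith
    have hsq : l2 ((withDiag (X ω) d).mulVec (toV z) - toS σ • w) ^ 2 ≤ c * n := by
      calc _ ≤ (√c * √n) ^ 2 := by gcongr; exact l2_nonneg _
        _ = c * n := by rw [mul_pow, Real.sq_sqrt hc.le, Real.sq_sqrt hn0.le]
    rw [l2_sq] at hsq
    show ∑ i ∈ (Tz z)ᶜ, ‖∑ j, (X ω i j : ℂ) * toV z j + (-(toS σ • w)) i‖ ^ 2 ≤ c * n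
    refine le_trans ?_ hsq
    refine le_trans (Finset.sum_le_sum fun i hi => ?_) (Finset.sum_le_sum_of_subset_of_nonneg
      (Finset.subset_univ (Tz z)ᶜ) fun _ _ _ => by positivity)
    apply le_of_eq
    congr 2
    rw [Pi.sub_apply, Pi.neg_apply, sub_eq_add_neg]
    congr 1
    rw [Matrix.mulVec, dotProduct]
    refine Finset.sum_congr rfl fun j _ => ?_
    simp only [withDiag, Matrix.of_apply]
    -- Row `i` lies outside the support of `z`, so the diagonal entry is multiplied by zero. The
    -- estimate is therefore uniform in `d`.
    by_cases hij : i = j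
    · subst hij
      have : z i = 0 := by
        by_contra h0
        exact (Finset.mem_compl.1 hi) (Finset.mem_filter.2 ⟨Finset.mem_univ _, h0⟩)
      have : toV z i = 0 := by simp only [htoV, this]; simp
      rw [this, mul_zero, mul_zero]
    · rw [if_neg hij]
  have hEp : ∀ p ∈ G ×ˢ S, P.real (E p) ≤ q ^ n := by
    rintro ⟨z, σ⟩ hp
    have hz := (Finset.mem_filter.1 (Finset.mem_product.1 hp).1).2
    refine H Ω P ι X hX (toV z) (Tz z) (fun j hj => ?_) hz.1 hz.2.1 hz.2.2 _
    have : z j = 0 := by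
      by_contra h0
      exact hj (Finset.mem_filter.2 ⟨Finset.mem_univ _, h0⟩)
    simp only [htoV, this]; simp
  have hGc : (G.card : ℝ) ≤ Real.exp (n * (L / 2)) := by
    calc (G.card : ℝ) ≤ Z.card := by exact_mod_cast Finset.card_filter_le _ _
      _ ≤ Real.exp (l * T) * ((1 + 4 * r) ^ 2) ^ n := card_filter_sum_natAbs_le hr0 hr1 N T
      _ ≤ Real.exp (n * (L / 4)) * Real.exp (L / 4) ^ n := by
          have h1 : l * T ≤ n * (L / 4) := by
            rw [hT, ← mul_assoc, mul_comm (n : ℝ)]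
            gcongr
          exact mul_le_mul (Real.exp_le_exp.2 h1) (pow_le_pow_left₀ (by positivity) hrL n)
            (by positivity) (by positivity)
      _ = _ := by rw [← Real.exp_nat_mul, ← Real.exp_add]; congr 1; ring
  have hSc : (S.card : ℝ) = (2 * N₁ + 1) ^ 2 := by
    rw [hS, Finset.card_product, Int.card_Icc]
    have : ((N₁ : ℤ) + 1 - -N₁).toNat = 2 * N₁ + 1 := by omega
    rw [this]; push_cast; ring
  calc _ ≤ P.real (⋃ p ∈ G ×ˢ S, E p) := measureReal_mono hcover (measure_ne_top _ _)
    _ ≤ ∑ p ∈ G ×ˢ S, P.real (E p) := measureReal_biUnion_finset_le _ _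
    _ ≤ ∑ _p ∈ G ×ˢ S, q ^ n := Finset.sum_le_sum hEp
    _ = G.card * S.card * q ^ n := by
        rw [Finset.sum_const, nsmul_eq_mul, Finset.card_product]; push_cast; ring
    _ ≤ Real.exp (n * (L / 2)) * (2 * N₁ + 1) ^ 2 * Real.exp (-(n * L)) := by
        rw [hSc]
        gcongr
        rw [← Real.rpow_natCast, Real.rpow_def_of_pos hq, Real.exp_le_exp]
        linarith
    _ = (2 * N₁ + 1) ^ 2 * (1 / Real.exp (n * (L / 2))) := by
        rw [one_div, ← Real.exp_neg, mul_comm (Real.exp _), mul_assoc, ← Real.exp_add]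
        congr 2; ring
    -- The exponential bound is weakened to `n⁻²`, which survives a later union bound over `n` rows.
    _ ≤ (2 * N₁ + 1) ^ 2 * (1 / ((n * (L / 2)) ^ 2 / 2)) := by
        gcongr
        have := Real.quadratic_le_exp_of_nonneg (by positivity : 0 ≤ n * (L / 2))
        have h5 : 0 ≤ n * (L / 2) := by positivity
        linarith
    _ = _ := by field_simp; ring

/-! ### Transposes, inverses, minors and Schur complements -/

/-- The squared Hilbert–Schmidt norm. -/
noncomputable def hsSq {ι : Type*} [Fintype ι] (G : Matrix ι ι ℂ) : ℝ := ∑ i, l2 (G i) ^ 2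

section matrices

variable {ι : Type*} [Fintype ι]

lemma hsSq_transpose (G : Matrix ι ι ℂ) : hsSq G.transpose = hsSq G := by
  simp only [hsSq, l2_sq, Matrix.transpose_apply]
  exact Finset.sum_comm

/-- For `y = Aᵀ x` the squared length of `y` is the bilinear pairing of `x` with `A ȳ`;
Cauchy–Schwarz and the bound for `A` then allow one factor `l2 y` to be cancelled. -/
lemma OpBound.transpose {A : Matrix ι ι ℂ} {k : ℝ} (h : OpBound A k) : OpBound A.transpose k := by
  intro x
  set y := A.transpose.mulVec x with hy
  rcases (l2_nonneg y).eq_or_lt with h0 | h0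
  · rw [← h0]
    rcases (l2_nonneg x).eq_or_lt with h1 | h1
    · rw [← h1, mul_zero]
    · have := (l2_nonneg _).trans (h x)
      exact this
  · have h1 : ((l2 y ^ 2 : ℝ) : ℂ) = ∑ i, x i * (A.mulVec (star y)) i := by
      rw [l2_sq]
      push_cast
      have e : ∑ i, x i * (A.mulVec (star y)) i = ∑ j, y j * star (y j) := by
        have := Matrix.dotProduct_mulVec x A (star y)
        rw [← Matrix.mulVec_transpose] at this
        exact this
      rw [e]
      refine Finset.sum_congr rfl fun j _ => ?_
      rw [RCLike.star_def, Complex.mul_conj, Complex.normSq_eq_norm_sq]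
      push_cast; rfl
    have h2 : l2 (star y) = l2 y := by simp [l2]
    have h3 := norm_sum_mul_le_l2 x (A.mulVec (star y))
    rw [← h1, Complex.norm_real, Real.norm_of_nonneg (by positivity)] at h3
    have h4 := h (star y)
    rw [h2] at h4
    have h5 : l2 y * l2 y ≤ k * l2 x * l2 y := by
      calc l2 y * l2 y = l2 y ^ 2 := (sq _).symm
        _ ≤ l2 x * l2 (A.mulVec (star y)) := h3
        _ ≤ l2 x * (k * l2 y) := by gcongr; exact l2_nonneg _
        _ = _ := by ring
    exact le_of_mul_le_mul_right h5 h0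

variable [DecidableEq ι]

lemma l2_single (j : ι) : l2 (Pi.single j (1 : ℂ)) = 1 := by
  have : ∑ i, ‖(Pi.single j (1 : ℂ) : ι → ℂ) i‖ ^ 2 = 1 := by
    rw [Finset.sum_eq_single j]
    · simp
    · intro i _ hi; simp [hi]
    · simp
  rw [l2, this, Real.sqrt_one]

/-- `B` maps each column of `B⁻¹` to a unit vector, so each column has length at least `1/(K√n)`;
the `n` columns are summed. This lets the `1` in the normalization `√(1 + |Gᵀ v|²)` be absorbed in
the Hilbert–Schmidt norm. -/
lemma one_le_of_opBound_inv {B : Matrix ι ι ℂ} {K : ℝ} [Nonempty ι]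
    (hB : OpBound B (K * √(Fintype.card ι))) (hdet : B.det ≠ 0) : 1 ≤ K ^ 2 * hsSq B⁻¹ := by
  have hn0 : (0 : ℝ) < Fintype.card ι := by exact_mod_cast Fintype.card_pos
  have h1 : ∀ j, 1 ≤ K ^ 2 * Fintype.card ι * l2 (B⁻¹.transpose j) ^ 2 := by
    intro j
    have h2 := hB (B⁻¹.mulVec (Pi.single j 1))
    rw [Matrix.mulVec_mulVec, Matrix.mul_nonsing_inv _ (isUnit_iff_ne_zero.2 hdet),
      Matrix.one_mulVec, l2_single, Matrix.mulVec_single_one] at h2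
    have h3 : 1 ^ 2 ≤ (K * √(Fintype.card ι) * l2 (B⁻¹.col j)) ^ 2 := by gcongr
    rw [mul_pow, mul_pow, Real.sq_sqrt hn0.le, one_pow] at h3
    exact h3
  rw [← hsSq_transpose, hsSq]
  have h4 := Finset.card_nsmul_le_sum Finset.univ _ 1 fun j _ => h1 j
  rw [← Finset.mul_sum, nsmul_eq_mul, mul_one, Finset.card_univ] at h4
  have h5 : (Fintype.card ι : ℝ) * 1
      ≤ Fintype.card ι * (K ^ 2 * ∑ i, l2 (B⁻¹.transpose i) ^ 2) := by linarith
  exact le_of_mul_le_mul_left h5 hn0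

/-- The principal submatrix with row and column `k` removed. -/
def minor (A : Matrix ι ι ℂ) (k : ι) : Matrix {i // i ≠ k} {i // i ≠ k} ℂ :=
  A.submatrix (↑) (↑)

lemma OpBound.minor {A : Matrix ι ι ℂ} {c : ℝ} (h : OpBound A c) (k : ι) :
    OpBound (minor A k) c := by
  intro y
  set x : ι → ℂ := fun i => if hi : i ≠ k then y ⟨i, hi⟩ else 0 with hx
  have hxk : x k = 0 := by simp [hx]
  have hxi : ∀ i : {i // i ≠ k}, x i = y i := fun i => by simp [hx, i.2]
  have h1 : l2 x = l2 y := by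
    unfold l2
    rw [Fintype.sum_eq_add_sum_subtype_ne _ k, hxk]
    simp_rw [hxi]
    simp
  have h2 : ∀ i : {i // i ≠ k}, (A.mulVec x) i = ((_root_.minor A k).mulVec y) i := fun i => by
    rw [Matrix.mulVec, dotProduct, Fintype.sum_eq_add_sum_subtype_ne _ k, hxk, mul_zero, zero_add]
    simp_rw [hxi]
    rfl
  rw [← h1]
  refine le_trans ?_ (h x)
  unfold l2
  apply Real.sqrt_le_sqrt
  rw [Fintype.sum_eq_add_sum_subtype_ne (fun i => ‖(A.mulVec x) i‖ ^ 2) k]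
  simp_rw [h2]
  have : 0 ≤ ‖(A.mulVec x) k‖ ^ 2 := by positivity
  linarith

/-- A lower bound for `A x` through the distance of the `k`-th column to the span of the others,
expressed by the inverse of the complementary minor. -/
lemma norm_mul_schur_le {A : Matrix ι ι ℂ} {k : ι} (hdet : (minor A k).det ≠ 0) (x : ι → ℂ) :
    ‖x k‖ * ‖A k k - dotProduct (fun i : {i // i ≠ k} => A k i)
        ((minor A k)⁻¹.mulVec fun i => A i k)‖
      ≤ l2 (A.mulVec x)
        * √(1 + l2 ((minor A k)⁻¹.transpose.mulVec fun i => A k i) ^ 2) := by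
  set G := (minor A k)⁻¹ with hG
  set v : {i // i ≠ k} → ℂ := fun i => A k i with hv
  set u : {i // i ≠ k} → ℂ := fun i => A i k with hu
  set p := G.transpose.mulVec v with hp
  have hpv : Matrix.vecMul p (minor A k) = v := by
    rw [hp, Matrix.mulVec_transpose, Matrix.vecMul_vecMul,
      Matrix.nonsing_inv_mul _ (isUnit_iff_ne_zero.2 hdet), Matrix.vecMul_one]
  -- The row vector with `1` at `k` and `-p` elsewhere annihilates every column of `A` except the
  -- `k`-th, where it gives the Schur complement. Pairing it with `A x` isolates `x k`.
  set w : ι → ℂ := fun i => if hi : i ≠ k then - p ⟨i, hi⟩ else 1 with hw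
  have hwk : w k = 1 := by simp [hw]
  have hwi : ∀ i : {i // i ≠ k}, w i = - p i := fun i => by simp [hw, i.2]
  have hl2 : l2 w = √(1 + l2 p ^ 2) := by
    rw [l2_sq, l2, Fintype.sum_eq_add_sum_subtype_ne _ k, hwk]
    simp_rw [hwi]
    simp
  have hvec : Matrix.vecMul w A = Pi.single k (A k k - dotProduct v (G.mulVec u)) := by
    funext j
    rw [Matrix.vecMul, dotProduct, Fintype.sum_eq_add_sum_subtype_ne _ k, hwk]
    simp_rw [hwi]
    by_cases hj : j = k
    · subst hj
      rw [Pi.single_eq_same, Matrix.dotProduct_mulVec, ← Matrix.mulVec_transpose, ← hp, dotProduct]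
      simp only [neg_mul, Finset.sum_neg_distrib, one_mul]
      rw [sub_eq_add_neg]
    · rw [Pi.single_eq_of_ne hj]
      have := congrFun hpv ⟨j, hj⟩
      simp only [Matrix.vecMul, dotProduct, minor, Matrix.submatrix_apply, hv] at this
      simp only [neg_mul, Finset.sum_neg_distrib, one_mul]
      rw [this, add_neg_cancel]
  have e : ∑ i, w i * (A.mulVec x) i = x k * (A k k - dotProduct v (G.mulVec u)) := by
    have := Matrix.dotProduct_mulVec w A x
    rw [hvec, single_dotProduct] at this
    rw [mul_comm (x k)]
    exact this
  rw [← norm_mul, ← e, ← hl2, mul_comm (l2 _)]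
  exact norm_sum_mul_le_l2 _ _

end matrices

/-! ### Combinatorics of spread vectors -/

section spread

variable {ι : Type*} [Fintype ι]

/-- Few coordinates of a vector are much larger than typical. -/
lemma card_large_mul_sq_le [DecidableEq ι] {x : ι → ℂ} {R c : ℝ} (hR : 0 < R) (hc : 0 ≤ c)
    (hx : l2 x ≤ R) :
    ((Finset.univ.filter fun i => c * R < √(Fintype.card ι) * ‖x i‖).card : ℝ) * c ^ 2
      ≤ Fintype.card ι := by
  set T := Finset.univ.filter fun i => c * R < √(Fintype.card ι) * ‖x i‖ with hT
  have h1 : T.card • (c * R) ^ 2 ≤ ∑ i ∈ T, (√(Fintype.card ι) * ‖x i‖) ^ 2 := by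
    apply Finset.card_nsmul_le_sum
    intro i hi
    have := (Finset.mem_filter.1 hi).2
    gcongr
  have h2 : ∑ i ∈ T, (√(Fintype.card ι) * ‖x i‖) ^ 2 ≤ Fintype.card ι * R ^ 2 := by
    simp_rw [mul_pow, Real.sq_sqrt (Nat.cast_nonneg (Fintype.card ι))]
    rw [← Finset.mul_sum]
    gcongr
    calc ∑ i ∈ T, ‖x i‖ ^ 2 ≤ ∑ i, ‖x i‖ ^ 2 := Finset.sum_le_sum_of_subset_of_nonneg
          (Finset.subset_univ _) fun _ _ _ => by positivity
      _ = l2 x ^ 2 := (l2_sq x).symm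
      _ ≤ R ^ 2 := by gcongr; exact l2_nonneg _
  rw [nsmul_eq_mul, mul_pow] at h1
  have h3 : (T.card * c ^ 2) * R ^ 2 ≤ Fintype.card ι * R ^ 2 := by linarith
  exact le_of_mul_le_mul_right h3 (by positivity)

/-- If `α` is spread and dominates `β`, then on a large set of coordinates outside a small set the
pairs `(α i, β i)` have comparable sizes. -/
lemma exists_comparable_of_spread [DecidableEq ι] {a b : ℝ} (ha : 0 < a) (hb : 0 < b)
    {α β : ι → ℂ} [Nonempty ι] (hα : Spread a b α) (h0 : 0 < l2 α) (hβ : l2 β ≤ l2 α)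
    {J : Finset ι} (hJ : (J.card : ℝ) ≤ b / 4 * Fintype.card ι) :
    ∃ S : Finset ι, Disjoint S J ∧ b / 2 * Fintype.card ι ≤ S.card ∧
      ∀ i ∈ S, (a * l2 α / √(Fintype.card ι)) ^ 2 ≤ ‖α i‖ ^ 2 + ‖β i‖ ^ 2 ∧
        ‖α i‖ ^ 2 + ‖β i‖ ^ 2 ≤ 16 / (b * a ^ 2) * (a * l2 α / √(Fintype.card ι)) ^ 2 := by
  classical
  set n := Fintype.card ι with hn
  have hn0 : (0 : ℝ) < n := by exact_mod_cast Fintype.card_pos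
  -- With `c² = 8/b` each set of atypically large coordinates has at most `b n/8` elements. Together
  -- with `J` at most `b n/2` of the `b n` good indices are lost.
  set c := √(8 / b) with hc
  have hc2 : c ^ 2 = 8 / b := Real.sq_sqrt (by positivity)
  set S₀ := Finset.univ.filter fun i => a * l2 α ≤ √n * ‖α i‖ with hS₀
  set T₁ := Finset.univ.filter fun i => c * l2 α < √n * ‖α i‖ with hT₁
  set T₂ := Finset.univ.filter fun i => c * l2 α < √n * ‖β i‖ with hT₂
  have hS₀c : b * n ≤ (S₀.card : ℝ) := by
    unfold Spread at hα
    convert hα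
  have hTc : ∀ t : ℝ, t * c ^ 2 ≤ n → t ≤ b / 8 * n := fun t ht => by
    rw [hc2] at ht
    have : t * (8 / b) * (b / 8) ≤ n * (b / 8) := by gcongr
    have e : t * (8 / b) * (b / 8) = t := by field_simp
    linarith
  have hT₁c := hTc _ (card_large_mul_sq_le h0 (Real.sqrt_nonneg (8 / b)) (le_refl (l2 α)))
  have hT₂c := hTc _ (card_large_mul_sq_le h0 (Real.sqrt_nonneg (8 / b)) hβ)
  refine ⟨S₀ \ (J ∪ (T₁ ∪ T₂)), ?_, ?_, ?_⟩
  · exact Finset.disjoint_left.2 fun i hi hiJ =>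
      (Finset.mem_sdiff.1 hi).2 (Finset.mem_union_left _ hiJ)
  · have h1 : S₀.card ≤ (S₀ \ (J ∪ (T₁ ∪ T₂))).card + (J.card + (T₁.card + T₂.card)) := by
      have h2 := Finset.le_card_sdiff (J ∪ (T₁ ∪ T₂)) S₀
      have h3 := Finset.card_union_le J (T₁ ∪ T₂)
      have h4 := Finset.card_union_le T₁ T₂
      omega
    have h5 : (S₀.card : ℝ) ≤ (S₀ \ (J ∪ (T₁ ∪ T₂))).card + (J.card + (T₁.card + T₂.card)) := by
      exact_mod_cast h1
    linarith
  · intro i hi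
    rw [Finset.mem_sdiff, Finset.mem_union, Finset.mem_union] at hi
    have h1 : a * l2 α ≤ √n * ‖α i‖ := (Finset.mem_filter.1 hi.1).2
    have h2 : √n * ‖α i‖ ≤ c * l2 α := by
      by_contra h
      exact hi.2 (Or.inr (Or.inl (Finset.mem_filter.2 ⟨Finset.mem_univ _, not_le.1 h⟩)))
    have h3 : √n * ‖β i‖ ≤ c * l2 α := by
      by_contra h
      exact hi.2 (Or.inr (Or.inr (Finset.mem_filter.2 ⟨Finset.mem_univ _, not_le.1 h⟩)))
    have hsn : 0 < √(n : ℝ) := by positivity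
    have e1 : a * l2 α / √n ≤ ‖α i‖ := by rw [div_le_iff₀ hsn]; linarith
    have e2 : ‖α i‖ ≤ c * l2 α / √n := by rw [le_div_iff₀ hsn]; linarith
    have e3 : ‖β i‖ ≤ c * l2 α / √n := by rw [le_div_iff₀ hsn]; linarith
    constructor
    · have : (a * l2 α / √n) ^ 2 ≤ ‖α i‖ ^ 2 := by gcongr
      have : 0 ≤ ‖β i‖ ^ 2 := by positivity
      linarith
    · have e4 : ‖α i‖ ^ 2 ≤ (c * l2 α / √n) ^ 2 := by gcongr
      have e5 : ‖β i‖ ^ 2 ≤ (c * l2 α / √n) ^ 2 := by gcongr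
      have e6 : (c * l2 α / √n) ^ 2 = 8 / (b * a ^ 2) * (a * l2 α / √n) ^ 2 := by
        rw [div_pow, mul_pow, hc2]; field_simp
      have e7 : 16 / (b * a ^ 2) * (a * l2 α / √n) ^ 2
          = 2 * (8 / (b * a ^ 2) * (a * l2 α / √n) ^ 2) := by ring
      linarith

/-- A finite set is covered by boundedly many subsets of small relative size. -/
lemma exists_cover_small {η : ℝ} (hη : 0 < η) :
    ∃ L : ℕ, 0 < L ∧ ∀ (ι : Type*) [Fintype ι], 1 ≤ η * Fintype.card ι →
      ∃ J : Fin L → Finset ι, (∀ i, ∃ l, i ∈ J l) ∧ ∀ l, ((J l).card : ℝ) ≤ η * Fintype.card ι := by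
  classical
  refine ⟨⌈2 / η⌉₊ + 1, by omega, fun ι _ hι => ?_⟩
  set n := Fintype.card ι with hn
  -- Blocks of `s` consecutive indices are used. The assumption `1 ≤ η n` makes `s` positive, whence
  -- `s ≥ η n/2`, and `⌈2/η⌉ + 1` blocks suffice.
  set s := ⌊η * n⌋₊ with hs
  have hs1 : 1 ≤ s := Nat.le_floor (by simpa using hι)
  have hs2 : (s : ℝ) ≤ η * n := Nat.floor_le (by linarith)
  have hs3 : η * n ≤ 2 * s := by
    have := Nat.lt_floor_add_one (η * n)
    have : (1 : ℝ) ≤ s := by exact_mod_cast hs1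
    linarith
  set e := Fintype.equivFin ι with he
  refine ⟨fun l => Finset.univ.filter fun i => (e i : ℕ) / s = l, fun i => ?_, fun l => ?_⟩
  · have h1 : (e i : ℕ) / s < ⌈2 / η⌉₊ + 1 := by
      rw [Nat.lt_succ_iff]
      apply Nat.div_le_of_le_mul
      have h2 : ((e i : ℕ) : ℝ) ≤ n := by exact_mod_cast (e i).2.le
      have h3 : (n : ℝ) ≤ s * ⌈2 / η⌉₊ := by
        calc (n : ℝ) = η * n * (1 / η) := by field_simp
          _ ≤ 2 * s * (1 / η) := by gcongr
          _ = s * (2 / η) := by ring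
          _ ≤ _ := by gcongr; exact Nat.le_ceil _
      have h4 : ((e i : ℕ) : ℝ) ≤ ((s * ⌈2 / η⌉₊ : ℕ) : ℝ) := by push_cast; linarith
      exact_mod_cast h4
    exact ⟨⟨_, h1⟩, Finset.mem_filter.2 ⟨Finset.mem_univ _, rfl⟩⟩
  · refine le_trans ?_ hs2
    norm_cast
    calc _ ≤ (Finset.Ico ((l : ℕ) * s) ((l : ℕ) * s + s)).card := by
          refine Finset.card_le_card_of_injOn (fun i => (e i : ℕ)) (fun i hi => ?_) ?_
          · have h1 := (Finset.mem_filter.1 hi).2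
            rw [Finset.coe_Ico, Set.mem_Ico]
            have h2 := Nat.div_add_mod (e i : ℕ) s
            have h3 := Nat.mod_lt (e i : ℕ) hs1
            rw [h1, mul_comm] at h2
            show (l : ℕ) * s ≤ (e i : ℕ) ∧ (e i : ℕ) < (l : ℕ) * s + s
            omega
          · intro i _ j _ hij
            exact e.injective (Fin.ext hij)
      _ = s := by rw [Nat.card_Ico]; omega

end spread

/-! ### Measurability -/

section measurability

variable {Ω : Type*} [MeasurableSpace Ω] {ι : Type*} [Fintype ι]

lemma Measurable.l2 {f : Ω → ι → ℂ} (hf : Measurable f) : Measurable fun ω => l2 (f ω) := by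
  unfold _root_.l2
  have : ∀ i, Measurable fun ω => f ω i := fun i => (measurable_pi_apply i).comp hf
  fun_prop

lemma measurableSet_spread {f : Ω → ι → ℂ} (hf : Measurable f) (a b : ℝ) :
    MeasurableSet {ω | Spread a b (f ω)} := by
  classical
  have h1 : ∀ i, Measurable fun ω => f ω i := fun i => (measurable_pi_apply i).comp hf
  have h2 := hf.l2
  have h3 : ∀ ω, ((Finset.univ.filter fun i =>
      a * l2 (f ω) ≤ √(Fintype.card ι) * ‖f ω i‖).card : ℝ)
      = ∑ i, if a * l2 (f ω) ≤ √(Fintype.card ι) * ‖f ω i‖ then (1 : ℝ) else 0 := fun ω => by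
    rw [Finset.card_filter]; push_cast; rfl
  have e : {ω | Spread a b (f ω)} = {ω | b * Fintype.card ι ≤
      ∑ i, if a * l2 (f ω) ≤ √(Fintype.card ι) * ‖f ω i‖ then (1 : ℝ) else 0} := by
    ext ω
    simp only [Set.mem_ofPred_eq, ← h3]
    unfold Spread
    constructor <;> intro h <;> convert h
  rw [e]
  refine measurableSet_le measurable_const (Finset.measurable_sum _ fun i _ => ?_)
  exact Measurable.ite (measurableSet_le (by fun_prop) (by have := h1 i; fun_prop))
    measurable_const measurable_const

lemma measurable_mulVec {A : Ω → Matrix ι ι ℂ} {x : Ω → ι → ℂ}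
    (hA : ∀ i j, Measurable fun ω => A ω i j) (hx : ∀ i, Measurable fun ω => x ω i) :
    Measurable fun ω => (A ω).mulVec (x ω) :=
  measurable_pi_lambda _ fun i => Finset.measurable_sum _ fun j _ => (hA i j).mul (hx j)

/-- The condition runs over uncountably many vectors; it is measurable because it is closed in the
entries. -/
lemma measurableSet_opBound {A : Ω → Matrix ι ι ℂ} (hA : ∀ i j, Measurable fun ω => A ω i j)
    (c : ℝ) : MeasurableSet {ω | OpBound (A ω) c} := by
  have hcl : IsClosed {B : ι → ι → ℂ | OpBound (Matrix.of B) c} := by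
    have : {B : ι → ι → ℂ | OpBound (Matrix.of B) c}
        = ⋂ x : ι → ℂ, {B : ι → ι → ℂ | l2 ((Matrix.of B).mulVec x) ≤ c * l2 x} := by
      ext B; simp [OpBound]
    rw [this]
    refine isClosed_iInter fun x => isClosed_le ?_ continuous_const
    simp only [_root_.l2, Matrix.mulVec, dotProduct, Matrix.of_apply]
    fun_prop
  have hm : Measurable fun ω => (fun i j => A ω i j : ι → ι → ℂ) :=
    measurable_pi_lambda _ fun i => measurable_pi_lambda _ fun j => hA i j
  exact hm hcl.measurableSet

variable [DecidableEq ι]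

lemma measurable_det {A : Ω → Matrix ι ι ℂ} (hA : ∀ i j, Measurable fun ω => A ω i j) :
    Measurable fun ω => (A ω).det := by
  simp_rw [Matrix.det_apply]
  refine Finset.measurable_sum _ fun σ _ => Measurable.const_smul ?_ _
  exact Finset.measurable_prod _ fun i _ => hA _ _

lemma measurable_inv_apply {A : Ω → Matrix ι ι ℂ} (hA : ∀ i j, Measurable fun ω => A ω i j)
    (i j : ι) : Measurable fun ω => (A ω)⁻¹ i j := by
  simp_rw [Matrix.inv_def, Matrix.smul_apply, Matrix.adjugate_apply, Ring.inverse_eq_inv',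
    smul_eq_mul]
  refine (measurable_det hA).inv.mul (measurable_det fun k l => ?_)
  simp only [Matrix.updateRow_apply]
  split_ifs
  exacts [measurable_const, hA k l]

end measurability

lemma measurable_withDiag {Ω : Type*} [MeasurableSpace Ω] {ι : Type*} [DecidableEq ι]
    {Y : Ω → ι → ι → ℝ} (hY : ∀ i j, i ≠ j → Measurable fun ω => Y ω i j) (d : ι → ℂ) (i j : ι) :
    Measurable fun ω => withDiag (Y ω) d i j := by
  simp only [withDiag, Matrix.of_apply]
  split_ifs with h
  exacts [measurable_const, Complex.measurable_ofReal.comp (hY i j h)]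

/-! ### Product measures and resampling -/

section products

/-- A set in a product whose sections outside an exceptional set are small is small. -/
lemma measureReal_prod_le_of_section_le {E F : Type*} [MeasurableSpace E] [MeasurableSpace F]
    (μ : Measure E) (ν : Measure F) [IsProbabilityMeasure μ] [IsProbabilityMeasure ν]
    {W : Set (E × F)} (hW : MeasurableSet W) {D : Set F} (hD : MeasurableSet D) {c : ℝ}
    (h : ∀ y ∉ D, μ.real {x | (x, y) ∈ W} ≤ c) (hc : 0 ≤ c) :
    (μ.prod ν).real W ≤ ν.real D + c := by
  have hs : ∀ y, MeasurableSet {x | (x, y) ∈ W} := fun y => measurable_prodMk_right hW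
  have h1 : (μ.prod ν).real W = ∫ y, μ.real {x | (x, y) ∈ W} ∂ν := by
    rw [measureReal_def, Measure.prod_apply_symm hW, ← integral_toReal]
    · rfl
    · exact (measurable_measure_prodMk_right hW).aemeasurable
    · exact Filter.Eventually.of_forall fun y => measure_lt_top _ _
  have hle1 : ∀ y, μ.real {x | (x, y) ∈ W} ≤ 1 := fun y => measureReal_le_one
  rw [h1]
  calc ∫ y, μ.real {x | (x, y) ∈ W} ∂ν ≤ ∫ y, (D.indicator (fun _ => (1 : ℝ)) y + c) ∂ν := by
        refine integral_mono_of_nonneg (Filter.Eventually.of_forall fun y => measureReal_nonneg)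
          (((integrable_const _).indicator hD).add (integrable_const _))
          (Filter.Eventually.of_forall fun y => ?_)
        by_cases hy : y ∈ D
        · simp only [Set.indicator_of_mem hy]; linarith [hle1 y]
        · simp only [Set.indicator_of_notMem hy]; linarith [h y hy]
    _ = ν.real D + c := by
        rw [integral_add ((integrable_const _).indicator hD) (integrable_const _),
          integral_indicator_const _ hD]
        simp

/-- The square of the probability of a section is the probability that two independent copies both
fall into it. Integrating over the base and using `(∫ f)² ≤ ∫ f²` gives the claim. -/
lemma sq_measureReal_prod_le {E F : Type*} [MeasurableSpace E] [MeasurableSpace F]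
    (μ : Measure E) (ν : Measure F) [IsProbabilityMeasure μ] [IsProbabilityMeasure ν]
    {W : Set (E × F)} (hW : MeasurableSet W) :
    (μ.prod ν).real W ^ 2
      ≤ (μ.prod (ν.prod ν)).real {p | (p.1, p.2.1) ∈ W ∧ (p.1, p.2.2) ∈ W} := by
  set f : E → ℝ := fun x => ν.real {y | (x, y) ∈ W} with hf
  have hfm : Measurable f := (measurable_measure_prodMk_left hW).ennreal_toReal
  have h1 : (μ.prod ν).real W = ∫ x, f x ∂μ := by
    rw [measureReal_def, Measure.prod_apply hW, ← integral_toReal]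
    · rfl
    · exact (measurable_measure_prodMk_left hW).aemeasurable
    · exact Filter.Eventually.of_forall fun y => measure_lt_top _ _
  set W2 : Set (E × F × F) := {p | (p.1, p.2.1) ∈ W ∧ (p.1, p.2.2) ∈ W} with hW2
  have hW2m : MeasurableSet W2 := by
    apply MeasurableSet.inter
    · exact (by fun_prop : Measurable fun p : E × F × F => (p.1, p.2.1)) hW
    · exact (by fun_prop : Measurable fun p : E × F × F => (p.1, p.2.2)) hW
  have h2 : (μ.prod (ν.prod ν)).real W2 = ∫ x, f x ^ 2 ∂μ := by
    rw [measureReal_def, Measure.prod_apply hW2m, ← integral_toReal]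
    · congr 1 with x
      have : Prod.mk x ⁻¹' W2 = {y | (x, y) ∈ W} ×ˢ {y | (x, y) ∈ W} := by
        ext p; rfl
      rw [this, Measure.prod_prod, ENNReal.toReal_mul, sq]
      rfl
    · exact (measurable_measure_prodMk_left hW2m).aemeasurable
    · exact Filter.Eventually.of_forall fun y => measure_lt_top _ _
  rw [h1, h2]
  have hb : ∀ x, ‖f x‖ ≤ 1 := fun x => by
    rw [Real.norm_of_nonneg measureReal_nonneg]; exact measureReal_le_one
  have hfi : Integrable f μ :=
    Integrable.of_bound hfm.aestronglyMeasurable 1 (Filter.Eventually.of_forall hb)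
  have hf2i : Integrable (fun x => f x ^ 2) μ :=
    Integrable.of_bound (hfm.pow_const 2).aestronglyMeasurable 1
      (Filter.Eventually.of_forall fun x => by
        rw [norm_pow]; exact pow_le_one₀ (norm_nonneg _) (hb x))
  have h3 : 0 ≤ ∫ x, (f x - ∫ x, f x ∂μ) ^ 2 ∂μ := integral_nonneg fun x => sq_nonneg _
  set m := ∫ x, f x ∂μ with hm
  have h4 : ∫ x, (f x - m) ^ 2 ∂μ = ∫ x, f x ^ 2 ∂μ - m ^ 2 := by
    have e : ∀ x, (f x - m) ^ 2 = f x ^ 2 - 2 * m * f x + m ^ 2 := fun x => by ring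
    have i1 : Integrable (fun x => f x ^ 2 - 2 * m * f x) μ := hf2i.sub (hfi.const_mul _)
    simp_rw [e]
    rw [integral_add i1 (integrable_const _), integral_sub hf2i (hfi.const_mul _),
      integral_const_mul, ← hm]
    simp
    ring
  linarith

lemma measurable_piecewise {ι : Type*} [DecidableEq ι] {E : Type*} [MeasurableSpace E]
    (J : Finset ι) :
    Measurable fun p : (ι → E) × (ι → E) => J.piecewise p.2 p.1 := by
  refine measurable_pi_lambda _ fun i => ?_
  by_cases hi : i ∈ J
  · simp only [Finset.piecewise, hi, if_true]; fun_prop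
  · simp only [Finset.piecewise, hi, if_false]; fun_prop

variable {ι : Type*} [Fintype ι] [DecidableEq ι] {E : Type*} [MeasurableSpace E]
  (ν : ι → Measure E) [∀ i, IsProbabilityMeasure (ν i)]

lemma map_piecewise_pi (J : Finset ι) :
    ((Measure.pi ν).prod (Measure.pi ν)).map (fun p => J.piecewise p.2 p.1) = Measure.pi ν := by
  symm
  apply Measure.pi_eq
  intro s hs
  rw [Measure.map_apply (measurable_piecewise J) (MeasurableSet.univ_pi hs)]
  have : (fun p : (ι → E) × (ι → E) => J.piecewise p.2 p.1) ⁻¹' Set.pi Set.univ s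
      = (Set.pi Set.univ fun i => if i ∈ J then Set.univ else s i) ×ˢ
        (Set.pi Set.univ fun i => if i ∈ J then s i else Set.univ) := by
    ext p
    simp only [Set.mem_preimage, Set.mem_pi, Set.mem_univ, true_implies, Set.mem_prod]
    rw [← forall_and]
    refine forall_congr' fun i => ?_
    by_cases hi : i ∈ J <;> simp [Finset.piecewise, hi]
  rw [this, Measure.prod_prod, Measure.pi_pi, Measure.pi_pi, ← Finset.prod_mul_distrib]
  refine Finset.prod_congr rfl fun i _ => ?_
  by_cases hi : i ∈ J <;> simp [hi]

/-- Decoupling: resampling the coordinates in `J` twice. -/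
lemma sq_measureReal_pi_le (J : Finset ι) {W : Set (ι → E)} (hW : MeasurableSet W) :
    (Measure.pi ν).real W ^ 2
      ≤ ((Measure.pi ν).prod ((Measure.pi ν).prod (Measure.pi ν))).real
        {p | J.piecewise p.2.1 p.1 ∈ W ∧ J.piecewise p.2.2 p.1 ∈ W} := by
  have h1 : (Measure.pi ν).real W = ((Measure.pi ν).prod (Measure.pi ν)).real
      ((fun p => J.piecewise p.2 p.1) ⁻¹' W) := by
    rw [← map_measureReal_apply (measurable_piecewise J) hW, map_piecewise_pi]
  rw [h1]
  exact sq_measureReal_prod_le _ _ (measurable_piecewise J hW)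

end products

/-! ### Averaging over events, and second moments -/

/-- A weighted Markov inequality for a finite family of events. -/
lemma mul_measureReal_le_sum {Ω : Type*} [MeasurableSpace Ω] {P : Measure Ω} [IsFiniteMeasure P]
    {κ : Type*} (s : Finset κ) {w : κ → ℝ} (hw : ∀ k ∈ s, 0 ≤ w k) (E : κ → Set Ω) {F : Set Ω}
    {c : ℝ} (h : ∀ ω ∈ F, c ≤ ∑ k ∈ s, (E k).indicator (fun _ => w k) ω) (hc : 0 ≤ c) :
    c * P.real F ≤ ∑ k ∈ s, w k * P.real (E k) := by
  -- The events need not be measurable; measurable hulls have the same probability.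
  set E' : κ → Set Ω := fun k => toMeasurable P (E k) with hE'
  have hm : ∀ k, MeasurableSet (E' k) := fun k => measurableSet_toMeasurable _ _
  have hi : ∀ k, Integrable ((E' k).indicator fun _ => w k) P := fun k =>
    (integrable_const _).indicator (hm k)
  have h1 := mul_meas_ge_le_integral_of_nonneg (μ := P)
    (f := fun ω => ∑ k ∈ s, (E' k).indicator (fun _ => w k) ω)
    (Filter.Eventually.of_forall fun ω => Finset.sum_nonneg fun k hk =>
      Set.indicator_nonneg (fun _ _ => hw k hk) ω)
    (integrable_finsetSum _ fun k _ => hi k) c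
  rw [integral_finsetSum _ fun k _ => hi k] at h1
  have h2 : ∀ k, ∫ ω, (E' k).indicator (fun _ => w k) ω ∂P = w k * P.real (E k) := fun k => by
    rw [integral_indicator_const _ (hm k), smul_eq_mul, mul_comm, measureReal_def,
      measure_toMeasurable, ← measureReal_def]
  simp_rw [h2] at h1
  refine le_trans ?_ h1
  gcongr
  · exact measure_ne_top _ _
  · intro ω hω
    refine (h ω hω).trans (Finset.sum_le_sum fun k hk => ?_)
    exact Set.indicator_le_indicator_of_subset (subset_toMeasurable _ _) (fun _ => hw k hk) ω

section independent

variable {Ω : Type*} [MeasurableSpace Ω] {P : Measure Ω} [IsProbabilityMeasure P]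
  {ι : Type*} [Fintype ι] [DecidableEq ι] {U V : ι → Ω → ℝ} {ρ M : ℝ}

lemma integral_sq_sum_right (hind : iIndepFun (fun i ω => (U i ω, V i ω)) P)
    (hm : ∀ i, PairMoments P (U i) (V i) ρ M) (c : ι → ℝ) :
    Integrable (fun ω => (∑ j, c j * V j ω) ^ 2) P ∧
      ∫ ω, (∑ j, c j * V j ω) ^ 2 ∂P = ∑ j, c j ^ 2 := by
  have hmem : ∀ j, MemLp (V j) 2 P := fun j => (hm j).symm.memLp_two_left
  have hi : ∀ i j, Integrable (fun ω => c i * c j * (V i ω * V j ω)) P := fun i j =>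
    ((hmem i).integrable_mul (hmem j)).const_mul _
  have e : ∀ ω, (∑ j, c j * V j ω) ^ 2 = ∑ i, ∑ j, c i * c j * (V i ω * V j ω) := fun ω => by
    rw [sq, Finset.sum_mul_sum]
    refine Finset.sum_congr rfl fun i _ => Finset.sum_congr rfl fun j _ => by ring
  have hE : ∀ i j, ∫ ω, c i * c j * (V i ω * V j ω) ∂P = if i = j then c i ^ 2 else 0 := by
    intro i j
    rw [integral_const_mul]
    split_ifs with h
    · subst h
      have := (hm i).var_right
      simp_rw [sq] at this
      rw [this]; ring
    · have h1 : IndepFun (V i) (V j) P :=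
        (hind.indepFun h).comp measurable_snd measurable_snd
      have h2 := h1.integral_mul_eq_mul_integral (hmem i).1 (hmem j).1
      simp only [Pi.mul_apply] at h2
      rw [h2, (hm i).mean_right]; ring
  simp_rw [e]
  refine ⟨integrable_finsetSum _ fun i _ => integrable_finsetSum _ fun j _ => hi i j, ?_⟩
  rw [integral_finsetSum _ fun i _ => integrable_finsetSum _ fun j _ => hi i j]
  simp_rw [integral_finsetSum _ fun j _ => hi _ j, hE]
  simp

/-- Markov's inequality: the `V j` are centred, independent and of unit variance, so the expected
squared length is exactly `hsSq G`. -/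
lemma measureReal_l2_mulVec_gt_le (hind : iIndepFun (fun i ω => (U i ω, V i ω)) P)
    (hm : ∀ i, PairMoments P (U i) (V i) ρ M) (G : Matrix ι ι ℂ) (hG : 0 < hsSq G) {δ : ℝ}
    (hδ : 0 < δ) :
    P.real {ω | hsSq G / δ ≤ l2 (G.mulVec fun j => (V j ω : ℂ)) ^ 2} ≤ δ := by
  have hsq : ∀ z : ℂ, ‖z‖ ^ 2 = z.re ^ 2 + z.im ^ 2 := fun z => by
    rw [← Complex.normSq_eq_norm_sq, Complex.normSq_apply]; ring
  have e : ∀ ω, l2 (G.mulVec fun j => (V j ω : ℂ)) ^ 2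
      = ∑ i, ((∑ j, (G i j).re * V j ω) ^ 2 + (∑ j, (G i j).im * V j ω) ^ 2) := fun ω => by
    rw [l2_sq]
    refine Finset.sum_congr rfl fun i _ => ?_
    rw [hsq, Matrix.mulVec, dotProduct, Complex.re_sum, Complex.im_sum]
    simp
  have hr := fun i => integral_sq_sum_right hind hm fun j => (G i j).re
  have him := fun i => integral_sq_sum_right hind hm fun j => (G i j).im
  have hri : ∀ i, Integrable (fun ω => (∑ j, (G i j).re * V j ω) ^ 2
      + (∑ j, (G i j).im * V j ω) ^ 2) P := fun i => (hr i).1.add (him i).1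
  have hint : Integrable (fun ω => l2 (G.mulVec fun j => (V j ω : ℂ)) ^ 2) P := by
    simp_rw [e]
    exact integrable_finsetSum _ fun i _ => hri i
  have hval : ∫ ω, l2 (G.mulVec fun j => (V j ω : ℂ)) ^ 2 ∂P = hsSq G := by
    simp_rw [e]
    rw [integral_finsetSum _ fun i _ => hri i, hsSq]
    refine Finset.sum_congr rfl fun i _ => ?_
    rw [integral_add (hr i).1 (him i).1, (hr i).2, (him i).2, l2_sq, ← Finset.sum_add_distrib]
    simp_rw [hsq]
  have h1 := mul_meas_ge_le_integral_of_nonneg (Filter.Eventually.of_forall fun ω => by positivity)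
    hint (hsSq G / δ)
  rw [hval, div_mul_eq_mul_div, div_le_iff₀ hδ] at h1
  exact le_of_mul_le_mul_left h1 hG

end independent

/-! ### Small balls with spread coefficients -/

/-- Small ball estimate for coefficient vectors the larger of which is spread. -/
theorem exists_smallBall_of_spread {ρ : ℝ} (hρ0 : 0 ≤ ρ) (hρ : ρ < 1) (M : ℝ) {a b : ℝ}
    (ha : 0 < a) (hb : 0 < b) :
    ∃ C : ℝ, 0 < C ∧ ∀ (Ω : Type*) [MeasurableSpace Ω] (P : Measure Ω)
      [IsProbabilityMeasure P] (ι : Type*) [Fintype ι] [DecidableEq ι] [Nonempty ι]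
      (U V : ι → Ω → ℝ),
      iIndepFun (fun i ω => (U i ω, V i ω)) P → (∀ i, PairMoments P (U i) (V i) ρ M) →
      ∀ (α β : ι → ℂ) (J : Finset ι), Spread a b α → 0 < l2 α → l2 β ≤ l2 α →
      (J.card : ℝ) ≤ b / 4 * Fintype.card ι → ∀ (r : ℝ), 0 ≤ r → ∀ w : ℂ,
      P.real {ω | ‖∑ i, ((if i ∈ J then 0 else α i) * U i ω
          + (if i ∈ J then 0 else β i) * V i ω) - w‖ ≤ r}
        ≤ C * (r / l2 α + 1 / √(Fintype.card ι)) := by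
  obtain ⟨C, hC, H⟩ := exists_smallBall hρ0 hρ M (Λ := 16 / (b * a ^ 2)) (by positivity)
  refine ⟨C * (1 / a + 1) / √(b / 2), by positivity, ?_⟩
  intro Ω _ P _ ι _ _ _ U V hind hm α β J hα h0 hβ hJ r hr w
  -- Zeroing the coefficients on `J` is harmless, as `S` avoids `J`. The common scale is `a l2 α /
  -- √n`, and `S` has order `n` elements.
  obtain ⟨S, hSJ, hSc, hS⟩ := exists_comparable_of_spread ha hb hα h0 hβ hJ
  have hn0 : (0 : ℝ) < Fintype.card ι := by exact_mod_cast Fintype.card_pos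
  have hSpos : (0 : ℝ) < S.card := lt_of_lt_of_le (by positivity) hSc
  refine (H Ω P ι U V hind hm (fun i => if i ∈ J then 0 else α i)
    (fun i => if i ∈ J then 0 else β i) S (a * l2 α / √(Fintype.card ι))
    (Finset.card_pos.1 (by exact_mod_cast hSpos)) (by positivity) (fun i hi => ?_) r hr w).trans ?_
  · rw [if_neg (Finset.disjoint_left.1 hSJ hi), if_neg (Finset.disjoint_left.1 hSJ hi)]
    exact hS i hi
  · calc C * (r / (a * l2 α / √(Fintype.card ι)) + 1) / √(S.card)
        ≤ C * (r / (a * l2 α / √(Fintype.card ι)) + 1) / √(b / 2 * Fintype.card ι) := by gcongr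
      _ = C * (1 / a * (r / l2 α) + 1 / √(Fintype.card ι)) / √(b / 2) := by
          rw [Real.sqrt_mul (by positivity)]
          field_simp
      _ ≤ C * ((1 / a + 1) * (r / l2 α + 1 / √(Fintype.card ι))) / √(b / 2) := by
          have h1 : 0 ≤ 1 / a * (1 / √(Fintype.card ι)) := by positivity
          have h2 : 0 ≤ r / l2 α := by positivity
          gcongr
          linarith
      _ = _ := by ring

/-- If all rows of `G` are spread, then for one of the sets of a cover, `G` applied to a random
vector supported in that set is unlikely to be much shorter than the Hilbert–Schmidt norm. -/
theorem exists_l2_mulVec_smallBall {ρ : ℝ} (hρ0 : 0 ≤ ρ) (hρ : ρ < 1) (M : ℝ) {a b : ℝ}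
    (ha : 0 < a) (hb : 0 < b) {L : ℕ} (hL : 0 < L) :
    ∃ C : ℝ, 0 < C ∧ ∀ (Ω : Type*) [MeasurableSpace Ω] (P : Measure Ω)
      [IsProbabilityMeasure P] (ι : Type*) [Fintype ι] [DecidableEq ι] [Nonempty ι]
      (U V : ι → Ω → ℝ),
      iIndepFun (fun i ω => (U i ω, V i ω)) P → (∀ i, PairMoments P (U i) (V i) ρ M) →
      ∀ (J : Fin L → Finset ι), (∀ i, ∃ l, i ∈ J l) → ∀ G : Matrix ι ι ℂ,
      (∀ k, Spread a b (G k)) → (∀ k, 0 < l2 (G k)) → ∃ l, ∀ (θ : ℝ), 0 < θ → ∀ u : ι → ℝ,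
      P.real {ω | l2 (G.mulVec fun i => if i ∈ J l then ((U i ω - u i : ℝ) : ℂ) else 0) ^ 2
          ≤ θ ^ 2 / (2 * L) * hsSq G}
        ≤ C * (θ + 1 / √(Fintype.card ι)) := by
  classical
  obtain ⟨C, hC, H⟩ := exists_smallBall hρ0 hρ M (Λ := 16 / (b * a ^ 2)) (by positivity)
  have hL0 : (0 : ℝ) < L := by exact_mod_cast hL
  have : Nonempty (Fin L) := ⟨⟨0, hL⟩⟩
  refine ⟨2 * (C * (1 / a + 1) / √(b / (2 * L))), by positivity, ?_⟩
  intro Ω _ P _ ι _ _ _ U V hind hm J hJ G hsp hpos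
  set n := Fintype.card ι with hn
  have hn0 : (0 : ℝ) < n := by exact_mod_cast Fintype.card_pos
  have hS : ∀ k, ∃ S : Finset ι, b / 2 * n ≤ S.card ∧
      ∀ i ∈ S, (a * l2 (G k) / √n) ^ 2 ≤ ‖G k i‖ ^ 2 ∧
        ‖G k i‖ ^ 2 ≤ 16 / (b * a ^ 2) * (a * l2 (G k) / √n) ^ 2 := by
    intro k
    obtain ⟨S, -, h1, h2⟩ := exists_comparable_of_spread (β := 0) (J := ∅) ha hb (hsp k) (hpos k)
      (by rw [l2_zero]; exact l2_nonneg _) (by simp; positivity)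
    refine ⟨S, h1, fun i hi => ?_⟩
    simpa using h2 i hi
  choose S hSc hS using hS
  -- Pigeonhole for a single row: one of the `L` sets contains a proportion `1/L` of its good
  -- coordinates.
  have hl : ∀ k, ∃ l, b / (2 * L) * n ≤ ((S k ∩ J l).card : ℝ) := by
    intro k
    have h1 : (S k).card ≤ ∑ l, (S k ∩ J l).card := by
      calc (S k).card ≤ (Finset.univ.biUnion fun l => S k ∩ J l).card := by
            apply Finset.card_le_card
            intro i hi
            obtain ⟨l, hl⟩ := hJ i
            exact Finset.mem_biUnion.2 ⟨l, Finset.mem_univ _, Finset.mem_inter.2 ⟨hi, hl⟩⟩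
        _ ≤ _ := Finset.card_biUnion_le
    have h2 : ∑ _l : Fin L, b / (2 * L) * n ≤ ∑ l, ((S k ∩ J l).card : ℝ) := by
      rw [Finset.sum_const, Finset.card_univ, Fintype.card_fin, nsmul_eq_mul]
      calc (L : ℝ) * (b / (2 * L) * n) = b / 2 * n := by field_simp
        _ ≤ (S k).card := hSc k
        _ ≤ _ := by exact_mod_cast h1
    obtain ⟨l, _, hl⟩ := Finset.exists_le_of_sum_le Finset.univ_nonempty h2
    exact ⟨l, hl⟩
  choose lk hlk using hl
  -- Second pigeonhole, weighted by squared row lengths: one set serves rows carrying `1/L` of the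
  -- Hilbert–Schmidt norm. The choice depends on `G` only, not on `θ` or `u`.
  have hw : ∃ l, hsSq G / L ≤ ∑ k ∈ Finset.univ.filter (fun k => lk k = l), l2 (G k) ^ 2 := by
    have h2 : ∑ _l : Fin L, hsSq G / L
        ≤ ∑ l, ∑ k ∈ Finset.univ.filter (fun k => lk k = l), l2 (G k) ^ 2 := by
      rw [Finset.sum_const, Finset.card_univ, Fintype.card_fin, nsmul_eq_mul,
        Finset.sum_fiberwise]
      apply le_of_eq
      rw [hsSq]; field_simp
    obtain ⟨l, _, hl⟩ := Finset.exists_le_of_sum_le Finset.univ_nonempty h2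
    exact ⟨l, hl⟩
  obtain ⟨l, hl⟩ := hw
  refine ⟨l, fun θ hθ u => ?_⟩
  set Gd := Finset.univ.filter (fun k => lk k = l) with hGd
  set W := ∑ k ∈ Gd, l2 (G k) ^ 2 with hW
  have hhs : 0 < hsSq G := Finset.sum_pos (fun k _ => by have := hpos k; positivity)
    Finset.univ_nonempty
  have hW0 : 0 < W := lt_of_lt_of_le (by positivity) hl
  set x : Ω → ι → ℂ := fun ω i => if i ∈ J l then ((U i ω - u i : ℝ) : ℂ) else 0 with hx
  set E : ι → Set Ω := fun k => {ω | ‖(G.mulVec (x ω)) k‖ ≤ θ * l2 (G k)} with hE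
  set p := C * (1 / a + 1) / √(b / (2 * L)) * (θ + 1 / √n) with hp
  have hEk : ∀ k ∈ Gd, P.real (E k) ≤ p := by
    intro k hk
    have hkl : lk k = l := (Finset.mem_filter.1 hk).2
    have hcard : b / (2 * L) * n ≤ ((S k ∩ J l).card : ℝ) := hkl ▸ hlk k
    have hcpos : (0 : ℝ) < (S k ∩ J l).card := lt_of_lt_of_le (by positivity) hcard
    have h0 := hpos k
    have h1 := H Ω P ι U V hind hm (fun i => if i ∈ J l then G k i else 0) (fun _ => 0) (S k ∩ J l)
      (a * l2 (G k) / √n) (Finset.card_pos.1 (by exact_mod_cast hcpos)) (by positivity)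
      (fun i hi => by
        have hi' := Finset.mem_inter.1 hi
        rw [if_pos hi'.2]
        simpa using hS k i hi'.1) (θ * l2 (G k)) (by positivity)
      (∑ i, if i ∈ J l then G k i * u i else 0)
    have e : E k = {ω | ‖∑ i, ((if i ∈ J l then G k i else 0) * (U i ω : ℂ) + 0 * (V i ω : ℂ))
        - (∑ i, if i ∈ J l then G k i * u i else 0)‖ ≤ θ * l2 (G k)} := by
      ext ω
      simp only [hE, Set.mem_ofPred_eq, hx, Matrix.mulVec, dotProduct]
      rw [← Finset.sum_sub_distrib]
      have : ∀ i, G k i * (if i ∈ J l then ((U i ω - u i : ℝ) : ℂ) else 0)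
          = ((if i ∈ J l then G k i else 0) * (U i ω : ℂ) + 0 * (V i ω : ℂ))
            - (if i ∈ J l then G k i * u i else 0) := fun i => by
        split_ifs
        · push_cast; ring
        · ring
      simp_rw [this]
    rw [e]
    refine h1.trans ?_
    calc C * (θ * l2 (G k) / (a * l2 (G k) / √n) + 1) / √((S k ∩ J l).card)
        ≤ C * (θ * l2 (G k) / (a * l2 (G k) / √n) + 1) / √(b / (2 * L) * n) := by gcongr
      _ = C * (1 / a * θ + 1 / √n) / √(b / (2 * L)) := by
          rw [Real.sqrt_mul (by positivity)]
          field_simp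
      _ ≤ C * ((1 / a + 1) * (θ + 1 / √n)) / √(b / (2 * L)) := by
          have h1 : 0 ≤ 1 / a * (1 / √n) := by positivity
          gcongr
          linarith
      _ = p := by rw [hp]; ring
  -- If the image is this short, the rows `k` with `‖(G x) k‖ ≤ θ l2 (G k)` carry at least half of
  -- the weight `W`, so the weighted Markov inequality applies.
  have key := mul_measureReal_le_sum (P := P) Gd (w := fun k => l2 (G k) ^ 2)
    (fun k _ => by positivity) E
    (F := {ω | l2 (G.mulVec (x ω)) ^ 2 ≤ θ ^ 2 / (2 * L) * hsSq G}) (c := W / 2) ?_ (by positivity)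
  · have h2 : ∑ k ∈ Gd, l2 (G k) ^ 2 * P.real (E k) ≤ W * p := by
      rw [hW, Finset.sum_mul]
      exact Finset.sum_le_sum fun k hk => by gcongr; exact hEk k hk
    have h3 : W * P.real {ω | l2 (G.mulVec (x ω)) ^ 2 ≤ θ ^ 2 / (2 * L) * hsSq G}
        ≤ W * (2 * p) := by linarith
    have h4 := le_of_mul_le_mul_left h3 hW0
    rw [mul_assoc]
    exact h4
  · intro ω hω
    simp only [Set.mem_ofPred_eq] at hω
    have h1 : ∑ k ∈ Gd, θ ^ 2 * (l2 (G k) ^ 2 - (E k).indicator (fun _ => l2 (G k) ^ 2) ω)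
        ≤ l2 (G.mulVec (x ω)) ^ 2 := by
      rw [l2_sq]
      calc _ ≤ ∑ k ∈ Gd, ‖(G.mulVec (x ω)) k‖ ^ 2 := by
            refine Finset.sum_le_sum fun k _ => ?_
            by_cases hk : ω ∈ E k
            · rw [Set.indicator_of_mem hk]; simp
            · rw [Set.indicator_of_notMem hk, sub_zero, ← mul_pow]
              have h0 := hpos k
              have : θ * l2 (G k) < ‖(G.mulVec (x ω)) k‖ := not_le.1 hk
              gcongr
        _ ≤ _ := Finset.sum_le_sum_of_subset_of_nonneg (Finset.subset_univ _)
            fun _ _ _ => by positivity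
    rw [← Finset.mul_sum, Finset.sum_sub_distrib] at h1
    have h2 : θ ^ 2 / (2 * L) * hsSq G ≤ θ ^ 2 * (W / 2) := by
      calc θ ^ 2 / (2 * L) * hsSq G = θ ^ 2 * (hsSq G / L / 2) := by field_simp
        _ ≤ _ := by gcongr
    have h3 : θ ^ 2 * (W - ∑ k ∈ Gd, (E k).indicator (fun _ => l2 (G k) ^ 2) ω)
        ≤ θ ^ 2 * (W / 2) := (h1.trans hω).trans h2
    have := le_of_mul_le_mul_left h3 (by positivity)
    linarith

lemma PairMoments.comp_measurePreserving {Ω Ω' : Type*} [MeasurableSpace Ω] [MeasurableSpace Ω']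
    {P : Measure Ω} {Q : Measure Ω'} {U V : Ω' → ℝ} {ρ M : ℝ} (h : PairMoments Q U V ρ M)
    {f : Ω → Ω'} (hf : MeasurePreserving f P Q) :
    PairMoments P (fun ω => U (f ω)) (fun ω => V (f ω)) ρ M := by
  have hi : ∀ g : Ω' → ℝ, Measurable g → ∫ ω, g (f ω) ∂P = ∫ ω, g ω ∂Q := fun g hg => by
    rw [← hf.map_eq, integral_map hf.measurable.aemeasurable hg.aestronglyMeasurable]
  have hU := h.measurable_left
  have hV := h.measurable_right
  refine ⟨hU.comp hf.measurable, hV.comp hf.measurable,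
    h.memLp_left.comp_measurePreserving hf, h.memLp_right.comp_measurePreserving hf,
    ?_, ?_, ?_, ?_, ?_, ?_, ?_⟩
  · rw [hi U hU]; exact h.mean_left
  · rw [hi V hV]; exact h.mean_right
  · rw [hi (fun ω => U ω ^ 2) (by fun_prop)]; exact h.var_left
  · rw [hi (fun ω => V ω ^ 2) (by fun_prop)]; exact h.var_right
  · rw [hi (fun ω => U ω ^ 4) (by fun_prop)]; exact h.fourth_left
  · rw [hi (fun ω => V ω ^ 4) (by fun_prop)]; exact h.fourth_right
  · rw [hi (fun ω => U ω * V ω) (by fun_prop)]; exact h.corr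

/-! ### Decoupling of the bilinear form -/

section resample

variable {ι : Type*} [DecidableEq ι]

/-- The difference of two samples of a coordinate functional of the pairs, restricted to `J`. -/
def resampleDiff (J : Finset ι) (f : ℝ × ℝ → ℝ) (p : (ι → ℝ × ℝ) × (ι → ℝ × ℝ)) : ι → ℂ :=
  fun i => if i ∈ J then ((f (p.1 i) - f (p.2 i) : ℝ) : ℂ) else 0

lemma measurable_resampleDiff (J : Finset ι) {f : ℝ × ℝ → ℝ} (hf : Measurable f) (i : ι) :
    Measurable fun p => resampleDiff J f p i := by
  simp only [resampleDiff]
  split_ifs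
  · fun_prop
  · exact measurable_const

variable [Fintype ι]

/-- The bilinear form of `G` evaluated at the two components of `y`. -/
noncomputable def pairForm (G : Matrix ι ι ℂ) (y : ι → ℝ × ℝ) : ℂ :=
  dotProduct (fun i => ((y i).2 : ℂ)) (G.mulVec fun i => ((y i).1 : ℂ))

/-- Terms with both indices outside `J` agree in the two samples and cancel. Terms with exactly one
index in `J` are linear in the kept coordinates, and terms with both indices in `J` form the
constant `w`, which depends on the two samples only. -/
lemma exists_pairForm_piecewise_sub (G : Matrix ι ι ℂ) (J : Finset ι)
    (p : (ι → ℝ × ℝ) × (ι → ℝ × ℝ)) : ∃ w : ℂ, ∀ x : ι → ℝ × ℝ,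
      pairForm G (J.piecewise p.1 x) - pairForm G (J.piecewise p.2 x)
        = ∑ i, ((if i ∈ J then 0 else G.transpose.mulVec (resampleDiff J Prod.snd p) i) * (x i).1
          + (if i ∈ J then 0 else G.mulVec (resampleDiff J Prod.fst p) i) * (x i).2) - w := by
  set d : (ι → ℝ × ℝ) → (ℝ × ℝ → ℝ) → ι → ℂ := fun y f i =>
    if i ∈ J then ((f (y i) : ℝ) : ℂ) else 0 with hd
  set c : (ι → ℝ × ℝ) → (ℝ × ℝ → ℝ) → ι → ℂ := fun y f i =>
    if i ∈ J then 0 else ((f (y i) : ℝ) : ℂ) with hc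
  refine ⟨-(dotProduct (d p.1 Prod.snd) (G.mulVec (d p.1 Prod.fst))
    - dotProduct (d p.2 Prod.snd) (G.mulVec (d p.2 Prod.fst))), fun x => ?_⟩
  have hpw : ∀ (y : ι → ℝ × ℝ) (f : ℝ × ℝ → ℝ),
      (fun i => ((f (J.piecewise y x i) : ℝ) : ℂ)) = c x f + d y f := by
    intro y f
    funext i
    simp only [hc, hd, Pi.add_apply, Finset.piecewise]
    split_ifs <;> simp
  have hr : ∀ f, resampleDiff J f p = d p.1 f - d p.2 f := by
    intro f
    funext i
    simp only [resampleDiff, hd, Pi.sub_apply]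
    split_ifs <;> simp
  have hm1 : ∀ (z : ι → ℂ), ∑ i, (if i ∈ J then 0 else z i) * ((x i).1 : ℂ)
      = dotProduct z (c x Prod.fst) := fun z => by
    rw [dotProduct]
    refine Finset.sum_congr rfl fun i _ => ?_
    simp only [hc]; split_ifs <;> simp
  have hm2 : ∀ (z : ι → ℂ), ∑ i, (if i ∈ J then 0 else z i) * ((x i).2 : ℂ)
      = dotProduct (c x Prod.snd) z := fun z => by
    rw [dotProduct]
    refine Finset.sum_congr rfl fun i _ => ?_
    simp only [hc]; split_ifs <;> simp [mul_comm]
  rw [Finset.sum_add_distrib, hm1, hm2, Matrix.mulVec_transpose, ← Matrix.dotProduct_mulVec,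
    hr, hr]
  simp only [pairForm, hpw _ Prod.fst, hpw _ Prod.snd, Matrix.mulVec_add, Matrix.mulVec_sub,
    add_dotProduct, dotProduct_add, sub_dotProduct, dotProduct_sub]
  ring

end resample

/-- Small ball estimate for a bilinear form in independent pairs, normalized by the length of the
coefficient vector. -/
theorem exists_pairForm_smallBall {ρ : ℝ} (hρ0 : 0 ≤ ρ) (hρ : ρ < 1) (M : ℝ) {a b K : ℝ}
    (ha : 0 < a) (hb : 0 < b) :
    ∃ (C : ℝ) (L : ℕ), 0 < C ∧ ∀ (ι : Type) [Fintype ι] [DecidableEq ι] [Nonempty ι],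
      1 ≤ b / 4 * Fintype.card ι → ∃ J : Fin L → Finset ι,
      ∀ (ν : ι → Measure (ℝ × ℝ)) [∀ i, IsProbabilityMeasure (ν i)],
      (∀ i, PairMoments (ν i) Prod.fst Prod.snd ρ M) → ∀ G : Matrix ι ι ℂ,
      (∀ k, Spread a b (G k)) → (∀ k, 0 < l2 (G k)) → 1 ≤ K ^ 2 * hsSq G →
      ∀ (z : ℂ) (ε : ℝ), 0 < ε → ε ≤ 1 →
      (Measure.pi ν).real {y | ‖z - pairForm G y‖
          ≤ ε * √(1 + l2 (G.transpose.mulVec fun i => ((y i).2 : ℂ)) ^ 2)}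
        ≤ ε ^ (1 / 8 : ℝ) + √(C * (ε ^ (1 / 4 : ℝ) + 1 / √(Fintype.card ι))
          + ∑ l, ((Measure.pi ν).prod (Measure.pi ν)).real
            {p | ¬ Spread a b (G.mulVec (resampleDiff (J l) Prod.fst p)) ∨
              ¬ Spread a b (G.transpose.mulVec (resampleDiff (J l) Prod.snd p))}) := by
  classical
  obtain ⟨L, hL, hcov⟩ := exists_cover_small (η := b / 4) (by positivity)
  have hL0 : (0 : ℝ) < L := by exact_mod_cast hL
  obtain ⟨C₂, hC₂, H₂⟩ := exists_smallBall_of_spread hρ0 hρ M ha hb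
  obtain ⟨C₃, hC₃, H₃⟩ := exists_l2_mulVec_smallBall hρ0 hρ M ha hb hL
  set C₁ := √(K ^ 2 + 1) with hC₁
  have hC₁0 : 0 < C₁ := by positivity
  set C₄ := 2 * C₁ * √(2 * L) + 1 with hC₄
  have hC₄0 : 0 < C₄ := by positivity
  refine ⟨C₂ * C₄ + C₃, L, by positivity, fun ι _ _ _ hcard => ?_⟩
  obtain ⟨J, hJ, hJc⟩ := hcov ι hcard
  refine ⟨J, fun ν _ hν G hsp hpos hK z ε hε hε1 => ?_⟩
  set n := Fintype.card ι with hn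
  have hn0 : (0 : ℝ) < n := by exact_mod_cast Fintype.card_pos
  set π := Measure.pi ν with hπ
  set U : ι → (ι → ℝ × ℝ) → ℝ := fun i y => (y i).1 with hU
  set V : ι → (ι → ℝ × ℝ) → ℝ := fun i y => (y i).2 with hV
  have hind : iIndepFun (fun i y => (U i y, V i y)) π :=
    iIndepFun_pi (X := fun _ => id) fun _ => aemeasurable_id
  have hmom : ∀ i, PairMoments π (U i) (V i) ρ M := fun i =>
    (hν i).comp_measurePreserving (measurePreserving_eval ν i)
  have hind' : iIndepFun (fun i y => (V i y, U i y)) π :=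
    hind.comp (fun _ => Prod.swap) fun _ => measurable_swap
  set hs := hsSq G with hhs
  have hs0 : 0 < hs := Finset.sum_pos (fun k _ => by have := hpos k; positivity)
    Finset.univ_nonempty
  set H := √hs with hH
  have hH0 : 0 < H := by positivity
  have hH2 : H ^ 2 = hs := Real.sq_sqrt hs0.le
  -- `δ` is the probability that `Gᵀ v` is too long, and `θ` is the relative threshold below which
  -- `α` counts as short. The square root from decoupling turns `ε^(1/4)` into `ε^(1/8)`.
  set δ := ε ^ (1 / 8 : ℝ) with hδ
  have hδ0 : 0 < δ := by positivity
  have hδ1 : δ ≤ 1 := Real.rpow_le_one hε.le hε1 (by norm_num)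
  set θ := ε ^ (1 / 4 : ℝ) with hθ
  have hθ0 : 0 < θ := by positivity
  -- In exponents: `1/16 + 1/4 + 1/4 ≤ 1`.
  have hεθ : ε / (√δ * θ) ≤ θ := by
    rw [div_le_iff₀ (by positivity), hδ, hθ, Real.sqrt_eq_rpow, ← Real.rpow_mul hε.le,
      ← Real.rpow_add hε, ← Real.rpow_add hε]
    calc ε = ε ^ (1 : ℝ) := (Real.rpow_one _).symm
      _ ≤ _ := Real.rpow_le_rpow_of_exponent_ge hε hε1 (by norm_num)
  set r := ε * (C₁ * H / √δ) with hr
  have hr0 : 0 < r := by positivity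
  have hQm : Measurable fun y : ι → ℝ × ℝ => pairForm G y := by
    unfold pairForm
    simp only [dotProduct, Matrix.mulVec]
    fun_prop
  set W : Set (ι → ℝ × ℝ) := {y | ‖z - pairForm G y‖ ≤ r} with hW
  have hWm : MeasurableSet W := measurableSet_le (by fun_prop) measurable_const
  obtain ⟨l, hl⟩ := H₃ (ι → ℝ × ℝ) π ι U V hind hmom J hJ G hsp hpos
  set D₁ : Set ((ι → ℝ × ℝ) × (ι → ℝ × ℝ)) :=
    {p | ¬ Spread a b (G.mulVec (resampleDiff (J l) Prod.fst p)) ∨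
      ¬ Spread a b (G.transpose.mulVec (resampleDiff (J l) Prod.snd p))} with hD₁
  set D₂ : Set ((ι → ℝ × ℝ) × (ι → ℝ × ℝ)) :=
    {p | l2 (G.mulVec (resampleDiff (J l) Prod.fst p)) ^ 2 ≤ θ ^ 2 / (2 * L) * hs} with hD₂
  have hm1 : Measurable fun p => G.mulVec (resampleDiff (J l) Prod.fst p) :=
    measurable_mulVec (A := fun _ => G) (fun _ _ => measurable_const)
      (measurable_resampleDiff _ measurable_fst)
  have hm2 : Measurable fun p => G.transpose.mulVec (resampleDiff (J l) Prod.snd p) :=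
    measurable_mulVec (A := fun _ => G.transpose) (fun _ _ => measurable_const)
      (measurable_resampleDiff _ measurable_snd)
  have hD₁m : MeasurableSet D₁ :=
    (measurableSet_spread hm1 a b).compl.union (measurableSet_spread hm2 a b).compl
  have hD₂m : MeasurableSet D₂ := measurableSet_le (hm1.l2.pow_const 2) measurable_const
  -- With the second sample fixed, the difference of samples is a random vector shifted by a
  -- constant, which the estimate `hl` allows.
  have hD₂le : (π.prod π).real D₂ ≤ C₃ * (θ + 1 / √n) := by
    have := measureReal_prod_le_of_section_le π π hD₂m (D := ∅) MeasurableSet.empty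
      (c := C₃ * (θ + 1 / √n)) (fun y _ => hl θ hθ0 fun i => (y i).1) (by positivity)
    simpa using this
  set W3 : Set ((ι → ℝ × ℝ) × (ι → ℝ × ℝ) × (ι → ℝ × ℝ)) :=
    {p | (J l).piecewise p.2.1 p.1 ∈ W ∧ (J l).piecewise p.2.2 p.1 ∈ W} with hW3
  have hW3m : MeasurableSet W3 := by
    apply MeasurableSet.inter
    · exact ((measurable_piecewise (J l)).comp
        (by fun_prop : Measurable fun p : (ι → ℝ × ℝ) × (ι → ℝ × ℝ) × (ι → ℝ × ℝ) =>
          (p.1, p.2.1))) hWm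
    · exact ((measurable_piecewise (J l)).comp
        (by fun_prop : Measurable fun p : (ι → ℝ × ℝ) × (ι → ℝ × ℝ) × (ι → ℝ × ℝ) =>
          (p.1, p.2.2))) hWm
  have hsec : ∀ p ∉ D₁ ∪ D₂, π.real {x | (x, p) ∈ W3} ≤ C₂ * C₄ * (θ + 1 / √n) := by
    intro p hp
    rw [Set.mem_union, not_or] at hp
    have hp1 : Spread a b (G.mulVec (resampleDiff (J l) Prod.fst p)) ∧
        Spread a b (G.transpose.mulVec (resampleDiff (J l) Prod.snd p)) := by
      have := hp.1
      simp only [hD₁, Set.mem_ofPred_eq, not_or, not_not] at this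
      exact this
    set α := G.mulVec (resampleDiff (J l) Prod.fst p) with hα
    set β := G.transpose.mulVec (resampleDiff (J l) Prod.snd p) with hβ
    have hα0 : θ * H / √(2 * L) < l2 α := by
      have h1 : θ ^ 2 / (2 * L) * hs < l2 α ^ 2 := not_le.1 hp.2
      refine lt_of_pow_lt_pow_left₀ 2 (l2_nonneg _) ?_
      rw [div_pow, mul_pow, hH2, Real.sq_sqrt (by positivity)]
      calc _ = θ ^ 2 / (2 * L) * hs := by ring
        _ < _ := h1
    obtain ⟨w, hw⟩ := exists_pairForm_piecewise_sub G (J l) p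
    have hsub : {x | (x, p) ∈ W3} ⊆ {x | ‖∑ i, ((if i ∈ J l then 0 else β i) * (U i x : ℂ)
        + (if i ∈ J l then 0 else α i) * (V i x : ℂ)) - w‖ ≤ 2 * r} := by
      rintro x ⟨h1, h2⟩
      simp only [Set.mem_ofPred_eq]
      rw [← hw x]
      have h3 : ‖z - pairForm G ((J l).piecewise p.1 x)‖ ≤ r := h1
      have h4 : ‖z - pairForm G ((J l).piecewise p.2 x)‖ ≤ r := h2
      calc _ = ‖(z - pairForm G ((J l).piecewise p.2 x))
            - (z - pairForm G ((J l).piecewise p.1 x))‖ := by congr 1; ring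
        _ ≤ _ := (norm_sub_le _ _).trans (by linarith)
    have hfin : ∀ N : ℝ, θ * H / √(2 * L) < N →
        C₂ * (2 * r / N + 1 / √n) ≤ C₂ * C₄ * (θ + 1 / √n) := by
      intro N hN
      have hN0 : 0 < θ * H / √(2 * L) := by positivity
      calc C₂ * (2 * r / N + 1 / √n) ≤ C₂ * (2 * r / (θ * H / √(2 * L)) + 1 / √n) := by gcongr
        _ = C₂ * (2 * C₁ * √(2 * L) * (ε / (√δ * θ)) + 1 / √n) := by
            rw [hr]; field_simp
        _ ≤ C₂ * (2 * C₁ * √(2 * L) * θ + 1 / √n) := by gcongr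
        _ ≤ C₂ * (C₄ * (θ + 1 / √n)) := by
            have h5 : 0 ≤ 2 * C₁ * √(2 * L) * (1 / √n) := by positivity
            gcongr
            rw [hC₄]
            linarith
        _ = _ := by ring
    have hθH : 0 < θ * H / √(2 * L) := by positivity
    refine (measureReal_mono hsub (measure_ne_top _ _)).trans ?_
    -- Only `α` is known to be long. If `β` is longer, it inherits the lower bound and takes the
    -- leading role.
    rcases le_total (l2 β) (l2 α) with h | h
    · have h1 := H₂ (ι → ℝ × ℝ) π ι V U hind' (fun i => (hmom i).symm) α β (J l) hp1.1
        (hθH.trans hα0) h (hJc l) (2 * r) (by positivity) w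
      refine le_trans (le_of_eq ?_) (h1.trans (hfin _ hα0))
      congr 1
      ext x
      simp only [Set.mem_ofPred_eq]
      simp_rw [add_comm]
    · exact (H₂ (ι → ℝ × ℝ) π ι U V hind hmom β α (J l) hp1.2
        ((hθH.trans hα0).trans_le h) h (hJc l) (2 * r) (by positivity) w).trans
        (hfin _ (hα0.trans_le h))
  have hWle : π.real W ≤ √((C₂ * C₄ + C₃) * (θ + 1 / √n) + ∑ l, (π.prod π).real
      {p | ¬ Spread a b (G.mulVec (resampleDiff (J l) Prod.fst p)) ∨
        ¬ Spread a b (G.transpose.mulVec (resampleDiff (J l) Prod.snd p))}) := by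
    apply Real.le_sqrt_of_sq_le
    have h1 := measureReal_prod_le_of_section_le π (π.prod π) hW3m (hD₁m.union hD₂m) hsec
      (by positivity)
    have h2 : (π.prod π).real (D₁ ∪ D₂) ≤ (π.prod π).real D₁ + (π.prod π).real D₂ :=
      measureReal_union_le _ _
    -- The index `l` depends on `G`, whereas the final bound must name fixed events; hence the sum
    -- over all `l`.
    have h3 : (π.prod π).real D₁ ≤ ∑ l, (π.prod π).real
        {p | ¬ Spread a b (G.mulVec (resampleDiff (J l) Prod.fst p)) ∨
          ¬ Spread a b (G.transpose.mulVec (resampleDiff (J l) Prod.snd p))} :=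
      Finset.single_le_sum (f := fun l => (π.prod π).real
        {p | ¬ Spread a b (G.mulVec (resampleDiff (J l) Prod.fst p)) ∨
          ¬ Spread a b (G.transpose.mulVec (resampleDiff (J l) Prod.snd p))})
        (fun _ _ => measureReal_nonneg) (Finset.mem_univ l)
    have h4 := sq_measureReal_pi_le ν (J l) hWm
    linarith
  have hsubE : {y : ι → ℝ × ℝ | ‖z - pairForm G y‖
      ≤ ε * √(1 + l2 (G.transpose.mulVec fun i => ((y i).2 : ℂ)) ^ 2)}
      ⊆ {y | hsSq G.transpose / δ ≤ l2 (G.transpose.mulVec fun j => (V j y : ℂ)) ^ 2} ∪ W := by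
    intro y hy
    by_cases h1 : hsSq G.transpose / δ ≤ l2 (G.transpose.mulVec fun j => (V j y : ℂ)) ^ 2
    · exact Or.inl h1
    · right
      rw [not_le, hsSq_transpose] at h1
      simp only [Set.mem_ofPred_eq] at hy
      refine hy.trans ?_
      rw [hr]
      gcongr
      -- Both `1` and `|Gᵀ v|²` are compared with the squared Hilbert–Schmidt norm divided by `δ`,
      -- using `1 ≤ K² hs` and `δ ≤ 1`.
      apply Real.sqrt_le_iff.2 ⟨by positivity, ?_⟩
      rw [div_pow, mul_pow, hC₁, Real.sq_sqrt (by positivity), hH2, Real.sq_sqrt hδ0.le]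
      have h2 : 1 ≤ K ^ 2 * hs / δ := by
        rw [le_div_iff₀ hδ0]; linarith
      have h3 : (K ^ 2 + 1) * hs / δ = K ^ 2 * hs / δ + hs / δ := by ring
      rw [h3]
      exact add_le_add h2 h1.le
  calc _ ≤ π.real ({y | hsSq G.transpose / δ
          ≤ l2 (G.transpose.mulVec fun j => (V j y : ℂ)) ^ 2} ∪ W) :=
        measureReal_mono hsubE (measure_ne_top _ _)
    _ ≤ π.real {y | hsSq G.transpose / δ
          ≤ l2 (G.transpose.mulVec fun j => (V j y : ℂ)) ^ 2} + π.real W :=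
        measureReal_union_le _ _
    _ ≤ _ := add_le_add (measureReal_l2_mulVec_gt_le hind hmom G.transpose
        (by rw [hsSq_transpose]; exact hs0) hδ0) hWle

lemma measureReal_prod_eq_integral {E F : Type*} [MeasurableSpace E] [MeasurableSpace F]
    (μ : Measure E) (ν : Measure F) [IsProbabilityMeasure μ] [IsProbabilityMeasure ν]
    {W : Set (E × F)} (hW : MeasurableSet W) :
    Integrable (fun x => ν.real {y | (x, y) ∈ W}) μ ∧
      (μ.prod ν).real W = ∫ x, ν.real {y | (x, y) ∈ W} ∂μ := by
  have hm : Measurable fun x => ν.real {y | (x, y) ∈ W} :=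
    (measurable_measure_prodMk_left hW).ennreal_toReal
  constructor
  · refine Integrable.of_bound hm.aestronglyMeasurable 1 (Filter.Eventually.of_forall fun x => ?_)
    rw [Real.norm_of_nonneg measureReal_nonneg]
    exact measureReal_le_one
  · rw [measureReal_def, Measure.prod_apply hW, ← integral_toReal]
    · rfl
    · exact (measurable_measure_prodMk_left hW).aemeasurable
    · exact Filter.Eventually.of_forall fun y => measure_lt_top _ _

/-! ### Solutions of random linear systems are spread -/

lemma withDiag_transpose {ι : Type*} [DecidableEq ι] (Y : ι → ι → ℝ) (d : ι → ℂ) :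
    (withDiag Y d).transpose = withDiag (fun i j => Y j i) d := by
  ext i j
  simp only [withDiag, Matrix.transpose_apply, Matrix.of_apply]
  by_cases h : i = j
  · subst h; simp
  · rw [if_neg h, if_neg (Ne.symm h)]

lemma withDiag_congr {ι : Type*} [DecidableEq ι] {Y Z : ι → ι → ℝ}
    (h : ∀ i j, i ≠ j → Y i j = Z i j) (d : ι → ℂ) :
    withDiag Y d = withDiag Z d := by
  ext i j
  simp only [withDiag, Matrix.of_apply]
  split_ifs with hij
  · rfl
  · rw [h i j hij]

section spread

variable {ι : Type*} [Fintype ι]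

/-- All coordinates satisfy the defining inequality trivially. Consequently a vector that is not
spread is nonzero and can be normalized. -/
lemma spread_zero {a b : ℝ} (hb : b ≤ 1) : Spread a b (0 : ι → ℂ) := by
  classical
  unfold Spread
  rw [Finset.filter_true_of_mem (fun i _ => by rw [l2_zero]; simp), Finset.card_univ]
  have : (0 : ℝ) ≤ Fintype.card ι := Nat.cast_nonneg _
  nlinarith

lemma Spread.smul {a b : ℝ} {x : ι → ℂ} (h : Spread a b x) (c : ℂ) : Spread a b (c • x) := by
  classical
  unfold Spread at h ⊢
  refine h.trans ?_
  norm_cast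
  apply Finset.card_le_card
  intro i hi
  simp only [Finset.mem_filter, Finset.mem_univ, true_and] at hi ⊢
  rw [l2_smul, Pi.smul_apply, smul_eq_mul, norm_mul]
  calc a * (‖c‖ * l2 x) = ‖c‖ * (a * l2 x) := by ring
    _ ≤ ‖c‖ * (√(Fintype.card ι) * ‖x i‖) := by gcongr
    _ = _ := by ring

/-- If `B` maps a vector that is not spread to the line of `w`, then a normalized such vector
exists. -/
lemma exists_unit_not_spread {a b κ r : ℝ} (hb : b ≤ 1) (hr : 0 ≤ r) {B : Matrix ι ι ℂ}
    (hB : OpBound B κ) {x₀ : ι → ℂ} (hx : ¬ Spread a b x₀) {c : ℂ} {w : ι → ℂ} (hw : l2 w = 1)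
    (h : B.mulVec x₀ = c • w) :
    ∃ (x : ι → ℂ) (s : ℂ), l2 x = 1 ∧ ¬ Spread a b x ∧ ‖s‖ ≤ κ ∧
      l2 (B.mulVec x - s • w) ≤ r := by
  have hx0 : x₀ ≠ 0 := fun h0 => hx (h0 ▸ spread_zero hb)
  have hl : l2 x₀ ≠ 0 := fun h0 => hx0 (l2_eq_zero.1 h0)
  set t : ℂ := (((l2 x₀)⁻¹ : ℝ) : ℂ) with ht
  have htn : ‖t‖ * l2 x₀ = 1 := by
    rw [ht, Complex.norm_real, Real.norm_of_nonneg (inv_nonneg.2 (l2_nonneg _)), inv_mul_cancel₀ hl]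
  have ht0 : t ≠ 0 := fun h0 => by rw [h0] at htn; simp at htn
  have e : B.mulVec (t • x₀) = (t * c) • w := by rw [Matrix.mulVec_smul, h, smul_smul]
  refine ⟨t • x₀, t * c, by rw [l2_smul, htn], fun hs => hx ?_, ?_, ?_⟩
  · have := hs.smul t⁻¹
    rwa [smul_smul, inv_mul_cancel₀ ht0, one_smul] at this
  · have := hB (t • x₀)
    rwa [e, l2_smul, hw, l2_smul, htn, mul_one, mul_one] at this
  · rw [e, sub_self, l2_zero]; exact hr

variable [DecidableEq ι]

lemma l2_inv_row_pos {B : Matrix ι ι ℂ} (hdet : B.det ≠ 0) (k : ι) : 0 < l2 (B⁻¹ k) := by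
  refine (l2_nonneg _).lt_of_ne' fun h0 => ?_
  have h1 := congrFun (congrFun (Matrix.nonsing_inv_mul B (isUnit_iff_ne_zero.2 hdet)) k) k
  rw [Matrix.mul_apply, Matrix.one_apply_eq] at h1
  have h2 : ∀ j, B⁻¹ k j = 0 := fun j => congrFun (l2_eq_zero.1 h0) j
  simp [h2] at h1

end spread

/-- For a random matrix with elliptic off-diagonal entries, the solution of a linear system with
fixed right hand side is unlikely not to be spread. -/
theorem exists_inv_not_spread_le {ρ : ℝ} (hρ0 : 0 ≤ ρ) (hρ : ρ < 1) (M : ℝ) {K : ℝ} (hK : 0 < K) :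
    ∃ a b C : ℝ, 0 < a ∧ 0 < b ∧ b ≤ 1 ∧ 0 < C ∧ ∀ (Ω : Type*) [MeasurableSpace Ω] (P : Measure Ω)
      [IsProbabilityMeasure P] (ι : Type*) [Fintype ι] [LinearOrder ι] [Nonempty ι]
      (X : Ω → ι → ι → ℝ), EllipticEntries P X ρ M → ∀ d : ι → ℂ,
      P.real {ω | OpBound (withDiag (X ω) d) (K * √(Fintype.card ι)) ∧
        ∃ x : ι → ℂ, l2 x = 1 ∧ ¬ Spread a b x ∧
          l2 ((withDiag (X ω) d).mulVec x) ≤ a * √(Fintype.card ι)}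
        ≤ C / (Fintype.card ι : ℝ) ^ 2 ∧
      (∀ w : ι → ℂ, P.real {ω | OpBound (withDiag (X ω) d) (K * √(Fintype.card ι)) ∧
          (withDiag (X ω) d).det ≠ 0 ∧ ¬ Spread a b ((withDiag (X ω) d)⁻¹.mulVec w)}
        ≤ C / (Fintype.card ι : ℝ) ^ 2) ∧
      ∀ w : ι → ℂ, P.real {ω | OpBound (withDiag (X ω) d) (K * √(Fintype.card ι)) ∧
          (withDiag (X ω) d).det ≠ 0 ∧ ¬ Spread a b ((withDiag (X ω) d)⁻¹.transpose.mulVec w)}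
        ≤ C / (Fintype.card ι : ℝ) ^ 2 := by
  obtain ⟨a, b, C, ha, hb, hb1, hC, H⟩ := exists_not_spread_le hρ0 hρ M hK
  refine ⟨a, b, C, ha, hb, hb1, hC, fun Ω _ P _ ι _ _ _ X hX d => ?_⟩
  have hn : 0 ≤ a * √(Fintype.card ι) := by positivity
  have hC0 : 0 ≤ C / (Fintype.card ι : ℝ) ^ 2 := by positivity
  have main : ∀ (Y : Ω → ι → ι → ℝ), EllipticEntries P Y ρ M → ∀ w : ι → ℂ,
      P.real {ω | OpBound (withDiag (Y ω) d) (K * √(Fintype.card ι)) ∧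
          (withDiag (Y ω) d).det ≠ 0 ∧ ¬ Spread a b ((withDiag (Y ω) d)⁻¹.mulVec w)}
        ≤ C / (Fintype.card ι : ℝ) ^ 2 := by
    intro Y hY w
    by_cases hw : w = 0
    · subst hw
      have : {ω | OpBound (withDiag (Y ω) d) (K * √(Fintype.card ι)) ∧
          (withDiag (Y ω) d).det ≠ 0 ∧ ¬ Spread a b ((withDiag (Y ω) d)⁻¹.mulVec 0)} = ∅ := by
        ext ω
        simp [spread_zero hb1]
      rw [this]; simpa using hC0
    · have hl : l2 w ≠ 0 := fun h0 => hw (l2_eq_zero.1 h0)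
      set w' : ι → ℂ := (((l2 w)⁻¹ : ℝ) : ℂ) • w with hw'
      have hw1 : l2 w' = 1 := by
        rw [hw', l2_smul, Complex.norm_real, Real.norm_of_nonneg (inv_nonneg.2 (l2_nonneg _)),
          inv_mul_cancel₀ hl]
      refine (measureReal_mono ?_ (measure_ne_top _ _)).trans (H Ω P ι Y hY d w' hw1.le)
      rintro ω ⟨hop, hdet, hsp⟩
      refine ⟨hop, exists_unit_not_spread hb1 hn hop hsp (c := l2 w) hw1 ?_⟩
      rw [Matrix.mulVec_mulVec, Matrix.mul_nonsing_inv _ (isUnit_iff_ne_zero.2 hdet),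
        Matrix.one_mulVec, hw', smul_smul, ← Complex.ofReal_mul, mul_inv_cancel₀ hl,
        Complex.ofReal_one, one_smul]
  -- The first claim is the degenerate line `w = 0`. The last one holds because the transposed
  -- entries satisfy the same hypotheses.
  refine ⟨?_, main X hX, fun w => ?_⟩
  · refine (measureReal_mono ?_ (measure_ne_top _ _)).trans
      (H Ω P ι X hX d 0 (by rw [l2_zero]; exact zero_le_one))
    rintro ω ⟨hop, x, hx1, hx2, hx3⟩
    exact ⟨hop, x, 0, hx1, hx2, by simp; positivity, by simpa using hx3⟩
  · refine (measureReal_mono ?_ (measure_ne_top _ _)).trans (main _ hX.transpose w)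
    rintro ω ⟨hop, hdet, hsp⟩
    show OpBound (withDiag (fun i j => X ω j i) d) _ ∧ _
    rw [← withDiag_transpose]
    refine ⟨hop.transpose, by rwa [Matrix.det_transpose], ?_⟩
    rwa [← Matrix.transpose_nonsing_inv]

/-! ### Small balls of the Schur complement -/

/-- Small ball estimate for the Schur complement of a random matrix with elliptic off-diagonal
entries, bordered by an independent family of pairs. -/
theorem exists_schur_smallBall {ρ : ℝ} (hρ0 : 0 ≤ ρ) (hρ : ρ < 1) (M : ℝ) {K : ℝ} (hK : 0 < K) :
    ∃ C : ℝ, 0 < C ∧ ∀ (Ω : Type*) [MeasurableSpace Ω] (P : Measure Ω)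
      [IsProbabilityMeasure P] (ι : Type) [Fintype ι] [LinearOrder ι] [Nonempty ι]
      (X : Ω → ι → ι → ℝ), EllipticEntries P X ρ M → ∀ U V : ι → Ω → ℝ,
      iIndepFun (fun i ω => (U i ω, V i ω)) P → (∀ i, PairMoments P (U i) (V i) ρ M) →
      IndepFun (fun ω i => (U i ω, V i ω)) (fun ω (p : {p : ι × ι // p.1 ≠ p.2}) =>
        X ω p.1.1 p.1.2) P →
      ∀ (d : ι → ℂ) (z : ℂ) (ε : ℝ), 0 < ε → ε ≤ 1 →
      P.real {ω | OpBound (withDiag (X ω) d) (K * √(Fintype.card ι)) ∧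
          (withDiag (X ω) d).det ≠ 0 ∧
          ‖z - dotProduct (fun i => (V i ω : ℂ))
            ((withDiag (X ω) d)⁻¹.mulVec fun i => (U i ω : ℂ))‖
          ≤ ε * √(1 + l2 ((withDiag (X ω) d)⁻¹.transpose.mulVec fun i => (V i ω : ℂ)) ^ 2)}
        ≤ C * (ε ^ (1 / 8 : ℝ) + (Fintype.card ι : ℝ) ^ (-(1 / 8) : ℝ)) := by
  classical
  obtain ⟨a, b, C₁, ha, hb, hb1, hC₁, H₁⟩ := exists_inv_not_spread_le hρ0 hρ M hK
  obtain ⟨C₂, L, hC₂, H₂⟩ := exists_pairForm_smallBall (K := K) hρ0 hρ M ha hb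
  set C := (4 / b) ^ (1 / 8 : ℝ) + (1 + √(C₂ + 1) + C₁ + 2 * L * C₁) with hC
  have hC0 : 0 < C := by positivity
  have hC4 : (4 / b) ^ (1 / 8 : ℝ) ≤ C := by
    have : 0 ≤ 1 + √(C₂ + 1) + C₁ + 2 * L * C₁ := by positivity
    linarith
  refine ⟨C, hC0, fun Ω _ P _ ι _ _ _ X hX U V hind hmom hindep d z ε hε hε1 => ?_⟩
  set n := Fintype.card ι with hn
  have hn1 : (1 : ℝ) ≤ n := by exact_mod_cast Fintype.card_pos
  have hn0 : (0 : ℝ) < n := by linarith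
  set η := ε ^ (1 / 8 : ℝ) with hη
  have hη0 : 0 < η := by positivity
  set ν' := (n : ℝ) ^ (-(1 / 8) : ℝ) with hν'
  have hν'0 : 0 < ν' := by positivity
  -- For `n < 4/b` the blocks of the cover could be empty; the first summand of `C` makes the bound
  -- trivial there.
  by_cases hcard : b / 4 * n < 1
  · refine measureReal_le_one.trans ?_
    have h1 : 1 ≤ C * ν' := by
      have h2 : (n : ℝ) ^ (1 / 8 : ℝ) ≤ C := by
        refine le_trans ?_ hC4
        apply Real.rpow_le_rpow hn0.le _ (by norm_num)
        rw [le_div_iff₀ hb]; linarith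
      calc (1 : ℝ) = (n : ℝ) ^ (1 / 8 : ℝ) * ν' := by
            rw [hν', ← Real.rpow_add hn0]; norm_num
        _ ≤ C * ν' := by gcongr
    nlinarith
  rw [not_lt] at hcard
  obtain ⟨J, H₂⟩ := H₂ ι hcard
  have hpairm : ∀ i, Measurable fun ω => (U i ω, V i ω) := fun i => (hmom i).1.prodMk (hmom i).2
  set ν : ι → Measure (ℝ × ℝ) := fun i => P.map fun ω => (U i ω, V i ω) with hν
  have hνp : ∀ i, IsProbabilityMeasure (ν i) := fun i =>
    Measure.isProbabilityMeasure_map (hpairm i).aemeasurable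
  set π := Measure.pi ν with hπ
  -- The diagonal is erased because only the off-diagonal entries are known to be measurable and
  -- independent of the border.
  set Φ : Ω → ι → ι → ℝ := fun ω i j => if i = j then 0 else X ω i j with hΦ
  have hΦX : ∀ ω, withDiag (Φ ω) d = withDiag (X ω) d := fun ω =>
    withDiag_congr (fun i j hij => by simp only [hΦ]; rw [if_neg hij]) d
  have hΦm : Measurable Φ := by
    refine measurable_pi_lambda _ fun i => measurable_pi_lambda _ fun j => ?_
    simp only [hΦ]
    split_ifs with hij
    exacts [measurable_const, hX.measurable hij]
  set μ := P.map Φ with hμ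
  have hμp : IsProbabilityMeasure μ := Measure.isProbabilityMeasure_map hΦm.aemeasurable
  have hμr : ∀ S : Set (ι → ι → ℝ), MeasurableSet S → μ.real S = P.real (Φ ⁻¹' S) :=
    fun S hS => map_measureReal_apply hΦm hS
  have hUVm : Measurable fun ω i => (U i ω, V i ω) := measurable_pi_lambda _ hpairm
  have hlaw : P.map (fun ω => ((fun i => (U i ω, V i ω)), Φ ω)) = π.prod μ := by
    have h1 : IndepFun (fun ω i => (U i ω, V i ω)) Φ P := by
      set ψ : ({p : ι × ι // p.1 ≠ p.2} → ℝ) → ι → ι → ℝ := fun f i j =>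
        if h : i = j then 0 else f ⟨(i, j), h⟩ with hψ
      have hψm : Measurable ψ := by
        refine measurable_pi_lambda _ fun i => measurable_pi_lambda _ fun j => ?_
        simp only [hψ]
        split_ifs
        · exact measurable_const
        · fun_prop
      have h2 := hindep.comp measurable_id hψm
      convert! h2 using 1
    rw [(indepFun_iff_map_prod_eq_prod_map_map hUVm.aemeasurable hΦm.aemeasurable).1 h1,
      (iIndepFun_iff_map_fun_eq_pi_map fun i => (hpairm i).aemeasurable).1 hind]
  set B : (ι → ι → ℝ) → Matrix ι ι ℂ := fun Y => withDiag Y d with hB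
  have hBm : ∀ i j, Measurable fun Y => B Y i j := fun i j =>
    measurable_withDiag (fun i j _ => by fun_prop) d i j
  have hBim : ∀ i j, Measurable fun Y => (B Y)⁻¹ i j := measurable_inv_apply hBm
  set κ := K * √n with hκ
  set good : Set (ι → ι → ℝ) := {Y | OpBound (B Y) κ ∧ (B Y).det ≠ 0} with hgood
  have hgoodm : MeasurableSet good :=
    (measurableSet_opBound hBm κ).inter (measurable_det hBm (measurableSet_singleton 0)).compl
  set E : Set ((ι → ℝ × ℝ) × (ι → ι → ℝ)) := {p | p.2 ∈ good ∧
    ‖z - pairForm (B p.2)⁻¹ p.1‖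
      ≤ ε * √(1 + l2 ((B p.2)⁻¹.transpose.mulVec fun i => ((p.1 i).2 : ℂ)) ^ 2)} with hE
  have hEm : MeasurableSet E := by
    have hm : ∀ i j, Measurable fun p : (ι → ℝ × ℝ) × (ι → ι → ℝ) => (B p.2)⁻¹ i j :=
      fun i j => (hBim i j).comp measurable_snd
    have h1 : Measurable fun p : (ι → ℝ × ℝ) × (ι → ι → ℝ) => pairForm (B p.2)⁻¹ p.1 := by
      unfold pairForm
      simp only [dotProduct, Matrix.mulVec]
      refine Finset.measurable_sum _ fun i _ => Measurable.mul (by fun_prop) ?_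
      exact Finset.measurable_sum _ fun j _ => (hm i j).mul (by fun_prop)
    have h2 := (measurable_mulVec (A := fun p : (ι → ℝ × ℝ) × (ι → ι → ℝ) => (B p.2)⁻¹.transpose)
      (x := fun p i => ((p.1 i).2 : ℂ)) (fun i j => hm j i) (fun i => by fun_prop)).l2
    exact (measurable_snd hgoodm).inter (measurableSet_le
      ((measurable_const.sub h1).norm)
      (measurable_const.mul ((measurable_const.add (h2.pow_const 2)).sqrt)))
  have hevent : P.real {ω | OpBound (withDiag (X ω) d) κ ∧ (withDiag (X ω) d).det ≠ 0 ∧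
          ‖z - dotProduct (fun i => (V i ω : ℂ))
            ((withDiag (X ω) d)⁻¹.mulVec fun i => (U i ω : ℂ))‖
          ≤ ε * √(1 + l2 ((withDiag (X ω) d)⁻¹.transpose.mulVec fun i => (V i ω : ℂ)) ^ 2)}
      = (π.prod μ).real E := by
    rw [← hlaw, map_measureReal_apply (hUVm.prodMk hΦm) hEm]
    congr 1
    ext ω
    simp only [hE, hgood, hB, Set.mem_preimage, Set.mem_ofPred_eq, hΦX, pairForm, and_assoc]
  rw [hevent]
  set W : Fin L → Set ((ι → ι → ℝ) × (ι → ℝ × ℝ) × (ι → ℝ × ℝ)) := fun l =>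
    {q | q.1 ∈ good ∧ (¬ Spread a b ((B q.1)⁻¹.mulVec (resampleDiff (J l) Prod.fst q.2)) ∨
      ¬ Spread a b ((B q.1)⁻¹.transpose.mulVec (resampleDiff (J l) Prod.snd q.2)))} with hW
  have hWm : ∀ l, MeasurableSet (W l) := by
    intro l
    have hm : ∀ i j, Measurable fun q : (ι → ι → ℝ) × (ι → ℝ × ℝ) × (ι → ℝ × ℝ) =>
      (B q.1)⁻¹ i j := fun i j => (hBim i j).comp measurable_fst
    have h1 := measurable_mulVec (x := fun q : (ι → ι → ℝ) × (ι → ℝ × ℝ) × (ι → ℝ × ℝ) =>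
      resampleDiff (J l) Prod.fst q.2) hm
      (fun i => (measurable_resampleDiff (J l) measurable_fst i).comp measurable_snd)
    have h2 := measurable_mulVec (A := fun q : (ι → ι → ℝ) × (ι → ℝ × ℝ) × (ι → ℝ × ℝ) =>
      (B q.1)⁻¹.transpose) (x := fun q => resampleDiff (J l) Prod.snd q.2) (fun i j => hm j i)
      (fun i => (measurable_resampleDiff (J l) measurable_snd i).comp measurable_snd)
    exact (measurable_fst hgoodm).inter
      ((measurableSet_spread h1 a b).compl.union (measurableSet_spread h2 a b).compl)
  obtain ⟨-, hS1, hS2⟩ := H₁ Ω P ι X hX d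
  have hWle : ∀ l, (μ.prod (π.prod π)).real (W l) ≤ 2 * C₁ / (n : ℝ) ^ 2 := by
    intro l
    -- For fixed samples the right hand sides are deterministic, so the estimate for linear systems
    -- applies to the random matrix and to its transpose.
    have h1 := measureReal_prod_le_of_section_le μ (π.prod π) (hWm l) (D := ∅) MeasurableSet.empty
      (c := 2 * C₁ / (n : ℝ) ^ 2) (fun q _ => ?_) (by positivity)
    · simpa using h1
    · have hsm : MeasurableSet {x | (x, q) ∈ W l} := measurable_prodMk_right (hWm l)
      rw [hμr _ hsm]
      refine (measureReal_mono ?_ (measure_ne_top _ _)).trans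
        ((measureReal_union_le _ _).trans ((add_le_add (hS1 (resampleDiff (J l) Prod.fst q))
          (hS2 (resampleDiff (J l) Prod.snd q))).trans (le_of_eq (by ring))))
      rintro ω ⟨⟨h2, h3⟩, h4 | h4⟩
      · simp only [hB, hΦX] at h2 h3 h4
        exact Or.inl ⟨h2, h3, h4⟩
      · simp only [hB, hΦX] at h2 h3 h4
        exact Or.inr ⟨h2, h3, h4⟩
  set p : Fin L → (ι → ι → ℝ) → ℝ := fun l Y => (π.prod π).real {q | (Y, q) ∈ W l} with hp
  -- Exceptional matrices. In `D₁` some row of the inverse is not spread: `n` events of probability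
  -- `O(n⁻²)`. In `D₂` the conditional probability that a coefficient vector is not spread exceeds
  -- `1/√n`: Markov's inequality loses `√n` against `O(n⁻²)`.
  set D₁ : Set (ι → ι → ℝ) := ⋃ k, {Y | Y ∈ good ∧ ¬ Spread a b ((B Y)⁻¹ k)} with hD₁
  set D₂ : Set (ι → ι → ℝ) := {Y | 1 / √n ≤ ∑ l, p l Y} with hD₂
  have hD₁m : MeasurableSet D₁ := MeasurableSet.iUnion fun k =>
    hgoodm.inter (measurableSet_spread (measurable_pi_lambda _ fun j => hBim k j) a b).compl
  have hpm : ∀ l, Measurable (p l) := fun l =>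
    (measurable_measure_prodMk_left (hWm l)).ennreal_toReal
  have hD₂m : MeasurableSet D₂ :=
    measurableSet_le measurable_const (Finset.measurable_sum _ fun l _ => hpm l)
  have hsqrt : 1 / √n ≤ ν' ^ 2 := by
    rw [hν', ← Real.rpow_natCast, ← Real.rpow_mul hn0.le, one_div, Real.sqrt_eq_rpow,
      ← Real.rpow_neg hn0.le]
    exact Real.rpow_le_rpow_of_exponent_le hn1 (by norm_num)
  have hinv : 1 / (n : ℝ) ≤ ν' := by
    rw [hν', one_div, ← Real.rpow_neg_one]
    exact Real.rpow_le_rpow_of_exponent_le hn1 (by norm_num)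
  have hD₁le : μ.real D₁ ≤ C₁ * ν' := by
    calc μ.real D₁ ≤ ∑ k, μ.real {Y | Y ∈ good ∧ ¬ Spread a b ((B Y)⁻¹ k)} :=
          measureReal_iUnion_fintype_le _
      _ ≤ ∑ _k : ι, C₁ / (n : ℝ) ^ 2 := by
          refine Finset.sum_le_sum fun k _ => ?_
          have hsm : MeasurableSet {Y | Y ∈ good ∧ ¬ Spread a b ((B Y)⁻¹ k)} :=
            hgoodm.inter (measurableSet_spread
              (measurable_pi_lambda _ fun j => hBim k j) a b).compl
          rw [hμr _ hsm]
          refine (measureReal_mono ?_ (measure_ne_top _ _)).trans (hS2 (Pi.single k 1))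
          rintro ω ⟨⟨h2, h3⟩, h4⟩
          simp only [hB, hΦX] at h2 h3 h4
          refine ⟨h2, h3, ?_⟩
          rwa [Matrix.mulVec_single_one]
      _ = C₁ * (1 / n) := by
          rw [Finset.sum_const, Finset.card_univ, nsmul_eq_mul, ← hn]; field_simp
      _ ≤ _ := by gcongr
  have hD₂le : μ.real D₂ ≤ 2 * L * C₁ * ν' := by
    have h1 := mul_meas_ge_le_integral_of_nonneg (μ := μ) (f := fun Y => ∑ l, p l Y)
      (Filter.Eventually.of_forall fun Y => Finset.sum_nonneg fun l _ => measureReal_nonneg)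
      (integrable_finsetSum _ fun l _ =>
        (measureReal_prod_eq_integral μ (π.prod π) (hWm l)).1) (1 / √n)
    rw [integral_finsetSum _ fun l _ =>
        (measureReal_prod_eq_integral μ (π.prod π) (hWm l)).1] at h1
    have h2 : ∑ l, ∫ Y, p l Y ∂μ ≤ L * (2 * C₁ / (n : ℝ) ^ 2) := by
      calc _ ≤ ∑ _l : Fin L, 2 * C₁ / (n : ℝ) ^ 2 := Finset.sum_le_sum fun l _ => by
            rw [← (measureReal_prod_eq_integral μ (π.prod π) (hWm l)).2]
            exact hWle l
        _ = _ := by rw [Finset.sum_const, Finset.card_univ, Fintype.card_fin, nsmul_eq_mul]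
    have h3 : 1 / √n * μ.real D₂ ≤ L * (2 * C₁ / (n : ℝ) ^ 2) := h1.trans h2
    have hsn : 0 < √(n : ℝ) := by positivity
    have hsn2 : √(n : ℝ) ≤ n := by
      rw [Real.sqrt_le_left hn0.le]; nlinarith
    calc μ.real D₂ = √n * (1 / √n * μ.real D₂) := by field_simp
      _ ≤ n * (L * (2 * C₁ / (n : ℝ) ^ 2)) := by
          have : 0 ≤ 1 / √n * μ.real D₂ := by positivity
          gcongr
      _ = 2 * L * C₁ * (1 / n) := by field_simp
      _ ≤ _ := by gcongr
  have hsec : ∀ Y ∉ D₁ ∪ D₂, π.real {y | (y, Y) ∈ E} ≤ η + √(C₂ + 1) * (η + ν') := by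
    intro Y hY
    have hnn : 0 ≤ η + √(C₂ + 1) * (η + ν') := by positivity
    by_cases hg : Y ∈ good
    · rw [Set.mem_union, not_or] at hY
      have hsp : ∀ k, Spread a b ((B Y)⁻¹ k) := by
        intro k
        by_contra h
        exact hY.1 (Set.mem_iUnion.2 ⟨k, hg, h⟩)
      have h1 := H₂ ν (fun i => (hmom i).map) (B Y)⁻¹ hsp (l2_inv_row_pos hg.2)
        (one_le_of_opBound_inv hg.1 hg.2) z ε hε hε1
      have h2 : {y | (y, Y) ∈ E} = {y | ‖z - pairForm (B Y)⁻¹ y‖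
          ≤ ε * √(1 + l2 ((B Y)⁻¹.transpose.mulVec fun i => ((y i).2 : ℂ)) ^ 2)} := by
        ext y
        exact ⟨fun h => h.2, fun h => ⟨hg, h⟩⟩
      rw [h2]
      refine h1.trans ?_
      gcongr
      have h3 : ∑ l, (π.prod π).real
          {p | ¬ Spread a b ((B Y)⁻¹.mulVec (resampleDiff (J l) Prod.fst p)) ∨
            ¬ Spread a b ((B Y)⁻¹.transpose.mulVec (resampleDiff (J l) Prod.snd p))}
          ≤ 1 / √n := by
        refine le_trans (le_of_eq ?_) (not_le.1 hY.2).le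
        refine Finset.sum_congr rfl fun l _ => ?_
        congr 1
        ext q
        exact ⟨fun h => ⟨hg, h⟩, fun h => h.2⟩
      apply Real.sqrt_le_iff.2 ⟨by positivity, ?_⟩
      -- The radicand is of order `η² + ν'²`, so its root is of order `η + ν'`.
      have hη2 : ε ^ (1 / 4 : ℝ) = η ^ 2 := by
        rw [hη, ← Real.rpow_natCast, ← Real.rpow_mul hε.le]; norm_num
      rw [mul_pow, Real.sq_sqrt (by positivity), hη2]
      calc _ ≤ C₂ * (η ^ 2 + ν' ^ 2) + ν' ^ 2 := by
            gcongr
            exact h3.trans hsqrt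
        _ ≤ (C₂ + 1) * (η + ν') ^ 2 := by
            have : 0 ≤ η * ν' := by positivity
            nlinarith [sq_nonneg η]
    · have : {y | (y, Y) ∈ E} = ∅ := by
        ext y
        simp only [Set.mem_ofPred_eq, Set.mem_empty_iff_false, iff_false]
        exact fun h => hg h.1
      rw [this]
      simpa using hnn
  have hfin := measureReal_prod_le_of_section_le π μ hEm (hD₁m.union hD₂m) hsec (by positivity)
  have hu := measureReal_union_le (μ := μ) D₁ D₂
  have h4 : 0 ≤ (4 / b) ^ (1 / 8 : ℝ) * (η + ν') := by positivity
  have h5 : 0 ≤ (C₁ + 2 * L * C₁) * η := by positivity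
  calc _ ≤ (C₁ * ν' + 2 * L * C₁ * ν') + (η + √(C₂ + 1) * (η + ν')) := by linarith
    _ ≤ C * (η + ν') := by
        rw [hC]
        nlinarith

/-! ### Generic shifts and independence of the border -/

/-- A real scalar shift makes a matrix singular for finitely many values only. -/
lemma finite_det_add_smul_eq_zero {ι : Type*} [Fintype ι] [DecidableEq ι] (B : Matrix ι ι ℂ) :
    {t : ℝ | (B + (t : ℂ) • (1 : Matrix ι ι ℂ)).det = 0}.Finite := by
  have h1 : {t : ℝ | (B + (t : ℂ) • (1 : Matrix ι ι ℂ)).det = 0}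
      = Complex.ofReal ⁻¹' ((-B).charpoly.rootSet ℂ) := by
    ext t
    rw [Set.mem_preimage, Polynomial.mem_rootSet_of_ne (Matrix.charpoly_monic _).ne_zero,
      Set.mem_ofPred_eq, Polynomial.coe_aeval_eq_eval, Matrix.eval_charpoly, sub_neg_eq_add,
      add_comm, Matrix.scalar_apply, Matrix.smul_one_eq_diagonal]
  rw [h1]
  exact (Polynomial.rootSet_finite _ _).preimage Complex.ofReal_injective.injOn

lemma withDiag_add {ι : Type*} [DecidableEq ι] (Y : ι → ι → ℝ) (d : ι → ℂ) (t : ℂ) :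
    withDiag Y (fun i => d i + t) = withDiag Y d + t • (1 : Matrix ι ι ℂ) := by
  ext i j
  by_cases h : i = j
  · subst h; simp [withDiag]
  · simp [withDiag, h]

lemma minor_withDiag {ι : Type*} [DecidableEq ι] (Y : ι → ι → ℝ) (d : ι → ℂ) (k : ι) :
    minor (withDiag Y d) k
      = withDiag (fun i j : {i // i ≠ k} => Y i j) (fun i : {i // i ≠ k} => d i) := by
  ext i j
  simp [minor, withDiag, Subtype.ext_iff]

section

variable {Ω : Type*} [MeasurableSpace Ω] {P : Measure Ω}
  {ι : Type*} [Fintype ι] [LinearOrder ι] {X : Ω → ι → ι → ℝ} {ρ M : ℝ}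

/-- The entries in the row and column `k` are independent of the remaining off-diagonal entries. -/
lemma EllipticEntries.indepFun_minor (hX : EllipticEntries P X ρ M) (k : ι) :
    IndepFun (fun ω (i : {i // i ≠ k}) => (X ω i k, X ω k i))
      (fun ω (p : {p : {i // i ≠ k} × {i // i ≠ k} // p.1 ≠ p.2}) => X ω p.1.1 p.1.2) P := by
  classical
  set Q := {p : {i // i ≠ k} × {i // i ≠ k} // p.1 < p.2} with hQ
  -- The left summand indexes the positions joining `k` to the minor, the right one the pairs inside
  -- the minor. As unordered positions they are all distinct.
  set f : {i // i ≠ k} ⊕ Q → ι := Sum.elim (fun i => i) fun q => q.1.1 with hf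
  set g : {i // i ≠ k} ⊕ Q → ι := Sum.elim (fun _ => k) fun q => q.1.2 with hg
  have hne : ∀ s, f s ≠ g s := by
    rintro (i | q)
    · exact i.2
    · exact (Subtype.coe_lt_coe.2 q.2).ne
  have hinj : ∀ s t, (f s = f t ∧ g s = g t) ∨ (f s = g t ∧ g s = f t) → s = t := by
    rintro (⟨i, hi⟩ | ⟨⟨⟨a, ha⟩, ⟨b, hb⟩⟩, hab⟩) (⟨j, hj⟩ | ⟨⟨⟨c, hc⟩, ⟨d, hd⟩⟩, hcd⟩) hh <;>
      simp only [hf, hg, Sum.elim_inl, Sum.elim_inr] at hh ⊢ <;>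
      simp only [reduceCtorEq, Sum.inl.injEq, Sum.inr.injEq, Subtype.mk.injEq] <;>
      grind
  have h1 := hX.indep_pairs f g hne hinj
  have hm : ∀ s, Measurable fun ω => (X ω (f s) (g s), X ω (g s) (f s)) := fun s =>
    (hX.measurable (hne s)).prodMk (hX.measurable (hne s).symm)
  set S : Finset ({i // i ≠ k} ⊕ Q) := Finset.univ.map .inl with hS
  set T : Finset ({i // i ≠ k} ⊕ Q) := Finset.univ.map .inr with hT
  have hST : Disjoint S T := by
    rw [Finset.disjoint_left]
    simp [hS, hT]
  have hmS : ∀ i, Sum.inl i ∈ S := by simp [hS]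
  have hmT : ∀ q, Sum.inr q ∈ T := by simp [hT]
  have h2 := h1.indepFun_finset S T hST hm
  set φ : (S → ℝ × ℝ) → {i // i ≠ k} → ℝ × ℝ := fun y i => y ⟨Sum.inl i, hmS i⟩ with hφ
  set ψ : (T → ℝ × ℝ) → {p : {i // i ≠ k} × {i // i ≠ k} // p.1 ≠ p.2} → ℝ := fun y p =>
    if h : p.1.1 < p.1.2 then (y ⟨Sum.inr ⟨p.1, h⟩, hmT _⟩).1
    else (y ⟨Sum.inr ⟨p.1.swap, lt_of_le_of_ne (not_lt.1 h) p.2.symm⟩, hmT _⟩).2 with hψ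
  have hφm : Measurable φ := by fun_prop
  have hψm : Measurable ψ := by
    refine measurable_pi_lambda _ fun p => ?_
    simp only [hψ]
    split_ifs <;> fun_prop
  have h3 := h2.comp hφm hψm
  convert! h3 using 1
  funext ω p
  simp only [hψ, Function.comp]
  split_ifs <;> rfl

/-- For almost every real shift of the diagonal, all principal minors are almost surely
invertible. -/
lemma EllipticEntries.ae_det_minor_ne_zero [IsProbabilityMeasure P]
    (hX : EllipticEntries P X ρ M) (d : ι → ℂ) :
    ∀ᵐ t : ℝ, ∀ᵐ ω ∂P, ∀ k, (minor (withDiag (X ω) fun i => d i + (t : ℂ)) k).det ≠ 0 := by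
  have hm : ∀ i j, Measurable fun x : Ω × ℝ => withDiag (X x.1) (fun i => d i + (x.2 : ℂ)) i j := by
    intro i j
    simp only [withDiag, Matrix.of_apply]
    split_ifs with h
    · fun_prop
    · exact Complex.measurable_ofReal.comp ((hX.measurable h).comp measurable_fst)
  have hS : MeasurableSet {x : Ω × ℝ |
      ∀ k, (minor (withDiag (X x.1) fun i => d i + (x.2 : ℂ)) k).det ≠ 0} := by
    rw [Set.ofPred_forall]
    refine MeasurableSet.iInter fun k => ?_
    exact (measurable_det
      (A := fun x : Ω × ℝ => minor (withDiag (X x.1) fun i => d i + (x.2 : ℂ)) k)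
      (fun i j => hm i j) (measurableSet_singleton 0)).compl
  -- Fubini: for every fixed outcome only finitely many shifts are bad for a given minor.
  rw [← Measure.ae_ae_comm hS]
  refine Filter.Eventually.of_forall fun ω => ?_
  rw [ae_all_iff]
  intro k
  have h1 := (finite_det_add_smul_eq_zero (minor (withDiag (X ω) d) k)).measure_zero volume
  rw [ae_iff]
  refine measure_mono_null (fun t ht => ?_) h1
  simp only [Set.mem_ofPred_eq, not_not] at ht ⊢
  rwa [minor_withDiag, ← withDiag_add, ← minor_withDiag _ (fun i => d i + (t : ℂ))]

end

/-! ### Short images for a deterministic diagonal -/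

/-- The least singular value of a random matrix with elliptic off-diagonal entries and arbitrary
deterministic diagonal. -/
theorem exists_small_image_le {ρ : ℝ} (hρ0 : 0 ≤ ρ) (hρ : ρ < 1) (M : ℝ) {K : ℝ} (hK : 0 < K) :
    ∃ C : ℝ, 0 < C ∧ ∀ (Ω : Type*) [MeasurableSpace Ω] (P : Measure Ω)
      [IsProbabilityMeasure P] (ι : Type) [Fintype ι] [LinearOrder ι] [Nonempty ι]
      (X : Ω → ι → ι → ℝ), EllipticEntries P X ρ M →
      ∀ (d : ι → ℂ) (ε : ℝ), 0 < ε → ε ≤ 1 →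
      P.real {ω | OpBound (withDiag (X ω) d) (K * √(Fintype.card ι)) ∧
          ∃ x, l2 x = 1 ∧ l2 ((withDiag (X ω) d).mulVec x) ≤ ε / √(Fintype.card ι)}
        ≤ C * (ε ^ (1 / 8 : ℝ) + (Fintype.card ι : ℝ) ^ (-(1 / 8) : ℝ)) := by
  classical
  obtain ⟨a, b, C₁, ha, hb, hb1, hC₁, H₁⟩ :=
    -- The generic shift at most doubles the norm bound, hence `2 * K`. In `4 * K` below, a further
    -- factor `2` pays for `√n ≤ 2√(n - 1)` when passing to a minor.
    exists_inv_not_spread_le hρ0 hρ M (K := 2 * K) (by positivity)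
  obtain ⟨C₂, hC₂, H₂⟩ := exists_schur_smallBall hρ0 hρ M (K := 4 * K) (by positivity)
  set s := (2 / a) ^ (1 / 8 : ℝ) with hs
  have hs0 : 0 < s := by positivity
  set C := s * (1 + C₂ / b) + (1 + C₁ + 2 * (C₂ / b)) with hC
  have hCb : 0 < C₂ / b := by positivity
  have hC1 : 1 ≤ C := by
    have : 0 < s * (1 + C₂ / b) := by positivity
    linarith
  refine ⟨C, by linarith, fun Ω _ P _ ι _ _ _ X hX d ε hε hε1 => ?_⟩
  set n := Fintype.card ι with hn
  have hnpos : 1 ≤ n := Fintype.card_pos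
  have hn1 : (1 : ℝ) ≤ n := by exact_mod_cast hnpos
  have hn0 : (0 : ℝ) < n := by linarith
  set η := ε ^ (1 / 8 : ℝ) with hη
  have hη0 : 0 < η := by positivity
  set ν' := (n : ℝ) ^ (-(1 / 8) : ℝ) with hν'
  have hν'0 : 0 < ν' := by positivity
  by_cases hn2 : n < 2
  · refine measureReal_le_one.trans ?_
    have : n = 1 := by omega
    have h1 : ν' = 1 := by rw [hν', this]; simp
    rw [h1]
    nlinarith
  rw [not_lt] at hn2
  have hn2' : (2 : ℝ) ≤ n := by exact_mod_cast hn2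
  have hsη : (2 * ε / a) ^ (1 / 8 : ℝ) = s * η := by
    rw [hs, hη, ← Real.mul_rpow (by positivity) hε.le]
    congr 1; ring
  by_cases hεa : 1 < 2 * ε / a
  · refine measureReal_le_one.trans ?_
    have h1 : 1 ≤ s * η := by
      rw [← hsη]; exact Real.one_le_rpow hεa.le (by norm_num)
    have h2 : s * η ≤ C * η := by
      apply mul_le_mul_of_nonneg_right _ hη0.le
      have : 0 < s * (C₂ / b) := by positivity
      rw [hC]; linarith
    nlinarith
  rw [not_lt] at hεa
  have hsn : 0 < √(n : ℝ) := by positivity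
  have hsn2 : √(n : ℝ) * √(n : ℝ) = n := Real.mul_self_sqrt hn0.le
  -- Entries may have atoms, so minors can be singular with positive probability. A shift `t`
  -- outside a null set prevents this, and its size at most doubles both the norm bound and the
  -- admissible length of the image.
  obtain ⟨t, ht0, ht1, ht2, ht⟩ : ∃ t : ℝ, 0 < t ∧ t ≤ ε / √n ∧ t ≤ K * √n ∧
      ∀ᵐ ω ∂P, ∀ k, (minor (withDiag (X ω) fun i => d i + (t : ℂ)) k).det ≠ 0 := by
    have hτ : 0 < min (ε / √n) (K * √n) := by positivity
    have h1 : (volume (Set.Ioo 0 (min (ε / √n) (K * √n)))) ≠ 0 := by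
      rw [Real.volume_Ioo, sub_zero]
      exact (ENNReal.ofReal_pos.2 hτ).ne'
    obtain ⟨t, ht, ht'⟩ := Measure.exists_mem_of_measure_ne_zero_of_ae h1
      (ae_restrict_of_ae (hX.ae_det_minor_ne_zero d))
    exact ⟨t, ht.1, (le_min_iff.1 ht.2.le).1, (le_min_iff.1 ht.2.le).2, ht'⟩
  set d' : ι → ℂ := fun i => d i + (t : ℂ) with hd'
  set A : Ω → Matrix ι ι ℂ := fun ω => withDiag (X ω) d' with hA
  have hAx : ∀ ω x, l2 ((A ω).mulVec x) ≤ l2 ((withDiag (X ω) d).mulVec x) + t * l2 x := by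
    intro ω x
    simp only [hA, hd', withDiag_add, Matrix.add_mulVec, Matrix.smul_mulVec, Matrix.one_mulVec]
    refine (l2_add_le _ _).trans_eq ?_
    rw [l2_smul, Complex.norm_real, Real.norm_of_nonneg ht0.le]
  set N : Set Ω := {ω | ¬ ∀ k, (minor (A ω) k).det ≠ 0} with hN
  have hN0 : P.real N = 0 := by rw [measureReal_def, ae_iff.1 ht, ENNReal.toReal_zero]
  set Bad : Set Ω := {ω | OpBound (A ω) (2 * K * √n) ∧ ∃ x : ι → ℂ, l2 x = 1 ∧ ¬ Spread a b x ∧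
    l2 ((A ω).mulVec x) ≤ a * √n} with hBad
  have hBadle : P.real Bad ≤ C₁ * ν' := by
    refine (H₁ Ω P ι X hX d').1.trans ?_
    rw [div_eq_mul_inv]
    apply mul_le_mul_of_nonneg_left _ hC₁.le
    rw [hν', ← hn, ← Real.rpow_natCast, ← Real.rpow_neg hn0.le]
    exact Real.rpow_le_rpow_of_exponent_le hn1 (by norm_num)
  set E : ι → Set Ω := fun k => {ω | OpBound (minor (A ω) k) (2 * K * √n) ∧
    (minor (A ω) k).det ≠ 0 ∧
    ‖d' k - dotProduct (fun i : {i // i ≠ k} => (X ω k i : ℂ))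
      ((minor (A ω) k)⁻¹.mulVec fun i => (X ω i k : ℂ))‖
    ≤ 2 * ε / a * √(1 + l2 ((minor (A ω) k)⁻¹.transpose.mulVec
      fun i => (X ω k i : ℂ)) ^ 2)} with hE
  have hEle : ∀ k, P.real (E k) ≤ C₂ * (s * η + 2 * ν') := by
    intro k
    have hcard : Fintype.card {i // i ≠ k} = n - 1 := Set.card_ne_eq k
    have hcard' : (Fintype.card {i // i ≠ k} : ℝ) = n - 1 := by
      rw [hcard, Nat.cast_sub hnpos, Nat.cast_one]
    have : Nonempty {i // i ≠ k} := Fintype.card_pos_iff.1 (by omega)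
    have h1 := H₂ Ω P {i // i ≠ k} (fun ω i j => X ω i j) (hX.restrict _)
      (fun i ω => X ω i k) (fun i ω => X ω k i)
      (hX.indep_pairs (fun i : {i // i ≠ k} => (i : ι)) (fun _ => k) (fun i => i.2)
        (fun i j hij => by have := i.2; have := j.2; grind))
      (fun i => hX.moments i k i.2) (hX.indepFun_minor k) (fun i => d' i) (d' k) (2 * ε / a)
      (by positivity) hεa
    rw [hcard', hsη] at h1
    have h2 : ((n : ℝ) - 1) ^ (-(1 / 8) : ℝ) ≤ 2 * ν' := by
      have h3 : ((n : ℝ) / 2) ^ (-(1 / 8) : ℝ) ≤ 2 * ν' := by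
        rw [div_eq_inv_mul, Real.mul_rpow (by norm_num) hn0.le]
        gcongr
        rw [Real.inv_rpow (by norm_num), ← Real.rpow_neg (by norm_num), neg_neg]
        calc (2 : ℝ) ^ (1 / 8 : ℝ) ≤ 2 ^ (1 : ℝ) :=
              Real.rpow_le_rpow_of_exponent_le (by norm_num) (by norm_num)
          _ = 2 := Real.rpow_one 2
      exact (Real.rpow_le_rpow_of_nonpos (by linarith) (by linarith) (by norm_num)).trans h3
    refine (measureReal_mono ?_ (measure_ne_top _ _)).trans (h1.trans (by gcongr))
    rintro ω ⟨h3, h4, h5⟩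
    simp only [hA, minor_withDiag] at h3 h4 h5
    refine ⟨fun x => (h3 x).trans ?_, h4, h5⟩
    apply mul_le_mul_of_nonneg_right _ (l2_nonneg x)
    have h6 : √(n : ℝ) ≤ 2 * √((n : ℝ) - 1) := by
      apply Real.sqrt_le_iff.2 ⟨by positivity, ?_⟩
      rw [mul_pow, Real.sq_sqrt (by linarith)]
      linarith
    nlinarith
  set F : Set Ω := {ω | OpBound (A ω) (2 * K * √n) ∧ (∀ k, (minor (A ω) k).det ≠ 0) ∧
    ∃ x : ι → ℂ, l2 x = 1 ∧ Spread a b x ∧ l2 ((A ω).mulVec x) ≤ 2 * ε / √n} with hF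
  have hFle : P.real F ≤ C₂ / b * (s * η + 2 * ν') := by
    -- A spread vector has at least `b n` coordinates of modulus at least `a/√n`, and on `F` each of
    -- these indices `k` forces the event `E k`. Averaging over `k` cancels the factor `n`.
    have h1 := mul_measureReal_le_sum (P := P) Finset.univ (w := fun _ : ι => 1)
      (fun _ _ => zero_le_one) E (F := F) (c := b * n) ?_ (by positivity)
    · have h2 : ∑ k, 1 * P.real (E k) ≤ n * (C₂ * (s * η + 2 * ν')) := by
        calc _ ≤ ∑ _k : ι, C₂ * (s * η + 2 * ν') :=
              Finset.sum_le_sum fun k _ => by rw [one_mul]; exact hEle k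
          _ = _ := by rw [Finset.sum_const, Finset.card_univ, nsmul_eq_mul]
      have h3 : b * n * P.real F ≤ b * n * (C₂ / b * (s * η + 2 * ν')) := by
        refine (h1.trans h2).trans_eq ?_
        field_simp
      exact le_of_mul_le_mul_left h3 (by positivity)
    · rintro ω ⟨hop, hdet, x, hx1, hxs, hxA⟩
      unfold Spread at hxs
      refine hxs.trans ?_
      rw [Finset.card_filter]
      push_cast
      refine Finset.sum_le_sum fun k _ => ?_
      split_ifs with hk
      · rw [Set.indicator_of_mem]
        refine ⟨hop.minor k, hdet k, ?_⟩
        rw [hx1, mul_one] at hk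
        have h1 := norm_mul_schur_le (hdet k) x
        have h2 : A ω k k = d' k := by simp [hA, withDiag]
        have h3 : (fun i : {i // i ≠ k} => A ω k i) = fun i : {i // i ≠ k} => (X ω k i : ℂ) := by
          funext i; simp [hA, withDiag, i.2.symm]
        have h4 : (fun i : {i // i ≠ k} => A ω i k) = fun i : {i // i ≠ k} => (X ω i k : ℂ) := by
          funext i; simp [hA, withDiag, i.2]
        rw [h2, h3, h4] at h1
        set R := √(1 + l2 ((minor (A ω) k)⁻¹.transpose.mulVec
          fun i : {i // i ≠ k} => (X ω k i : ℂ)) ^ 2)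
        set D := ‖d' k - dotProduct (fun i : {i // i ≠ k} => (X ω k i : ℂ))
          ((minor (A ω) k)⁻¹.mulVec fun i => (X ω i k : ℂ))‖
        have hR : 0 ≤ R := Real.sqrt_nonneg _
        have hD : 0 ≤ D := norm_nonneg _
        have h5 : a * D ≤ 2 * ε * R := by
          calc a * D ≤ √n * ‖x k‖ * D := by gcongr
            _ = √n * (‖x k‖ * D) := by ring
            _ ≤ √n * (2 * ε / √n * R) := by
                exact mul_le_mul_of_nonneg_left
                  (h1.trans (mul_le_mul_of_nonneg_right hxA hR)) hsn.le
            _ = 2 * ε * R := by field_simp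
        rw [div_mul_eq_mul_div, le_div_iff₀ ha]
        linarith
      · exact Set.indicator_nonneg (fun _ _ => zero_le_one) _
  have hsub : {ω | OpBound (withDiag (X ω) d) (K * √n) ∧
      ∃ x, l2 x = 1 ∧ l2 ((withDiag (X ω) d).mulVec x) ≤ ε / √n} ⊆ N ∪ (Bad ∪ F) := by
    rintro ω ⟨hop, x, hx1, hxA⟩
    have hop' : OpBound (A ω) (2 * K * √n) := fun y => by
      have h1 := hop y
      have h2 := hAx ω y
      have h3 := mul_le_mul_of_nonneg_right ht2 (l2_nonneg y)
      linarith
    have hxA' : l2 ((A ω).mulVec x) ≤ 2 * ε / √n := by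
      have h1 := hAx ω x
      rw [hx1, mul_one] at h1
      calc _ ≤ ε / √n + ε / √n := by linarith
        _ = _ := by ring
    by_cases hdet : ∀ k, (minor (A ω) k).det ≠ 0
    · right
      by_cases hxs : Spread a b x
      · exact Or.inr ⟨hop', hdet, x, hx1, hxs, hxA'⟩
      · refine Or.inl ⟨hop', x, hx1, hxs, hxA'.trans ?_⟩
        -- The bound for vectors that are not spread tolerates images of length `a √n`, far beyond
        -- `2ε/√n`, since `2ε ≤ a`.
        rw [div_le_iff₀ hsn, mul_assoc, hsn2]
        rw [div_le_one ha] at hεa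
        nlinarith
    · exact Or.inl hdet
  have h1 := measureReal_union_le (μ := P) N (Bad ∪ F)
  have h2 := measureReal_union_le (μ := P) Bad F
  have h3 : 0 < (1 + C₁ + 2 * (C₂ / b)) * η := by positivity
  have h4 : 0 < s * (1 + C₂ / b) * ν' := by positivity
  have h5 : 0 < s * η := by positivity
  calc _ ≤ P.real (N ∪ (Bad ∪ F)) := measureReal_mono hsub (measure_ne_top _ _)
    _ ≤ C₁ * ν' + C₂ / b * (s * η + 2 * ν') := by linarith
    _ ≤ C * (η + ν') := by
        rw [hC]
        linarith

/-! ### Singular values and the random diagonal -/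

/-- The unit sphere is compact, so projecting it away is a closed map and the condition is closed in
the entries. -/
lemma measurableSet_exists_small_image {Ω : Type*} [MeasurableSpace Ω] {ι : Type*} [Fintype ι]
    {A : Ω → Matrix ι ι ℂ} (hA : ∀ i j, Measurable fun ω => A ω i j) (r : ℝ) :
    MeasurableSet {ω | ∃ x, l2 x = 1 ∧ l2 ((A ω).mulVec x) ≤ r} := by
  have hcl : IsClosed {B : ι → ι → ℂ | ∃ x, l2 x = 1 ∧ l2 ((Matrix.of B).mulVec x) ≤ r} := by
    have h1 : IsClosed {p : (ι → ι → ℂ) × Metric.sphere (0 : EuclideanSpace ℂ ι) 1 |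
        l2 ((Matrix.of p.1).mulVec p.2.1.ofLp) ≤ r} := by
      refine isClosed_le ?_ continuous_const
      simp only [l2, Matrix.mulVec, dotProduct, Matrix.of_apply]
      fun_prop
    convert isClosedMap_fst_of_compactSpace _ h1 using 1
    ext B
    constructor
    · rintro ⟨x, hx, hr⟩
      exact ⟨(B, ⟨WithLp.toLp 2 x, by rw [mem_sphere_zero_iff_norm, ← l2_eq_norm, hx]⟩), hr, rfl⟩
    · rintro ⟨⟨B, y⟩, hr, rfl⟩
      exact ⟨y.1.ofLp, by rw [l2_eq_norm, WithLp.toLp_ofLp, mem_sphere_zero_iff_norm.1 y.2], hr⟩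
  have hm : Measurable fun ω => (fun i j => A ω i j : ι → ι → ℂ) :=
    measurable_pi_lambda _ fun i => measurable_pi_lambda _ fun j => hA i j
  exact hm hcl.measurableSet

/-- The least singular value is attained at a unit vector. -/
lemma exists_l2_mulVec_eq_smallestSingularValue {n : ℕ} (hn : 1 ≤ n)
    (A : Matrix (Fin n) (Fin n) ℂ) :
    ∃ x, l2 x = 1 ∧ l2 (A.mulVec x) = smallestSingularValue A := by
  set T := Matrix.toEuclideanLin A with hT
  have hlt : n - 1 < Module.finrank ℂ (EuclideanSpace ℂ (Fin n)) := by
    rw [finrank_euclideanSpace_fin]; omega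
  -- A normalized eigenvector of `T* T` for the square of the last singular value serves as the
  -- minimizer.
  obtain ⟨v, hv⟩ := (T.hasEigenvalue_adjoint_comp_self_sq_singularValues hlt).exists_hasEigenvector
  have hv0 : 0 < ‖v‖ := norm_pos_iff.2 hv.2
  have h1 : ‖T v‖ ^ 2 = (T.singularValues (n - 1) * ‖v‖) ^ 2 := by
    have h2 : inner ℂ v ((LinearMap.adjoint T ∘ₗ T) v) = inner ℂ (T v) (T v) := by
      rw [LinearMap.comp_apply, LinearMap.adjoint_inner_right]
    rw [hv.apply_eq_smul, inner_smul_right, inner_self_eq_norm_sq_to_K,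
      inner_self_eq_norm_sq_to_K] at h2
    rw [mul_pow]
    exact_mod_cast h2.symm
  have h2 : ‖T v‖ = T.singularValues (n - 1) * ‖v‖ :=
    (sq_eq_sq₀ (norm_nonneg _) (mul_nonneg (T.singularValues_nonneg _) hv0.le)).1 h1
  have hc : ‖(((‖v‖)⁻¹ : ℝ) : ℂ)‖ = ‖v‖⁻¹ := by
    rw [Complex.norm_real, Real.norm_of_nonneg (by positivity)]
  refine ⟨(((‖v‖)⁻¹ : ℝ) : ℂ) • v.ofLp, ?_, ?_⟩
  · rw [l2_smul, hc, l2_eq_norm, WithLp.toLp_ofLp, inv_mul_cancel₀ hv0.ne']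
  · have h3 : l2 (A.mulVec v.ofLp) = ‖T v‖ := by
      rw [l2_eq_norm]; rfl
    rw [Matrix.mulVec_smul, l2_smul, hc, h3, h2, smallestSingularValue]
    rw [← hT, mul_comm, mul_assoc, mul_inv_cancel₀ hv0.ne', mul_one]

lemma opBound_spectralNorm2 {n : ℕ} (A : Matrix (Fin n) (Fin n) ℂ) :
    OpBound A (spectralNorm2 A) := by
  intro x
  rw [l2_eq_norm, l2_eq_norm]
  exact (Matrix.toEuclideanCLM (n := Fin n) (𝕜 := ℂ) A).le_opNorm (WithLp.toLp 2 x)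

section

variable {Ω : Type*} [MeasurableSpace Ω] {P : Measure Ω} {n : ℕ}
  {X : Ω → Matrix (Fin n) (Fin n) ℝ} {ρ M₄ : ℝ}

/-- The sign of the correlation plays no role: the covariance is bounded below by `1 - |ρ|`. -/
lemma ConditionC0.ellipticEntries (hX : ConditionC0 P X ρ M₄) :
    EllipticEntries P (fun ω i j => X ω i j) |ρ| M₄ where
  indep := hX.pairs_indep
  moments := fun i j hij =>
    { measurable_left := hX.measurable i j
      measurable_right := hX.measurable j i
      memLp_left := hX.memLp_four i j hij
      memLp_right := hX.memLp_four j i hij.symm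
      mean_left := hX.mean_eq_zero i j hij
      mean_right := hX.mean_eq_zero j i hij.symm
      var_left := hX.second_moment i j hij
      var_right := hX.second_moment j i hij.symm
      fourth_left := hX.fourth_moment i j hij
      fourth_right := hX.fourth_moment j i hij.symm
      corr := by rw [hX.correlation i j hij] }

/-- A bound which is uniform over the deterministic diagonals holds for an independent random
diagonal. -/
lemma ConditionC0.measureReal_le_of_diag [IsProbabilityMeasure P] (hX : ConditionC0 P X ρ M₄)
    (z : ℂ) (κ r : ℝ) {c : ℝ} (hc : 0 ≤ c)
    (h : ∀ d : Fin n → ℂ, P.real {ω | OpBound (withDiag (X ω) d) κ ∧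
      ∃ x, l2 x = 1 ∧ l2 ((withDiag (X ω) d).mulVec x) ≤ r} ≤ c) :
    P.real {ω | OpBound (withDiag (X ω) fun i => X ω i i - z) κ ∧
      ∃ x, l2 x = 1 ∧ l2 ((withDiag (X ω) fun i => X ω i i - z).mulVec x) ≤ r} ≤ c := by
  set O : Ω → {p : Fin n × Fin n // p.1 ≠ p.2} → ℝ := fun ω p => X ω p.1.1 p.1.2 with hO
  set D : Ω → Fin n → ℝ := fun ω i => X ω i i with hD
  have hOm : Measurable O := measurable_pi_lambda _ fun p => hX.measurable _ _
  have hDm : Measurable D := measurable_pi_lambda _ fun i => hX.measurable i i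
  set Y : ({p : Fin n × Fin n // p.1 ≠ p.2} → ℝ) → Fin n → Fin n → ℝ := fun o i j =>
    if h : i = j then 0 else o ⟨(i, j), h⟩ with hY
  have hYX : ∀ ω d, withDiag (Y (O ω)) d = withDiag (X ω) d := fun ω d =>
    withDiag_congr (fun i j hij => by simp only [hY, hO]; rw [dif_neg hij]) d
  have hA : ∀ i j, Measurable fun q : ({p : Fin n × Fin n // p.1 ≠ p.2} → ℝ) × (Fin n → ℝ) =>
      withDiag (Y q.1) (fun i => (q.2 i : ℂ) - z) i j := by
    intro i j
    by_cases hij : i = j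
    · simp only [withDiag, Matrix.of_apply, if_pos hij]
      fun_prop
    · simp only [withDiag, Matrix.of_apply, if_neg hij, hY, dif_neg hij]
      fun_prop
  set W : Set (({p : Fin n × Fin n // p.1 ≠ p.2} → ℝ) × (Fin n → ℝ)) :=
    {q | OpBound (withDiag (Y q.1) fun i => (q.2 i : ℂ) - z) κ ∧
      ∃ x, l2 x = 1 ∧ l2 ((withDiag (Y q.1) fun i => (q.2 i : ℂ) - z).mulVec x) ≤ r} with hW
  have hWm : MeasurableSet W :=
    (measurableSet_opBound hA κ).inter (measurableSet_exists_small_image hA r)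
  have hlaw : P.map (fun ω => (O ω, D ω)) = (P.map O).prod (P.map D) :=
    (indepFun_iff_map_prod_eq_prod_map_map hOm.aemeasurable hDm.aemeasurable).1
      hX.diag_indep_offDiag.symm
  have := Measure.isProbabilityMeasure_map (μ := P) hOm.aemeasurable
  have := Measure.isProbabilityMeasure_map (μ := P) hDm.aemeasurable
  -- The law of the matrix is the product of the laws of its off-diagonal part and of its diagonal,
  -- and every section at a fixed diagonal has probability at most `c`.
  have h1 := measureReal_prod_le_of_section_le (P.map O) (P.map D) hWm (D := ∅)
    MeasurableSet.empty (c := c) (fun g _ => ?_) hc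
  · rw [← hlaw, map_measureReal_apply (hOm.prodMk hDm) hWm, measureReal_empty, zero_add] at h1
    convert h1 using 2
    ext ω
    simp only [hW, Set.mem_preimage, Set.mem_ofPred_eq, hYX, hD]
  · have hsm : MeasurableSet {o | (o, g) ∈ W} := measurable_prodMk_right hWm
    rw [map_measureReal_apply hOm hsm]
    convert h fun i => (g i : ℂ) - z using 2
    ext ω
    simp only [hW, Set.mem_preimage, Set.mem_ofPred_eq, hYX]

end

lemma shiftedMatrix_eq_withDiag {n : ℕ} (X : Matrix (Fin n) (Fin n) ℝ) (z : ℂ) :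
    shiftedMatrix X z = withDiag X fun i => X i i - z := by
  ext i j
  by_cases h : i = j
  · subst h; simp [shiftedMatrix, withDiag]
  · simp [shiftedMatrix, withDiag, h]

theorem mainTheorem2 (ρ K M₄ : ℝ) (hρ : |ρ| < 1) (hK : 1 < K) :
    ∃ C C₁ : ℝ, 0 < C ∧ 0 < C₁ ∧
      ∀ (Ω : Type*) [MeasurableSpace Ω] (P : Measure Ω) [IsProbabilityMeasure P]
        (n : ℕ) (_ : 1 ≤ n) (X : Ω → Matrix (Fin n) (Fin n) ℝ) (_ : ConditionC0 P X ρ M₄)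
        (z : ℂ) (ε : ℝ) (_ : 0 < ε),
        P.real {ω | smallestSingularValue (shiftedMatrix (X ω) z) ≤ ε * (n : ℝ) ^ (-(1 / 2) : ℝ) ∧
            spectralNorm2 (shiftedMatrix (X ω) z) ≤ 3 * K * √(n : ℝ)}
          ≤ C * ε ^ (1 / 8 : ℝ) + C₁ * (n : ℝ) ^ (-(1 / 8) : ℝ) := by
  obtain ⟨C, hC, H⟩ := exists_small_image_le (abs_nonneg ρ) hρ M₄ (K := 3 * K) (by positivity)
  -- The added `1` makes the bound trivial for `ε > 1`, where the estimate for small `ε` is not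
  -- available.
  refine ⟨C + 1, C, by positivity, hC, fun Ω _ P _ n hn X hX z ε hε => ?_⟩
  have hn0 : (0 : ℝ) < n := by exact_mod_cast hn
  have hν : 0 < C * (n : ℝ) ^ (-(1 / 8) : ℝ) := by positivity
  have hη : 0 < ε ^ (1 / 8 : ℝ) := by positivity
  by_cases hε1 : 1 < ε
  · refine measureReal_le_one.trans ?_
    have h1 : 1 ≤ ε ^ (1 / 8 : ℝ) := Real.one_le_rpow hε1.le (by norm_num)
    nlinarith
  rw [not_lt] at hε1
  have : Nonempty (Fin n) := ⟨⟨0, hn⟩⟩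
  have h1 := hX.measureReal_le_of_diag z (3 * K * √n) (ε / √n)
    (c := C * (ε ^ (1 / 8 : ℝ) + (n : ℝ) ^ (-(1 / 8) : ℝ))) (by positivity)
    fun d => by
      have h2 := H Ω P (Fin n) (fun ω i j => X ω i j) hX.ellipticEntries d ε hε hε1
      rw [Fintype.card_fin] at h2
      exact h2
  refine (measureReal_mono ?_ (measure_ne_top _ _)).trans (h1.trans ?_)
  · rintro ω ⟨h2, h3⟩
    rw [shiftedMatrix_eq_withDiag] at h2 h3
    obtain ⟨x, hx1, hx⟩ := exists_l2_mulVec_eq_smallestSingularValue hn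
      (withDiag (X ω) fun i => X ω i i - z)
    refine ⟨fun y => (opBound_spectralNorm2 _ y).trans
      (mul_le_mul_of_nonneg_right h3 (l2_nonneg y)), x, hx1, hx.trans_le (h2.trans_eq ?_)⟩
    rw [Real.rpow_neg hn0.le, ← Real.sqrt_eq_rpow, div_eq_mul_inv]
  · rw [mul_add, add_mul]
    linarith
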